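/- Write $\lg=\log_2$. For $4\le n\le m$ let $b=\lceil \lg m\rceil$ and $\ell=\lfloor\lg (m/n)\rfloor$, and let $A[0]\le A[1]\le\dots\le A[n-1]$ be a sorted list of $n$ integers from the universe $[0,m-1]$. The plain format of the list is the array of $n$ cells of $b$ bits each whose $i$-th cell holds $A[i]$. Its compact format is an array of the same shape which, read as a string of $nb$ bits (cell after cell, most significant bit first), consists of the Elias–Fano encoding of the list, that is, the $\ell$ least significant bits of $A[0],\dots,A[n-1]$ one after the other, followed by the bit vector whose ones are at the positions $\lfloor A[i]/2^{\ell}\rfloor+i$ ($0\le i<n$), and then of zeros only. The machine is a word RAM whose words have $w$ bits, for any $w$ with $m<2^w$ and $nb<2^w$. A program has a constant number of registers of $w$ bits each. In one step it carries out an arithmetic, shift, bitwise or comparison operation on registers, loads or stores one $b$-bit cell of the array, reads one cell of a read-only table, or tests a register. The numbers $n,m,b$ are given in registers. Theorem. There are three fixed programs (encode, decode, access), independent of $n,m,w$ and of the list, a constant $C$, and a function $f(n)=o(n)$ such that, for all $4\le n\le m$, all such $w$ and all sorted lists $A$ of $n$ integers from $[0,m-1]$: 1. the last $n\lg n-2n$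 bits of the compact format are all zero (that is, every bit whose $0$-based position $j<nb$ satisfies $j\ge nb-(n\lg n-2n)$); 2. encode turns the plain format into the compact format, and decode turns the compact format into the plain format, each in place (no memory besides the array and the registers) and in at most $Cn$ steps; 3. there is an auxiliary structure of at most $f(n)$ bits, namely a read-only table of $\lceil\lg n\rceil$-bit cells, such that for each $i<n$ access, given $i$, the compact format and this table, computes $A[i]$ in at most $C$ steps and leaves the compact format as it was. The extra space of the programs is $O(1)$ words. It is $O(\lg n)$ bits when $m$ is polynomially bounded in $n$: for each $d$ there is a $D$ such that for all $4\le n\le m\le n^d$ some admissible word size $w$ makes the total size of all the registers that occur in the three programs at most $D\lg n$ bits. -/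

import Mathlib

/-! A word RAM with word size `w`. It has finitely many `w`-bit registers (those which its program
mentions), an array of `b`-bit cells that it may read and overwrite, and a read-only table. -/

namespace WordRAM

/-- Unit-cost binary operations on machine words; comparisons return `0` or `1`. -/
inductive Op where
  | add | sub | mul | div | mod | shl | shr | and | or | xor | lt | eq

/-- Value of an operation before reduction to `w` bits (`sub` is cut off at `0`). -/
def Op.eval : Op → ℕ → ℕ → ℕ
  | .add, x, y => x + y
  | .sub, x, y => x - y
  | .mul, x, y => x * y
  | .div, x, y => x / y
  | .mod, x, y => x % y
  | .shl, x, y => x <<< y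
  | .shr, x, y => x >>> y
  | .and, x, y => x &&& y
  | .or, x, y => x ||| y
  | .xor, x, y => x ^^^ y
  | .lt, x, y => if x < y then 1 else 0
  | .eq, x, y => if x = y then 1 else 0

/-- Programs. The arguments of type `ℕ` are register names, except the literal in `const`. -/
inductive Cmd where
  | skip : Cmd
  /-- `r := c` for a literal `c` -/
  | const (r c : ℕ) : Cmd
  /-- `r := s ∘ t` for the operation `o` -/
  | op (o : Op) (r s t : ℕ) : Cmd
  /-- `r := array[s]` -/
  | load (r s : ℕ) : Cmd
  /-- `array[r] := s` -/
  | store (r s : ℕ) : Cmd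
  /-- `r := table[s]` -/
  | lookup (r s : ℕ) : Cmd
  | seq (p q : Cmd) : Cmd
  /-- if register `r` is nonzero then `p` else `q` -/
  | ite (r : ℕ) (p q : Cmd) : Cmd
  /-- while register `r` is nonzero do `p` -/
  | loop (r : ℕ) (p : Cmd) : Cmd

/-- The registers that a program mentions. -/
def Cmd.regs : Cmd → Finset ℕ
  | .skip => ∅
  | .const r _ => {r}
  | .op _ r s t => {r, s, t}
  | .load r s => {r, s}
  | .store r s => {r, s}
  | .lookup r s => {r, s}
  | .seq p q => p.regs ∪ q.regs
  | .ite r p q => insert r (p.regs ∪ q.regs)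
  | .loop r p => insert r p.regs

structure State where
  reg : ℕ → ℕ
  arr : List ℕ
  table : List ℕ

/-- Write the `w` low-order bits of `v` into register `r`. -/
def State.setReg (w : ℕ) (σ : State) (r v : ℕ) : State :=
  { σ with reg := Function.update σ.reg r (v % 2 ^ w) }

/-- Write the `b` low-order bits of `v` into array cell `i`; no effect outside the array. -/
def State.setArr (b : ℕ) (σ : State) (i v : ℕ) : State :=
  { σ with arr := σ.arr.set i (v % 2 ^ b) }

/-- `Exec w b p σ τ t`: with word size `w` and cell width `b`, the program `p` started in state `σ`
halts in state `τ` after `t` steps. Reads outside the array or the table give `0`. -/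
inductive Exec (w b : ℕ) : Cmd → State → State → ℕ → Prop where
  | skip (σ : State) : Exec w b .skip σ σ 1
  | const (σ : State) (r c : ℕ) : Exec w b (.const r c) σ (σ.setReg w r c) 1
  | op (σ : State) (o : Op) (r s t : ℕ) :
      Exec w b (.op o r s t) σ (σ.setReg w r (o.eval (σ.reg s) (σ.reg t))) 1
  | load (σ : State) (r s : ℕ) :
      Exec w b (.load r s) σ (σ.setReg w r (σ.arr.getD (σ.reg s) 0)) 1
  | store (σ : State) (r s : ℕ) :
      Exec w b (.store r s) σ (σ.setArr b (σ.reg r) (σ.reg s)) 1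
  | lookup (σ : State) (r s : ℕ) :
      Exec w b (.lookup r s) σ (σ.setReg w r (σ.table.getD (σ.reg s) 0)) 1
  | seq {p q : Cmd} {σ τ υ : State} {t u : ℕ} :
      Exec w b p σ τ t → Exec w b q τ υ u → Exec w b (.seq p q) σ υ (t + u)
  | iteTrue {r : ℕ} {p : Cmd} (q : Cmd) {σ τ : State} {t : ℕ} :
      σ.reg r ≠ 0 → Exec w b p σ τ t → Exec w b (.ite r p q) σ τ (t + 1)
  | iteFalse {r : ℕ} (p : Cmd) {q : Cmd} {σ τ : State} {t : ℕ} :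
      σ.reg r = 0 → Exec w b q σ τ t → Exec w b (.ite r p q) σ τ (t + 1)
  | loopDone {r : ℕ} (p : Cmd) {σ : State} :
      σ.reg r = 0 → Exec w b (.loop r p) σ σ 1
  | loopStep {r : ℕ} {p : Cmd} {σ τ υ : State} {t u : ℕ} :
      σ.reg r ≠ 0 → Exec w b p σ τ t → Exec w b (.loop r p) τ υ u →
        Exec w b (.loop r p) σ υ (t + u + 1)

/-- Start state: the inputs `xs` in registers `0, 1, …`, and `0` in all other registers. -/
def start (xs arr table : List ℕ) : State where
  reg := fun r => xs.getD r 0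
  arr := arr
  table := table

end WordRAM

namespace EliasFano

/-- The number `⌈lg m⌉` of bits of a cell that stores an element of the universe `[0, m-1]`. -/
def cellWidth (m : ℕ) : ℕ := Nat.clog 2 m

/-- `w`-bit words can hold the elements and the size of the universe `[0, m-1]`, and the address of
each bit of an array of `n` such elements. -/
def WordFits (n m w : ℕ) : Prop := m < 2 ^ w ∧ n * cellWidth m < 2 ^ w

/-- The `j`-th bit of an array of `b`-bit cells, read as the concatenation of its cells, each with
its most significant bit first. -/
def arrayBit (b : ℕ) (Z : List ℕ) (j : ℕ) : Bool :=
  (Z.getD (j / b) 0).testBit (b - 1 - j % b)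

/-- The array of `n` cells of `b` bits whose `j`-th bit is `f j`. -/
def packBits (b n : ℕ) (f : ℕ → Bool) : List ℕ :=
  (List.range n).map fun c =>
    ∑ k ∈ Finset.range b, if f (c * b + k) then 2 ^ (b - 1 - k) else 0

/-- The number `⌊lg (m / n)⌋` of low-order bits of each element that are stored verbatim. -/
def lowWidth (n m : ℕ) : ℕ := Nat.log 2 (m / n)

/-- The bit vector of the high-order parts: its ones are at the positions `⌊A[i] / 2 ^ l⌋ + i`. -/
def upperBit (l : ℕ) (A : List ℕ) (j : ℕ) : Bool :=
  decide (∃ i < A.length, A.getD i 0 / 2 ^ l + i = j)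

/-- Elias–Fano encoding of a list over `[0, m-1]`: the `l` low-order bits of the elements, one
element after the other, and then the bit vector of the high-order parts, followed by zeros. -/
def bit (m : ℕ) (A : List ℕ) (j : ℕ) : Bool :=
  let l := lowWidth A.length m
  if j < A.length * l then (A.getD (j / l) 0).testBit (l - 1 - j % l)
  else upperBit l A (j - A.length * l)

/-- The compact format of `A`: its Elias–Fano encoding, in an array of the same shape as `A`. -/
def compact (m : ℕ) (A : List ℕ) : List ℕ :=
  packBits (cellWidth m) A.length (bit m A)

/-- Sorted lists of `n` integers from the universe `[0, m-1]`. -/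
def IsSortedList (n m : ℕ) (A : List ℕ) : Prop :=
  A.length = n ∧ A.Pairwise (· ≤ ·) ∧ ∀ x ∈ A, x < m

end EliasFano

/-! Write `l` for the number of low-order bits, `b` for the cell width and `L` for the rounded-up
binary logarithm of `n`.

Zeros. Put `m = 2^l * n * r` with `1 ≤ r ≤ 2`. The last one of the bit vector lies before `n*l + r*n
+ n`, and `b ≥ lg m = l + lg n + lg r`. So all ones avoid the last `n lg n - 2n` bits as soon as `r
- 1 ≤ lg r`, which holds on `[1, 2]` by concavity (`sub_one_le_logb`, `EliasFano.high_add_lt_real`).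

Conversion in place. The difficulty is to find room for the bit vector while the high-order parts,
from which it is computed, are still needed. A sorted sequence of numbers below a constant is
determined by constantly many counters, which fit into registers (`countLE_le_iff`, `Ev.top`). If `n
< 64`, the high-order parts are below `2n < 128`; the counters hold them completely, and the leading
`b - l` bits of every cell are free. If `n ≥ 64`, the counters hold the three leading bits of every
cell. This frees exactly the `3n` bits that the vector needs, and a high-order part is still
available from the counters and the untouched middle bits (`Ev.highPart`). Once the vector stands in
the leading bits, the middle bits are obsolete, and the low-order bits and the vector fit into the
trailing `b - 3` bits of the cells, because `l + 6 ≤ b`; from there both are moved to the front.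
Every move towards the front copies in ascending order, so nothing is overwritten before it has been
read. Decoding runs the moves backwards in descending order, scans the vector, and thereby regains
counters and middle bits (`runs_encodeLarge`, `runs_decodeLarge`).

Access. The high-order part of `A[i]` is the position of the `i`-th one minus `i`, so a
constant-time select structure of `o(n)` bits is needed. Take `φ` about `4 lg L`. Ones are grouped
by `L * φ^2`, and again by `φ^2`. A group spread over many positions (`L^3`, respectively `φ^4`) is
sparse: few groups are sparse, so all their answers are stored, and such a group is found through
the block of positions in which it starts (`EliasFano.sparseGroup_eq`). Inside a large group that is
not sparse all differences have at most `φ` bits, and are packed. A small group that is not sparse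
lies within `φ^4 ≤ L` bits, which are read at once and looked up in a table of all patterns.
Everything together takes `O(n / φ)` bits (`EliasFano.Sizes.streamLength_mul_le`). Finitely many `n`
are too small for these estimates; for them all positions are listed.

Programs are written in a language of expressions and loops with a Hoare calculus that counts steps
(`Runs`, `Ev`). Arrays are treated throughout as bit strings, with views for the bits at fixed
places of all cells. -/

namespace WordRAM

/-! ### A small expression language on top of the word RAM -/

/-- Side-effect free expressions over program variables, the array and the table. -/
inductive Expr where
  | var (r : ℕ)
  | lit (c : ℕ)
  | bin (o : Op) (e f : Expr)
  | cell (e : Expr)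
  | look (e : Expr)
  | cond (c e f : Expr)

/-- Value of an expression over the natural numbers, without reduction to the word size. -/
def Expr.eval (s : State) : Expr → ℕ
  | .var r => s.reg r
  | .lit c => c
  | .bin o e f => o.eval (e.eval s) (f.eval s)
  | .cell e => s.arr.getD (e.eval s) 0
  | .look e => s.table.getD (e.eval s) 0
  | .cond c e f => if c.eval s ≠ 0 then e.eval s else f.eval s

/-- No intermediate result overflows a `w`-bit word. -/
def Expr.Fits (w : ℕ) (s : State) : Expr → Prop
  | .var _ => True
  | .lit c => c < 2 ^ w
  | .bin o e f => e.Fits w s ∧ f.Fits w s ∧ o.eval (e.eval s) (f.eval s) < 2 ^ w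
  | .cell e => e.Fits w s
  | .look e => e.Fits w s
  | .cond c e f => c.Fits w s ∧ (c.eval s ≠ 0 → e.Fits w s) ∧ (c.eval s = 0 → f.Fits w s)

/-- The register of a program variable. -/
def vreg (r : ℕ) : ℕ := if r < 4 then r else 2 * r

/-- The registers of intermediate results. -/
def treg (k : ℕ) : ℕ := 2 * k + 5

theorem vreg_inj {r s : ℕ} (h : vreg r = vreg s) : r = s := by
  unfold vreg at h; split_ifs at h <;> omega

/-- Temporaries are the odd registers from 5 on. Variables are the registers 0 to 3, where the
inputs arrive, and even registers, so evaluating an expression never disturbs a variable. -/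
theorem vreg_ne_treg (r k : ℕ) : vreg r ≠ treg k := by
  unfold vreg treg; split_ifs <;> omega

/-- Code that leaves the value of an expression in register `treg k`. -/
def Expr.compile : Expr → ℕ → Cmd
  | .var r, k => .op .or (treg k) (vreg r) (vreg r)
  | .lit c, k => .const (treg k) c
  | .bin o e f, k => .seq (e.compile k) (.seq (f.compile (k + 1))
      (.op o (treg k) (treg k) (treg (k + 1))))
  | .cell e, k => .seq (e.compile k) (.load (treg k) (treg k))
  | .look e, k => .seq (e.compile k) (.lookup (treg k) (treg k))
  | .cond c e f, k => .seq (c.compile k) (.ite (treg k) (e.compile k) (f.compile k))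

/-- Bound on the running time of the code of an expression. -/
def Expr.cost : Expr → ℕ
  | .var _ => 1
  | .lit _ => 1
  | .bin _ e f => e.cost + f.cost + 1
  | .cell e => e.cost + 1
  | .look e => e.cost + 1
  | .cond c e f => c.cost + e.cost + f.cost + 1

/-- The contents of registers, array and table respect the word and cell sizes. -/
structure WF (w b : ℕ) (s : State) : Prop where
  le : b ≤ w
  reg : ∀ r, s.reg r < 2 ^ w
  arr : ∀ x ∈ s.arr, x < 2 ^ b
  table : ∀ x ∈ s.table, x < 2 ^ w

theorem getD_lt {l : List ℕ} {N : ℕ} (h : ∀ x ∈ l, x < N) (hN : 0 < N) (i : ℕ) :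
    l.getD i 0 < N := by
  rw [List.getD_eq_getElem?_getD]
  rcases hi : l[i]? with _ | x
  · simpa using hN
  · simpa using h x (List.mem_of_getElem? hi)

theorem WF.cell_lt {w b : ℕ} {s : State} (h : WF w b s) (i : ℕ) : s.arr.getD i 0 < 2 ^ b :=
  getD_lt h.arr (by positivity) i

theorem WF.cell_lt' {w b : ℕ} {s : State} (h : WF w b s) (i : ℕ) : s.arr.getD i 0 < 2 ^ w :=
  (h.cell_lt i).trans_le (Nat.pow_le_pow_right (by norm_num) h.le)

theorem WF.look_lt {w b : ℕ} {s : State} (h : WF w b s) (i : ℕ) : s.table.getD i 0 < 2 ^ w :=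
  getD_lt h.table (by positivity) i

/-- The program variables, with array and table. -/
def State.abs (σ : State) : State := { σ with reg := fun r => σ.reg (vreg r) }

theorem WF.abs {w b : ℕ} {σ : State} (h : WF w b σ) : WF w b σ.abs :=
  ⟨h.le, fun _ => h.reg _, h.arr, h.table⟩

theorem WF.setReg {w b : ℕ} {σ : State} (h : WF w b σ) (r v : ℕ) : WF w b (σ.setReg w r v) := by
  refine ⟨h.le, fun q => ?_, h.arr, h.table⟩
  by_cases hq : q = r
  · subst hq; simpa [State.setReg] using Nat.mod_lt v (by positivity)
  · simpa [State.setReg, Function.update_of_ne hq] using h.reg q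

theorem WF.setArr {w b : ℕ} {σ : State} (h : WF w b σ) (i v : ℕ) : WF w b (σ.setArr b i v) := by
  refine ⟨h.le, h.reg, fun x hx => ?_, h.table⟩
  rcases List.mem_or_eq_of_mem_set hx with hx | rfl
  · exact h.arr x hx
  · exact Nat.mod_lt v (by positivity)

theorem Expr.eval_lt {w b : ℕ} {s : State} (h : WF w b s) (e : Expr)
    (he : e.Fits w s) :
    e.eval s < 2 ^ w := by
  induction e with
  | var _ => exact h.reg _
  | lit c => exact he
  | bin o e f _ _ => exact he.2.2
  | cell e _ => exact h.cell_lt' _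
  | look e _ => exact h.look_lt _
  | cond c e f _ ih1 ih2 =>
    simp only [Expr.eval]
    split_ifs with hc
    · exact ih1 (he.2.1 hc)
    · exact ih2 (he.2.2 (not_not.mp hc))

/-- `τ` arises from `σ` by changing registers of intermediate results from number `k` on. -/
structure Frame (k : ℕ) (σ τ : State) : Prop where
  arr : τ.arr = σ.arr
  table : τ.table = σ.table
  reg : ∀ r, (∀ j, k ≤ j → r ≠ treg j) → τ.reg r = σ.reg r

theorem Frame.abs {k : ℕ} {σ τ : State} (h : Frame k σ τ) : τ.abs = σ.abs := by
  unfold State.abs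
  rw [h.arr, h.table]
  congr 1
  funext r
  exact h.reg _ fun j _ => vreg_ne_treg r j

theorem Frame.trans {j k : ℕ} {σ τ υ : State} (h : Frame j σ τ) (h' : Frame k τ υ) (hjk : j ≤ k) :
    Frame j σ υ :=
  ⟨h'.arr.trans h.arr, h'.table.trans h.table, fun r hr =>
    (h'.reg r fun i hi => hr i (hjk.trans hi)).trans (h.reg r hr)⟩

theorem Frame.setReg (w k : ℕ) (σ : State) (v : ℕ) : Frame k σ (σ.setReg w (treg k) v) :=
  ⟨rfl, rfl, fun r hr => by simp [State.setReg, Function.update_of_ne (hr k le_rfl)]⟩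

theorem setReg_self (w r v : ℕ) (σ : State) : (σ.setReg w r v).reg r = v % 2 ^ w := by
  simp [State.setReg]

/-- The second operand is computed in temporaries from `k + 1` on, so the first one survives in
`treg k`. As nothing overflows, the reductions modulo `2 ^ w` have no effect and the machine agrees
with the arithmetic of natural numbers. -/
theorem Expr.exec_compile {w b : ℕ} (e : Expr) : ∀ (k : ℕ) (σ : State), WF w b σ →
    e.Fits w σ.abs → ∃ τ t, Exec w b (e.compile k) σ τ t ∧ t ≤ e.cost ∧ WF w b τ ∧
      Frame k σ τ ∧ τ.reg (treg k) = e.eval σ.abs := by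
  induction e with
  | var _ =>
    intro k σ h he
    refine ⟨_, 1, Exec.op σ _ _ _ _, le_rfl, h.setReg _ _, Frame.setReg _ _ _ _, ?_⟩
    rw [setReg_self, Op.eval, Nat.or_self, Nat.mod_eq_of_lt (h.reg _)]
    rfl
  | lit c =>
    intro k σ h he
    refine ⟨_, 1, Exec.const σ _ _, le_rfl, h.setReg _ _, Frame.setReg _ _ _ _, ?_⟩
    rw [setReg_self, Nat.mod_eq_of_lt he]
    rfl
  | bin o e f ih1 ih2 =>
    intro k σ h he
    obtain ⟨τ, t, x1, ht, h1, f1, e1⟩ := ih1 k σ h he.1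
    obtain ⟨υ, u, x2, hu, h2, f2, e2⟩ := ih2 (k + 1) τ h1 (by rw [f1.abs]; exact he.2.1)
    refine ⟨_, _, Exec.seq x1 (Exec.seq x2 (Exec.op υ o _ _ _)), ?_, h2.setReg _ _,
      (f1.trans f2 (by omega)).trans (Frame.setReg _ _ _ _) le_rfl, ?_⟩
    · simp only [Expr.cost]; omega
    · have : υ.reg (treg k) = τ.reg (treg k) :=
        f2.reg _ fun j hj => by unfold treg; omega
      rw [setReg_self, this, e1, e2, f1.abs, Nat.mod_eq_of_lt he.2.2]
      rfl
  | cell e ih =>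
    intro k σ h he
    obtain ⟨τ, t, x1, ht, h1, f1, e1⟩ := ih k σ h he
    refine ⟨_, _, Exec.seq x1 (Exec.load τ _ _), ?_, h1.setReg _ _,
      f1.trans (Frame.setReg _ _ _ _) le_rfl, ?_⟩
    · simp only [Expr.cost]; omega
    · rw [setReg_self, e1, Nat.mod_eq_of_lt (h1.cell_lt' _), f1.arr]
      rfl
  | look e ih =>
    intro k σ h he
    obtain ⟨τ, t, x1, ht, h1, f1, e1⟩ := ih k σ h he
    refine ⟨_, _, Exec.seq x1 (Exec.lookup τ _ _), ?_, h1.setReg _ _,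
      f1.trans (Frame.setReg _ _ _ _) le_rfl, ?_⟩
    · simp only [Expr.cost]; omega
    · rw [setReg_self, e1, Nat.mod_eq_of_lt (h1.look_lt _), f1.table]
      rfl
  | cond c e f ih0 ih1 ih2 =>
    intro k σ h he
    obtain ⟨τ, t, x1, ht, h1, f1, e1⟩ := ih0 k σ h he.1
    by_cases hc : c.eval σ.abs = 0
    · obtain ⟨υ, u, x2, hu, h2, f2, e2⟩ := ih2 k τ h1 (by rw [f1.abs]; exact he.2.2 hc)
      refine ⟨υ, _, Exec.seq x1 (Exec.iteFalse _ (e1.trans hc) x2), ?_, h2,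
        f1.trans f2 le_rfl, ?_⟩
      · simp only [Expr.cost]; omega
      · rw [e2, f1.abs]; simp [Expr.eval, hc]
    · obtain ⟨υ, u, x2, hu, h2, f2, e2⟩ := ih1 k τ h1 (by rw [f1.abs]; exact he.2.1 hc)
      refine ⟨υ, _, Exec.seq x1 (Exec.iteTrue _ (by rwa [e1]) x2), ?_, h2,
        f1.trans f2 le_rfl, ?_⟩
      · simp only [Expr.cost]; omega
      · rw [e2, f1.abs]; simp [Expr.eval, hc]

/-! ### Statements -/

/-- Assignment to a program variable. -/
def assign (r : ℕ) (e : Expr) : Cmd := .seq (e.compile 0) (.op .or (vreg r) (treg 0) (treg 0))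

/-- Assignment to the array cell with index `e`. -/
def setCell (e f : Expr) : Cmd :=
  .seq (e.compile 0) (.seq (f.compile 1) (.store (treg 0) (treg 1)))

/-- Conditional statement. -/
def branch (e : Expr) (p q : Cmd) : Cmd := .seq (e.compile 0) (.ite (treg 0) p q)

/-- Loop with a condition that is tested before each round. -/
def loopWhile (e : Expr) (p : Cmd) : Cmd :=
  .seq (e.compile 0) (.loop (treg 0) (.seq p (e.compile 0)))

/-- `x := v` for a program variable `x`. -/
def State.set (s : State) (r v : ℕ) : State := { s with reg := Function.update s.reg r v }

@[simp] theorem State.set_arr (s : State) (r v : ℕ) : (s.set r v).arr = s.arr := rfl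
@[simp] theorem State.set_table (s : State) (r v : ℕ) : (s.set r v).table = s.table := rfl
@[simp] theorem State.set_reg_self (s : State) (r v : ℕ) : (s.set r v).reg r = v := by
  simp [State.set]
theorem State.set_reg_of_ne (s : State) {r q : ℕ} (v : ℕ) (h : q ≠ r) :
    (s.set r v).reg q = s.reg q := by
  simp [State.set, h]
theorem State.set_reg (s : State) (r q v : ℕ) :
    (s.set r v).reg q = if q = r then v else s.reg q := by
  simp [State.set, Function.update_apply]

/-- Started with program variables, array and table as in `s`, the program `p` halts after at most
`T` steps in a state that satisfies `Q`. -/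
def Runs (w b : ℕ) (p : Cmd) (s : State) (T : ℕ) (Q : State → Prop) : Prop :=
  ∀ σ : State, WF w b σ → σ.abs = s → ∃ τ t, Exec w b p σ τ t ∧ t ≤ T ∧ WF w b τ ∧ Q τ.abs

variable {w b : ℕ} {p q : Cmd} {s : State} {T T' : ℕ} {Q R : State → Prop}

/-- Overflow conditions follow from the size bounds on registers and cells, which every admissible
start state supplies; so they may be assumed when a triple is proved. -/
theorem Runs.of_wf (h : WF w b s → Runs w b p s T Q) : Runs w b p s T Q :=
  fun σ hσ hs => h (hs ▸ hσ.abs) σ hσ hs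

theorem Runs.mono (h : Runs w b p s T Q) (hT : T ≤ T') (hQ : ∀ s', WF w b s' → Q s' → R s') :
    Runs w b p s T' R := fun σ hσ hs => by
  obtain ⟨τ, t, x, ht, hw, hq⟩ := h σ hσ hs
  exact ⟨τ, t, x, ht.trans hT, hw, hQ _ hw.abs hq⟩

theorem Runs.seq (h : Runs w b p s T R) (h' : ∀ s', WF w b s' → R s' → Runs w b q s' T' Q) :
    Runs w b (.seq p q) s (T + T') Q := fun σ hσ hs => by
  obtain ⟨τ, t, x, ht, hw, hr⟩ := h σ hσ hs
  obtain ⟨υ, u, y, hu, hw', hq⟩ := h' _ hw.abs hr τ hw rfl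
  exact ⟨υ, _, x.seq y, by omega, hw', hq⟩

theorem Runs.skip (h : Q s) : Runs w b .skip s 1 Q := fun σ hσ hs =>
  ⟨σ, 1, .skip σ, le_rfl, hσ, hs ▸ h⟩

theorem runs_assign {r : ℕ} {e : Expr} (he : e.Fits w s) (hQ : Q (s.set r (e.eval s))) :
    Runs w b (assign r e) s (e.cost + 1) Q := fun σ hσ hs => by
  subst hs
  obtain ⟨τ, t, x, ht, hw, hf, hv⟩ := e.exec_compile 0 σ hσ he
  refine ⟨_, _, x.seq (Exec.op τ _ _ _ _), by omega, hw.setReg _ _, ?_⟩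
  convert hQ using 1
  unfold State.abs State.setReg State.set
  simp only [hf.arr, hf.table, Op.eval, Nat.or_self, hv,
    Nat.mod_eq_of_lt (Expr.eval_lt hσ.abs e he)]
  congr 1
  funext q
  by_cases hq : q = r
  · subst hq; simp [State.abs]
  · rw [Function.update_of_ne hq, Function.update_of_ne fun h => hq (vreg_inj h)]
    exact hf.reg _ fun j _ => vreg_ne_treg q j

theorem runs_setCell {e f : Expr} (he : e.Fits w s) (hf : f.Fits w s) (hb : f.eval s < 2 ^ b)
    (hQ : Q { s with arr := s.arr.set (e.eval s) (f.eval s) }) :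
    Runs w b (setCell e f) s (e.cost + f.cost + 1) Q := fun σ hσ hs => by
  subst hs
  obtain ⟨τ, t, x1, ht, h1, f1, e1⟩ := e.exec_compile 0 σ hσ he
  obtain ⟨υ, u, x2, hu, h2, f2, e2⟩ := f.exec_compile 1 τ h1 (by rw [f1.abs]; exact hf)
  refine ⟨_, _, x1.seq (x2.seq (Exec.store υ _ _)), by omega, h2.setArr _ _, ?_⟩
  have h3 : υ.reg (treg 0) = τ.reg (treg 0) := f2.reg _ fun j hj => by unfold treg; omega
  convert hQ using 1
  have h4 := f1.trans f2 (Nat.zero_le 1)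
  rw [h3, e1, e2, f1.abs]
  simp only [State.setArr, State.abs] at hb ⊢
  rw [Nat.mod_eq_of_lt hb, h4.arr, h4.table]
  congr 1
  funext r
  exact h4.reg _ fun j _ => vreg_ne_treg r j

theorem runs_branch {e : Expr} (he : e.Fits w s) (h1 : e.eval s ≠ 0 → Runs w b p s T Q)
    (h0 : e.eval s = 0 → Runs w b q s T Q) :
    Runs w b (branch e p q) s (e.cost + T + 1) Q := fun σ hσ hs => by
  subst hs
  obtain ⟨τ, t, x, ht, hw, hf, hv⟩ := e.exec_compile 0 σ hσ he
  by_cases hc : e.eval σ.abs = 0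
  · obtain ⟨υ, u, y, hu, hw', hq⟩ := h0 hc τ hw hf.abs
    exact ⟨υ, _, x.seq (.iteFalse _ (hv.trans hc) y), by omega, hw', hq⟩
  · obtain ⟨υ, u, y, hu, hw', hq⟩ := h1 hc τ hw hf.abs
    exact ⟨υ, _, x.seq (.iteTrue _ (by rwa [hv]) y), by omega, hw', hq⟩

/-- A loop with invariant `I` whose condition holds in exactly `N` rounds. -/
theorem runs_while {e : Expr} (I : ℕ → State → Prop) (N : ℕ) (h0 : I 0 s)
    (hfit : ∀ k s, k ≤ N → WF w b s → I k s → e.Fits w s ∧ (e.eval s ≠ 0 ↔ k < N))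
    (hstep : ∀ k s, k < N → WF w b s → I k s → Runs w b p s T (I (k + 1))) :
    Runs w b (loopWhile e p) s (e.cost + 1 + N * (T + e.cost + 1)) (I N) := by
  intro σ hσ hs
  subst hs
  obtain ⟨τ, t, x, ht, hw, hf, hv⟩ := e.exec_compile 0 σ hσ (hfit 0 _ (Nat.zero_le _) hσ.abs h0).1
  -- Induction on the number `d` of remaining rounds. The loop body ends by evaluating the condition
  -- again, so its current value is always in `treg 0`.
  have key : ∀ d k (τ : State), k + d = N → WF w b τ → I k τ.abs → τ.reg (treg 0) = e.eval τ.abs →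
      ∃ υ u, Exec w b (.loop (treg 0) (.seq p (e.compile 0))) τ υ u ∧
        u ≤ d * (T + e.cost + 1) + 1 ∧ WF w b υ ∧ I N υ.abs := by
    intro d
    induction d with
    | zero =>
      intro k τ hk hw hI hv
      obtain rfl : k = N := by omega
      have := (hfit k _ le_rfl hw.abs hI).2
      refine ⟨τ, 1, .loopDone _ ?_, by omega, hw, hI⟩
      rw [hv]
      by_contra hne
      exact lt_irrefl _ (this.mp hne)
    | succ d ih =>
      intro k τ hk hw hI hv
      have := (hfit k _ (by omega) hw.abs hI).2.mpr (by omega)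
      obtain ⟨υ, u, x1, hu, hw1, hI1⟩ := hstep k _ (by omega) hw.abs hI τ hw rfl
      obtain ⟨φ, v, x2, hv2, hw2, hf2, he2⟩ :=
        e.exec_compile 0 υ hw1 (hfit (k + 1) _ (by omega) hw1.abs hI1).1
      obtain ⟨χ, z, x3, hz, hw3, hI3⟩ := ih (k + 1) φ (by omega) hw2 (hf2.abs ▸ hI1)
        (by rw [he2, hf2.abs])
      refine ⟨χ, _, .loopStep (by rw [hv]; exact this) (x1.seq x2) x3, ?_, hw3, hI3⟩
      rw [Nat.succ_mul]; omega
  obtain ⟨υ, u, y, hu, hw', hq⟩ := key N 0 τ (by omega) hw (hf.abs ▸ h0) (by rw [hv, hf.abs])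
  exact ⟨υ, _, x.seq y, by omega, hw', hq⟩

/-- `for i = 0, …, c - 1 do p` for program variables `i` and `c`. -/
def forLoop (i c : ℕ) (p : Cmd) : Cmd :=
  .seq (assign i (.lit 0)) (loopWhile (.bin .lt (.var i) (.var c))
    (.seq p (assign i (.bin .add (.var i) (.lit 1)))))

/-- The increment belongs to the loop, hence the body has to establish the invariant for the state
with advanced counter. Of the 8 extra steps of a round, 4 are for the increment, 3 for the condition
and 1 for the test. -/
theorem runs_forLoop {i c : ℕ} (hic : i ≠ c) (hw : 1 < 2 ^ w) (I : ℕ → State → Prop)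
    {N : ℕ} (hN : s.reg c = N) (h0 : I 0 (s.set i 0))
    (hstep : ∀ k s, k < N → WF w b s → I k s → s.reg i = k → s.reg c = N →
      Runs w b p s T fun s' => s'.reg i = k ∧ s'.reg c = N ∧ I (k + 1) (s'.set i (k + 1))) :
    Runs w b (forLoop i c p) s (6 + N * (T + 8)) (fun s' => I N s' ∧ s'.reg c = N) := by
  have hlit : (0 : ℕ) < 2 ^ w := by omega
  refine (Runs.seq (runs_assign (Q := fun s' => s' = s.set i 0)
    (show (Expr.lit 0).Fits w s from hlit) rfl) (Q := fun s' => (I N s' ∧ s'.reg i = N) ∧ s'.reg c = N) ?_).mono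
    (T := (Expr.lit 0).cost + 1 + (3 + 1 + N * (T + 4 + 3 + 1))) (by simp [Expr.cost, add_assoc]; omega)
    (fun s' _ h => ?_)
  · rintro s' hs' rfl
    refine (runs_while (T := T + 4) (fun k s => (I k s ∧ s.reg i = k) ∧ s.reg c = N) N
      ⟨⟨h0, by simp⟩, by rw [State.set_reg_of_ne _ _ hic.symm, hN]⟩ ?_ ?_).mono le_rfl
      fun _ _ h => h
    · rintro k s hk - ⟨⟨-, h1⟩, h2⟩
      simp only [Expr.Fits, Expr.eval, Op.eval, h1, h2]
      by_cases h : k < N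
      · rw [if_pos h]
        exact ⟨⟨trivial, trivial, hw⟩, by simpa using h⟩
      · rw [if_neg h]
        exact ⟨⟨trivial, trivial, hlit⟩, by simpa using h⟩
    · rintro k s hk hwf ⟨⟨hI, h1⟩, h2⟩
      refine (hstep k s hk hwf hI h1 h2).seq fun s' hs' ⟨h3, h4, h5⟩ => ?_
      refine (runs_assign ?_ ?_).mono le_rfl fun _ _ h => h
      · have := hs'.reg c
        simp only [Expr.Fits, Expr.eval, Op.eval, h3, true_and]
        omega
      · simp only [Expr.eval, Op.eval, h3]
        exact ⟨⟨h5, by simp⟩, by rw [State.set_reg_of_ne _ _ hic.symm, h4]⟩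
  · exact ⟨h.1.1, h.2⟩

end WordRAM

namespace WordRAM

/-! ### Expressions with a given value -/

/-- The expression `e` has the value `x`, and its evaluation does not overflow. -/
structure Ev (w : ℕ) (s : State) (e : Expr) (x : ℕ) : Prop where
  fits : e.Fits w s
  eq : e.eval s = x

section Ev

variable {w b : ℕ} {s : State} {e f c : Expr} {x y : ℕ}

theorem Ev.lt (h : Ev w s e x) (hw : WF w b s) : x < 2 ^ w :=
  h.eq ▸ Expr.eval_lt hw e h.fits

theorem Ev.var (w : ℕ) (s : State) (r : ℕ) : Ev w s (.var r) (s.reg r) := ⟨trivial, rfl⟩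

theorem Ev.var' {r x : ℕ} (h : s.reg r = x) : Ev w s (.var r) x := ⟨trivial, h⟩

theorem Ev.lit {x : ℕ} (h : x < 2 ^ w) : Ev w s (.lit x) x := ⟨h, rfl⟩

theorem Ev.cell (h : Ev w s e x) : Ev w s (.cell e) (s.arr.getD x 0) :=
  ⟨h.fits, by rw [Expr.eval, h.eq]⟩

theorem Ev.look (h : Ev w s e x) : Ev w s (.look e) (s.table.getD x 0) :=
  ⟨h.fits, by rw [Expr.eval, h.eq]⟩

theorem Ev.bin {o : Op} (h : Ev w s e x) (h' : Ev w s f y) (ho : o.eval x y < 2 ^ w) :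
    Ev w s (.bin o e f) (o.eval x y) := by
  obtain ⟨h1, rfl⟩ := h
  obtain ⟨h2, rfl⟩ := h'
  exact ⟨⟨h1, h2, ho⟩, rfl⟩

theorem Ev.add (h : Ev w s e x) (h' : Ev w s f y) (ho : x + y < 2 ^ w) :
    Ev w s (.bin .add e f) (x + y) := Ev.bin (o := .add) h h' ho

theorem Ev.mul (h : Ev w s e x) (h' : Ev w s f y) (ho : x * y < 2 ^ w) :
    Ev w s (.bin .mul e f) (x * y) := Ev.bin (o := .mul) h h' ho

theorem Ev.shl (h : Ev w s e x) (h' : Ev w s f y) (ho : x <<< y < 2 ^ w) :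
    Ev w s (.bin .shl e f) (x <<< y) := Ev.bin (o := .shl) h h' ho

theorem Ev.sub (hw : WF w b s) (h : Ev w s e x) (h' : Ev w s f y) :
    Ev w s (.bin .sub e f) (x - y) :=
  Ev.bin (o := .sub) h h' ((Nat.sub_le _ _).trans_lt (h.lt hw))

theorem Ev.div (hw : WF w b s) (h : Ev w s e x) (h' : Ev w s f y) :
    Ev w s (.bin .div e f) (x / y) :=
  Ev.bin (o := .div) h h' ((Nat.div_le_self _ _).trans_lt (h.lt hw))

theorem Ev.mod (hw : WF w b s) (h : Ev w s e x) (h' : Ev w s f y) :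
    Ev w s (.bin .mod e f) (x % y) :=
  Ev.bin (o := .mod) h h' ((Nat.mod_le _ _).trans_lt (h.lt hw))

theorem Ev.shr (hw : WF w b s) (h : Ev w s e x) (h' : Ev w s f y) :
    Ev w s (.bin .shr e f) (x >>> y) :=
  Ev.bin (o := .shr) h h' ((Nat.shiftRight_le _ _).trans_lt (h.lt hw))

theorem Ev.or (hw : WF w b s) (h : Ev w s e x) (h' : Ev w s f y) :
    Ev w s (.bin .or e f) (x ||| y) :=
  Ev.bin (o := .or) h h' (Nat.or_lt_two_pow (h.lt hw) (h'.lt hw))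

theorem Ev.xor (hw : WF w b s) (h : Ev w s e x) (h' : Ev w s f y) :
    Ev w s (.bin .xor e f) (x ^^^ y) :=
  Ev.bin (o := .xor) h h' (Nat.xor_lt_two_pow (h.lt hw) (h'.lt hw))

theorem Ev.ltOp (hw : 1 < 2 ^ w) (h : Ev w s e x) (h' : Ev w s f y) :
    Ev w s (.bin .lt e f) (if x < y then 1 else 0) :=
  Ev.bin (o := .lt) h h' (by simp only [Op.eval]; split_ifs <;> omega)

theorem Ev.eqOp (hw : 1 < 2 ^ w) (h : Ev w s e x) (h' : Ev w s f y) :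
    Ev w s (.bin .eq e f) (if x = y then 1 else 0) :=
  Ev.bin (o := .eq) h h' (by simp only [Op.eval]; split_ifs <;> omega)

theorem Ev.cond {z : ℕ} (h : Ev w s c z) (h1 : z ≠ 0 → Ev w s e x) (h0 : z = 0 → Ev w s f x) :
    Ev w s (.cond c e f) x := by
  obtain ⟨h, rfl⟩ := h
  refine ⟨⟨h, fun hc => (h1 hc).fits, fun hc => (h0 hc).fits⟩, ?_⟩
  by_cases hc : c.eval s = 0
  · simp [Expr.eval, hc, (h0 hc).eq]
  · simp [Expr.eval, hc, (h1 hc).eq]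

theorem Ev.congr (h : Ev w s e x) (hxy : x = y) : Ev w s e y := hxy ▸ h

/-- The `k` low-order bits of `e`. -/
def Expr.low (e k : Expr) : Expr := .bin .sub e (.bin .shl (.bin .shr e k) k)

/-- Clearing the low-order bits by two shifts and subtracting keeps all intermediate results below
`x`, whereas the modulus `2 ^ y` need not fit into a word. -/
theorem Ev.low (hw : WF w b s) (h : Ev w s e x) (h' : Ev w s f y) :
    Ev w s (e.low f) (x % 2 ^ y) := by
  have hx := h.lt hw
  have key : x >>> y <<< y ≤ x := by
    rw [Nat.shiftLeft_eq, Nat.shiftRight_eq_div_pow]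
    exact Nat.div_mul_le_self _ _
  refine (Ev.sub hw h (Ev.shl (Ev.shr hw h h') h' (key.trans_lt hx))).congr ?_
  rw [Nat.shiftLeft_eq, Nat.shiftRight_eq_div_pow, Nat.mod_def, mul_comm]

theorem Runs.assign {p : ℕ} {T : ℕ} {Q : State → Prop} (h : Ev w s e x) (hQ : Q (s.set p x))
    (hT : e.cost + 1 ≤ T) : Runs w b (assign p e) s T Q :=
  (runs_assign h.fits (h.eq ▸ hQ)).mono hT fun _ _ h => h

theorem Runs.setCell {T : ℕ} {Q : State → Prop} (h : Ev w s e x) (h' : Ev w s f y)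
    (hb : y < 2 ^ b) (hQ : Q { s with arr := s.arr.set x y }) (hT : e.cost + f.cost + 1 ≤ T) :
    Runs w b (setCell e f) s T Q := by
  obtain ⟨h1, rfl⟩ := h
  obtain ⟨h2, rfl⟩ := h'
  exact (runs_setCell h1 h2 hb hQ).mono hT fun _ _ h => h

end Ev

/-! ### Bit fields -/

open EliasFano

/-- The position, in an array of `b`-bit cells, of the `v`-th bit of the bit string that consists of
`W` consecutive bits of each cell, from the `off`-th bit of the cell on. -/
def viewPos (b W off v : ℕ) : ℕ := v / W * b + off + v % W

/-- The `k` bits from position `p` on, all of them in one cell. -/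
def getField (b : ℕ) (Z : List ℕ) (p k : ℕ) : ℕ :=
  Z.getD (p / b) 0 >>> (b - p % b - k) % 2 ^ k

theorem getField_lt (b : ℕ) (Z : List ℕ) (p k : ℕ) : getField b Z p k < 2 ^ k :=
  Nat.mod_lt _ (by positivity)

theorem add_div_of_le {b p k j : ℕ} (h : p % b + k ≤ b) (hj : j < k) : (p + j) / b = p / b := by
  have hb : 0 < b := by omega
  conv_lhs => rw [← Nat.div_add_mod p b, add_assoc, Nat.mul_add_div hb]
  rw [Nat.div_eq_of_lt (a := p % b + j) (by omega), add_zero]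

theorem add_mod_of_le {b p k j : ℕ} (h : p % b + k ≤ b) (hj : j < k) :
    (p + j) % b = p % b + j := by
  conv_lhs => rw [← Nat.div_add_mod p b, add_assoc, Nat.mul_add_mod]
  exact Nat.mod_eq_of_lt (by omega)

theorem testBit_getField {b : ℕ} (Z : List ℕ) {p k : ℕ} (h : p % b + k ≤ b) {j : ℕ} (hj : j < k) :
    (getField b Z p k).testBit (k - 1 - j) = arrayBit b Z (p + j) := by
  unfold getField arrayBit
  rw [add_div_of_le h hj, add_mod_of_le h hj, Nat.testBit_mod_two_pow, Nat.testBit_shiftRight]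
  have : k - 1 - j < k := by omega
  simp only [this, decide_true, Bool.true_and]
  congr 1
  omega

/-- Overwrite the `k` bits from position `p` on, all of them in one cell, by the number `x`. -/
def setField (b : ℕ) (Z : List ℕ) (p k x : ℕ) : List ℕ :=
  Z.set (p / b) (Z.getD (p / b) 0 ^^^ ((getField b Z p k ^^^ x) <<< (b - p % b - k)))

@[simp] theorem length_setField (b : ℕ) (Z : List ℕ) (p k x : ℕ) :
    (setField b Z p k x).length = Z.length := by
  simp [setField]

/-- XOR with the shifted difference of old and new contents flips exactly the bits of the field that
have to change, so no mask is required. An empty field may lie outside the array; nothing is changed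
then. -/
theorem arrayBit_setField {b : ℕ} {Z : List ℕ} {p k x : ℕ} (h : p % b + k ≤ b) (hx : x < 2 ^ k)
    (hp : k ≠ 0 → p / b < Z.length) (r : ℕ) :
    arrayBit b (setField b Z p k x) r =
      if p ≤ r ∧ r < p + k then x.testBit (k - 1 - (r - p)) else arrayBit b Z r := by
  rcases Nat.eq_zero_or_pos k with rfl | hk
  · have hx0 : x = 0 := by simpa using hx
    subst hx0
    have h0 : setField b Z p 0 0 = Z := by
      unfold setField
      have : getField b Z p 0 = 0 := by simpa using getField_lt b Z p 0
      rw [this]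
      simp only [Nat.xor_self, Nat.zero_shiftLeft, Nat.xor_zero]
      apply List.ext_getElem?
      intro i
      rw [List.getElem?_set]
      split_ifs with h1 h2
      · subst h1; simp [h2]
      · subst h1; simp at h2; simp [h2]
      · rfl
    rw [h0, if_neg (by omega)]
  have hp := hp hk.ne'
  have hb : 0 < b := by omega
  set a := b - p % b - k with ha
  unfold arrayBit setField
  rw [← ha]
  by_cases hc : r / b = p / b
  · rw [hc, List.getD_eq_getElem?_getD, List.getElem?_set_self hp, Option.getD_some,
      Nat.testBit_xor, Nat.testBit_shiftLeft, Nat.testBit_xor]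
    have hr := Nat.div_add_mod r b
    have hp' := Nat.div_add_mod p b
    rw [hc] at hr
    have hrb := Nat.mod_lt r hb
    have hpb := Nat.mod_lt p hb
    have hbit : ∀ i, (getField b Z p k).testBit i =
        (decide (i < k) && (Z.getD (p / b) 0).testBit (a + i)) := fun i => by
      unfold getField
      rw [Nat.testBit_mod_two_pow, Nat.testBit_shiftRight]
    rw [hbit]
    split_ifs with hin
    · have h1 : a ≤ b - 1 - r % b := by omega
      have h2 : b - 1 - r % b - a = k - 1 - (r - p) := by omega
      have h3 : k - 1 - (r - p) < k := by omega
      have h4 : a + (k - 1 - (r - p)) = b - 1 - r % b := by omega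
      rw [h2, h4]
      simp [h1, h3]
    · by_cases h1 : a ≤ b - 1 - r % b
      · have h2 : ¬ b - 1 - r % b - a < k := by omega
        have h3 : x.testBit (b - 1 - r % b - a) = false :=
          Nat.testBit_lt_two_pow (hx.trans_le (Nat.pow_le_pow_right (by norm_num) (by omega)))
        rw [h3]
        simp [h2]
      · simp [h1]
  · rw [if_neg, List.getD_eq_getElem?_getD, List.getElem?_set_ne (Ne.symm hc),
      ← List.getD_eq_getElem?_getD]
    rintro ⟨h1, h2⟩
    apply hc
    have := add_div_of_le h (j := r - p) (by omega)
    rwa [Nat.add_sub_cancel' h1] at this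

theorem setField_cell_lt {b : ℕ} {Z : List ℕ} {p k x : ℕ} (h : p % b + k ≤ b) (hx : x < 2 ^ k)
    (hZ : Z.getD (p / b) 0 < 2 ^ b) :
    Z.getD (p / b) 0 ^^^ ((getField b Z p k ^^^ x) <<< (b - p % b - k)) < 2 ^ b := by
  refine Nat.xor_lt_two_pow hZ ?_
  rw [Nat.shiftLeft_eq]
  calc _ < 2 ^ k * 2 ^ (b - p % b - k) :=
        Nat.mul_lt_mul_of_pos_right (Nat.xor_lt_two_pow (getField_lt ..) hx) (by positivity)
    _ ≤ 2 ^ b := by rw [← pow_add]; exact Nat.pow_le_pow_right (by norm_num) (by omega)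

/-- The `len` bits from the `v`-th bit of a view on. -/
def getView (b W off : ℕ) (Z : List ℕ) (v len : ℕ) : ℕ :=
  if v % W + len ≤ W then getField b Z (viewPos b W off v) len
  else
    getField b Z (viewPos b W off v) (W - v % W) <<< (len - (W - v % W)) |||
      getField b Z (viewPos b W off (v + (W - v % W))) (len - (W - v % W))

/-- Overwrite the `len` bits from the `v`-th bit of a view on by the number `x`. -/
def setView (b W off : ℕ) (Z : List ℕ) (v len x : ℕ) : List ℕ :=
  if v % W + len ≤ W then setField b Z (viewPos b W off v) len x
  else
    setField b (setField b Z (viewPos b W off v) (W - v % W) (x >>> (len - (W - v % W))))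
      (viewPos b W off (v + (W - v % W))) (len - (W - v % W)) (x % 2 ^ (len - (W - v % W)))

section View

variable {b W off : ℕ}

theorem viewPos_add_within {v j : ℕ} (hj : v % W + j < W) :
    viewPos b W off (v + j) = viewPos b W off v + j := by
  unfold viewPos
  rw [add_div_of_le (k := j + 1) (by omega) (by omega),
    add_mod_of_le (k := j + 1) (by omega) (by omega)]
  omega

theorem viewPos_mod (hW : off + W ≤ b) {v : ℕ} (h0 : 0 < W) :
    viewPos b W off v % b = off + v % W := by
  have := Nat.mod_lt v h0
  unfold viewPos
  rw [add_assoc, mul_comm, Nat.mul_add_mod, Nat.mod_eq_of_lt (by omega)]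

theorem viewPos_div (hW : off + W ≤ b) {v : ℕ} (h0 : 0 < W) :
    viewPos b W off v / b = v / W := by
  have := Nat.mod_lt v h0
  unfold viewPos
  rw [add_assoc, mul_comm, Nat.mul_add_div (by omega),
    Nat.div_eq_of_lt (a := off + v % W) (by omega), add_zero]

/-- A view embeds its bit string into the array in an order-preserving way. Disjointness of fields
and the safety of copying in place rest on this. -/
theorem viewPos_lt_viewPos (hW : off + W ≤ b) (h0 : 0 < W) {u v : ℕ} (h : u < v) :
    viewPos b W off u < viewPos b W off v := by
  have h1 := Nat.div_add_mod u W
  have h2 := Nat.div_add_mod v W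
  have h3 := Nat.mod_lt u h0
  rcases (Nat.div_le_div_right h.le : u / W ≤ v / W).lt_or_eq with h4 | h4
  · have : (u / W + 1) * b ≤ v / W * b := Nat.mul_le_mul_right _ h4
    unfold viewPos
    rw [add_mul] at this
    omega
  · unfold viewPos
    rw [h4] at h1 ⊢
    omega

theorem viewPos_inj (hW : off + W ≤ b) (h0 : 0 < W) {u v : ℕ}
    (h : viewPos b W off u = viewPos b W off v) : u = v := by
  rcases lt_trichotomy u v with h1 | h1 | h1
  · exact absurd h (viewPos_lt_viewPos hW h0 h1).ne
  · exact h1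
  · exact absurd h (viewPos_lt_viewPos hW h0 h1).ne'

theorem add_sub_mod (h0 : 0 < W) (v : ℕ) : (v + (W - v % W)) % W = 0 := by
  have h1 := Nat.div_add_mod v W
  have h2 := Nat.mod_lt v h0
  have : v + (W - v % W) = W * (v / W + 1) := by rw [mul_add]; omega
  rw [this, Nat.mul_mod_right]

theorem getView_lt (Z : List ℕ) {v len : ℕ} : getView b W off Z v len < 2 ^ len := by
  unfold getView
  split_ifs with h
  · exact getField_lt ..
  · refine Nat.or_lt_two_pow ?_
      ((getField_lt ..).trans_le (Nat.pow_le_pow_right (by norm_num) (by omega)))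
    rw [Nat.shiftLeft_eq]
    calc _ < 2 ^ (W - v % W) * 2 ^ (len - (W - v % W)) :=
          Nat.mul_lt_mul_of_pos_right (getField_lt ..) (by positivity)
      _ = 2 ^ len := by rw [← pow_add]; congr 1; omega

/-- Because of `len ≤ W` the range meets at most two cells: `W - v % W` bits remain in the first
one, and the others start at the beginning of the next one's part of the view. -/
theorem testBit_getView (Z : List ℕ) (hW : off + W ≤ b) {v len : ℕ} (hlen : len ≤ W) {j : ℕ}
    (hj : j < len) :
    (getView b W off Z v len).testBit (len - 1 - j) = arrayBit b Z (viewPos b W off (v + j)) := by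
  have h0 : 0 < W := by omega
  have hvm := Nat.mod_lt v h0
  have hm := viewPos_mod hW (v := v) h0
  unfold getView
  split_ifs with h
  · rw [testBit_getField Z (by omega) hj, viewPos_add_within (by omega)]
  · set k := W - v % W with hk
    have hm' := viewPos_mod hW (v := v + k) h0
    have hz := add_sub_mod h0 v
    rw [← hk] at hz
    rw [Nat.testBit_or, Nat.testBit_shiftLeft]
    by_cases h1 : j < k
    · have h2 : len - 1 - j ≥ len - k := by omega
      have h3 : len - 1 - j - (len - k) = k - 1 - j := by omega
      rw [h3, testBit_getField Z (by omega) h1, ← viewPos_add_within (by omega),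
        Nat.testBit_lt_two_pow ((getField_lt ..).trans_le
          (Nat.pow_le_pow_right (by norm_num) h2))]
      simp [h2]
    · have h2 : ¬ len - 1 - j ≥ len - k := by omega
      have h3 : len - 1 - j = len - k - 1 - (j - k) := by omega
      have h4 : v + j = v + k + (j - k) := by omega
      rw [h4, viewPos_add_within (v := v + k) (by omega),
        ← testBit_getField Z (k := len - k) (by omega) (by omega), ← h3]
      simp [h2]

@[simp] theorem length_setView (Z : List ℕ) (v len x : ℕ) :
    (setView b W off Z v len x).length = Z.length := by
  unfold setView; split_ifs <;> simp

/-- `B'` arises from `B` by overwriting the `len` bits from the `v`-th bit of a view on by `x`. -/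
structure Upd (b W off v len x : ℕ) (B B' : ℕ → Bool) : Prop where
  set : ∀ j < len, B' (viewPos b W off (v + j)) = x.testBit (len - 1 - j)
  keep : ∀ p, (∀ j < len, p ≠ viewPos b W off (v + j)) → B' p = B p

theorem upd_setField {Z : List ℕ} {v len x : ℕ} (hW : off + W ≤ b) (hx : x < 2 ^ len)
    (hm : v % W + len ≤ W) (h0 : 0 < len → v / W < Z.length) :
    Upd b W off v len x (arrayBit b Z)
      (arrayBit b (setField b Z (viewPos b W off v) len x)) := by
  have hz : viewPos b W off v % b + len ≤ b ∨ len = 0 := by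
    rcases Nat.eq_zero_or_pos len with h | h
    · exact Or.inr h
    · rw [viewPos_mod hW (by omega)]; omega
  rcases Nat.eq_zero_or_pos b with rfl | hb
  · obtain rfl : len = 0 := by omega
    refine ⟨by omega, fun p _ => ?_⟩
    simp only [arrayBit, setField]
    have hx0 : x = 0 := by simpa using hx
    have h1 : getField 0 Z (viewPos 0 W off v) 0 = 0 := by
      simpa using getField_lt 0 Z (viewPos 0 W off v) 0
    rw [h1, hx0]
    simp only [Nat.div_zero, Nat.xor_self, Nat.zero_shiftLeft, Nat.xor_zero]
    rcases Z with _ | ⟨z, Z⟩ <;> simp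
  have hz' : viewPos b W off v % b + len ≤ b := by
    rcases hz with h | h
    · exact h
    · rw [h]; exact (Nat.mod_lt _ hb).le
  have hlen : len ≠ 0 → viewPos b W off v / b < Z.length := fun h => by
    rw [viewPos_div hW (by omega)]; exact h0 (by omega)
  refine ⟨fun j hj => ?_, fun p hp => ?_⟩
  · rw [viewPos_add_within (by omega), arrayBit_setField hz' hx hlen, if_pos (by omega)]
    congr 2; omega
  · rw [arrayBit_setField hz' hx hlen, if_neg]
    rintro ⟨h1, h2⟩
    apply hp (p - viewPos b W off v) (by omega)
    rw [viewPos_add_within (by omega)]; omega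

/-- The two stores concern disjoint fields, since `viewPos` is injective, so the second one keeps
what the first one has written. `hv0` is for the empty view, where `v % 0 = v`. -/
theorem upd_setView {Z : List ℕ} {v len x : ℕ} (hW : off + W ≤ b) (hlen : len ≤ W)
    (hx : x < 2 ^ len) (hv : ∀ j < len, (v + j) / W < Z.length) (hv0 : W = 0 → v = 0) :
    Upd b W off v len x (arrayBit b Z) (arrayBit b (setView b W off Z v len x)) := by
  unfold setView
  split_ifs with h
  · exact upd_setField hW hx h fun h0 => hv 0 h0
  have h0 : 0 < W := by
    rcases Nat.eq_zero_or_pos W with rfl | h0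
    · simp [hv0 rfl] at h
      omega
    · exact h0
  have hvm := Nat.mod_lt v h0
  set k := W - v % W with hk
  have hz := add_sub_mod h0 v
  rw [← hk] at hz
  have h1 : x >>> (len - k) < 2 ^ k := by
    rw [Nat.shiftRight_eq_div_pow]
    apply Nat.div_lt_of_lt_mul
    rw [← pow_add]
    exact hx.trans_le (Nat.pow_le_pow_right (by norm_num) (by omega))
  have u1 := upd_setField (Z := Z) (v := v) hW h1 (by omega) fun _ => hv 0 (by omega)
  have u2 := upd_setField (Z := setField b Z (viewPos b W off v) k (x >>> (len - k)))
    (v := v + k) (len := len - k) (x := x % 2 ^ (len - k)) hW (Nat.mod_lt _ (by positivity))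
    (by omega) fun _ => by simpa using hv k (by omega)
  refine ⟨fun j hj => ?_, fun p hp => ?_⟩
  · by_cases hjk : j < k
    · rw [u2.keep, u1.set j hjk, Nat.testBit_shiftRight]
      · congr 1; omega
      · intro i hi hne
        have := viewPos_inj hW h0 hne
        omega
    · have := u2.set (j - k) (by omega)
      rw [show v + k + (j - k) = v + j by omega] at this
      rw [this, Nat.testBit_mod_two_pow, show len - k - 1 - (j - k) = len - 1 - j by omega]
      simp; omega
  · rw [u2.keep, u1.keep]
    · exact fun j hj => hp j (by omega)
    · intro j hj
      rw [add_assoc]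
      exact hp _ (by omega)

end View

end WordRAM

namespace WordRAM

open EliasFano

/-! ### Programs for bit fields -/

/-- Expression for `viewPos`. -/
def viewPosE (b W off v : Expr) : Expr :=
  .bin .add (.bin .add (.bin .mul (.bin .div v W) b) off) (.bin .mod v W)

/-- Expression for the shift amount of a bit field. -/
def shiftE (b p k : Expr) : Expr := .bin .sub (.bin .sub b (.bin .mod p b)) k

/-- Expression for `getField`. -/
def fieldE (b p k : Expr) : Expr :=
  (Expr.bin .shr (.cell (.bin .div p b)) (shiftE b p k)).low k

/-- Expression for the number of bits from the `v`-th bit of a view on that lie in its cell. -/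
def headE (W v : Expr) : Expr := .bin .sub W (.bin .mod v W)

/-- Expression for `getView`. -/
def getViewE (b W off v len : Expr) : Expr :=
  .cond (.bin .lt (headE W v) len)
    (.bin .or
      (.bin .shl (fieldE b (viewPosE b W off v) (headE W v)) (.bin .sub len (headE W v)))
      (fieldE b (viewPosE b W off (.bin .add v (headE W v))) (.bin .sub len (headE W v))))
    (fieldE b (viewPosE b W off v) len)

section Ev

variable {w b : ℕ} {s : State} {eb eW eo ev el ep ek : Expr} {W off v len p k : ℕ}

theorem Ev.viewPos (hw : WF w b s) (hb : Ev w s eb b) (hW : Ev w s eW W) (ho : Ev w s eo off)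
    (hv : Ev w s ev v) (h : viewPos b W off v < 2 ^ w) :
    Ev w s (viewPosE eb eW eo ev) (viewPos b W off v) := by
  unfold WordRAM.viewPos at *
  exact Ev.add (Ev.add (Ev.mul (Ev.div hw hv hW) hb (by omega)) ho (by omega)) (Ev.mod hw hv hW) h

theorem Ev.shift (hw : WF w b s) (hb : Ev w s eb b) (hp : Ev w s ep p) (hk : Ev w s ek k) :
    Ev w s (shiftE eb ep ek) (b - p % b - k) :=
  Ev.sub hw (Ev.sub hw hb (Ev.mod hw hp hb)) hk

theorem Ev.field (hw : WF w b s) (hb : Ev w s eb b) (hp : Ev w s ep p) (hk : Ev w s ek k) :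
    Ev w s (fieldE eb ep ek) (getField b s.arr p k) :=
  Ev.low hw (Ev.shr hw (Ev.cell (Ev.div hw hp hb)) (Ev.shift hw hb hp hk)) hk

theorem Ev.head (hw : WF w b s) (hW : Ev w s eW W) (hv : Ev w s ev v) :
    Ev w s (headE eW ev) (W - v % W) := Ev.sub hw hW (Ev.mod hw hv hW)

theorem Ev.getView (hw : WF w b s) (hb : Ev w s eb b) (hW : Ev w s eW W) (ho : Ev w s eo off)
    (hv : Ev w s ev v) (hl : Ev w s el len) (hWb : off + W ≤ b) (hlen : len ≤ W)
    (h0 : WordRAM.viewPos b W off v < 2 ^ w)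
    (h : ∀ j < len, WordRAM.viewPos b W off (v + j) < 2 ^ w) (hv0 : W = 0 → v = 0) :
    Ev w s (getViewE eb eW eo ev el) (getView b W off s.arr v len) := by
  have hbw : 1 < 2 ^ w ∨ len = 0 := by
    rcases Nat.eq_zero_or_pos len with h1 | h1
    · exact Or.inr h1
    · left
      exact Nat.one_lt_two_pow (by have := hw.le; omega)
  have hc : Ev w s (.bin .lt (headE eW ev) el) (if W - v % W < len then 1 else 0) := by
    refine Ev.bin (o := .lt) (Ev.head hw hW hv) hl ?_
    simp only [Op.eval]
    split_ifs with h1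
    · rcases hbw with h2 | h2
      · exact h2
      · omega
    · positivity
  refine Ev.cond hc (fun h1 => ?_) (fun h1 => ?_)
  · have h2 : W - v % W < len := by
      by_contra h2; exact h1 (if_neg h2)
    have hW0 : 0 < W := by omega
    have := Nat.mod_lt v hW0
    have h3 : ¬ (v % W + len ≤ W) := by omega
    unfold WordRAM.getView
    rw [if_neg h3]
    have hle : v + (W - v % W) ≤ WordRAM.viewPos b W off (v + (W - v % W)) := by
      unfold WordRAM.viewPos
      have h4 := Nat.div_add_mod (v + (W - v % W)) W
      have h5 : (v + (W - v % W)) / W * W ≤ (v + (W - v % W)) / W * b :=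
        Nat.mul_le_mul_left _ (by omega)
      rw [mul_comm] at h4
      omega
    have h6 := h _ h2
    refine Ev.or hw (Ev.shl (Ev.field hw hb (Ev.viewPos hw hb hW ho hv h0) (Ev.head hw hW hv))
      (Ev.sub hw hl (Ev.head hw hW hv)) ?_)
      (Ev.field hw hb (Ev.viewPos hw hb hW ho (Ev.add hv (Ev.head hw hW hv) (by omega)) h6)
        (Ev.sub hw hl (Ev.head hw hW hv)))
    rw [Nat.shiftLeft_eq]
    calc _ < 2 ^ (W - v % W) * 2 ^ (len - (W - v % W)) :=
          Nat.mul_lt_mul_of_pos_right (getField_lt ..) (by positivity)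
      _ = 2 ^ len := by rw [← pow_add]; congr 1; omega
      _ ≤ 2 ^ w := Nat.pow_le_pow_right (by norm_num) (by have := hw.le; omega)
  · have h2 : ¬ W - v % W < len := by
      intro h2; rw [if_pos h2] at h1; omega
    have h3 : v % W + len ≤ W := by
      rcases Nat.eq_zero_or_pos W with h4 | h4
      · rw [h4, hv0 h4]; simpa [h4] using hlen
      · have := Nat.mod_lt v h4; omega
    unfold WordRAM.getView
    rw [if_pos h3]
    exact Ev.field hw hb (Ev.viewPos hw hb hW ho hv h0) hl

end Ev

/-- Code for `setField`; the number to be stored must not depend on the array. -/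
def setFieldC (b p k x : Expr) : Cmd :=
  setCell (.bin .div p b) (.bin .xor (.cell (.bin .div p b))
    (.bin .shl (.bin .xor (fieldE b p k) x) (shiftE b p k)))

/-- Code for `setView`, for parameters in program variables. -/
def setViewC (b W off v len x : ℕ) : Cmd :=
  let h := headE (.var W) (.var v)
  let r := Expr.bin .sub (.var len) h
  branch (.bin .lt h (.var len))
    (.seq
      (setFieldC (.var b) (viewPosE (.var b) (.var W) (.var off) (.var v)) h
        (.bin .shr (.var x) r))
      (setFieldC (.var b) (viewPosE (.var b) (.var W) (.var off) (.bin .add (.var v) h)) r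
        ((Expr.var x).low r)))
    (setFieldC (.var b) (viewPosE (.var b) (.var W) (.var off) (.var v)) (.var len) (.var x))

theorem runs_setFieldC {w b p k x : ℕ} {s : State} {eb ep ek ex : Expr} (hw : WF w b s)
    (hb : Ev w s eb b) (hp : Ev w s ep p) (hk : Ev w s ek k) (hx : Ev w s ex x)
    (h : p % b + k ≤ b) (hxk : x < 2 ^ k) :
    Runs w b (setFieldC eb ep ek ex) s (4 * eb.cost + 4 * ep.cost + 4 * ek.cost +
      4 * (eb.cost + ep.cost + ek.cost) + 4 * (eb.cost + ep.cost + ek.cost) + ex.cost + 60)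
      (fun s' => s' = { s with arr := setField b s.arr p k x }) := by
  have hlt := setField_cell_lt h hxk (hw.cell_lt (p / b))
  have hdiv := Ev.div hw hp hb
  have hf := Ev.field hw hb hp hk
  refine Runs.setCell hdiv (Ev.xor hw (Ev.cell hdiv)
    (Ev.shl (Ev.xor hw hf hx) (Ev.shift hw hb hp hk) ?_)) hlt rfl ?_
  · rw [Nat.shiftLeft_eq]
    calc _ < 2 ^ k * 2 ^ (b - p % b - k) :=
          Nat.mul_lt_mul_of_pos_right (Nat.xor_lt_two_pow (getField_lt ..) hxk) (by positivity)
      _ ≤ 2 ^ w := by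
          rw [← pow_add]
          exact Nat.pow_le_pow_right (by norm_num) (by have := hw.le; omega)
  · simp only [Expr.cost, fieldE, Expr.low, shiftE]
    omega

theorem runs_setViewC {w b W off v len x : ℕ} {s : State} (rb rW ro rv rl rx : ℕ)
    (hb : s.reg rb = b) (hW : s.reg rW = W) (ho : s.reg ro = off) (hv : s.reg rv = v)
    (hl : s.reg rl = len) (hx : s.reg rx = x) (hWb : off + W ≤ b) (hlen : len ≤ W)
    (hxl : x < 2 ^ len) (hnb : s.arr.length * b < 2 ^ w) (h0 : viewPos b W off v < 2 ^ w)
    (h : ∀ j < len, (v + j) / W < s.arr.length) (hv0 : W = 0 → v = 0) :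
    Runs w b (setViewC rb rW ro rv rl rx) s 1000
      (fun s' => s' = { s with arr := setView b W off s.arr v len x }) := by
  refine Runs.of_wf fun hw => ?_
  have eb := Ev.var' (w := w) hb
  have eW := Ev.var' (w := w) hW
  have eo := Ev.var' (w := w) ho
  have ev := Ev.var' (w := w) hv
  have el := Ev.var' (w := w) hl
  have ex := Ev.var' (w := w) hx
  have eh := Ev.head hw eW ev
  have er := Ev.sub hw el eh
  have hc : Ev w s (.bin .lt (headE (.var rW) (.var rv)) (.var rl))
      (if W - v % W < len then 1 else 0) := by
    refine Ev.bin (o := .lt) eh el ?_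
    simp only [Op.eval]
    split_ifs with h1
    · exact Nat.one_lt_two_pow (by have := hw.le; omega)
    · positivity
  refine (runs_branch (T := 950) hc.fits ?_ ?_).mono (by simp [Expr.cost, headE]) fun _ _ h => h
  · intro h1
    rw [hc.eq] at h1
    have h2 : W - v % W < len := by
      by_contra h2; exact h1 (if_neg h2)
    have hW0 : 0 < W := by omega
    have hm := Nat.mod_lt v hW0
    have h3 : ¬ (v % W + len ≤ W) := by omega
    have h4 := h _ h2
    have hz := add_sub_mod hW0 v
    have h5 : viewPos b W off (v + (W - v % W)) < 2 ^ w := by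
      refine lt_of_lt_of_le ?_ hnb.le
      unfold viewPos
      rw [hz]
      have : ((v + (W - v % W)) / W + 1) * b ≤ s.arr.length * b := Nat.mul_le_mul_right _ h4
      rw [add_mul] at this
      omega
    have h6 : v + (W - v % W) < 2 ^ w := by
      refine lt_of_lt_of_le ?_ hnb.le
      have h7 := Nat.div_add_mod (v + (W - v % W)) W
      have : ((v + (W - v % W)) / W + 1) * W ≤ s.arr.length * b := Nat.mul_le_mul h4 (by omega)
      rw [mul_comm, mul_add] at this
      omega
    unfold setView
    rw [if_neg h3]
    have ep := Ev.viewPos hw eb eW eo ev h0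
    have hm1 := viewPos_mod hWb (v := v) hW0
    have hm2 := viewPos_mod hWb (v := v + (W - v % W)) hW0
    have hx1 : x >>> (len - (W - v % W)) < 2 ^ (W - v % W) := by
      rw [Nat.shiftRight_eq_div_pow]
      apply Nat.div_lt_of_lt_mul
      rw [← pow_add]
      exact hxl.trans_le (Nat.pow_le_pow_right (by norm_num) (by omega))
    refine ((runs_setFieldC hw eb ep eh (Ev.shr hw ex er) (by omega) hx1).seq (T' := 500)
      fun s' hw' hs' => ?_).mono (by simp [Expr.cost, headE, viewPosE]) fun _ _ h => h
    have hr : s'.reg = s.reg := by rw [hs']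
    have eb := Ev.var' (w := w) (s := s') (hr ▸ hb)
    have eW := Ev.var' (w := w) (s := s') (hr ▸ hW)
    have eo := Ev.var' (w := w) (s := s') (hr ▸ ho)
    have ev := Ev.var' (w := w) (s := s') (hr ▸ hv)
    have el := Ev.var' (w := w) (s := s') (hr ▸ hl)
    have ex := Ev.var' (w := w) (s := s') (hr ▸ hx)
    have eh := Ev.head hw' eW ev
    have er := Ev.sub hw' el eh
    exact (runs_setFieldC hw' eb (Ev.viewPos hw' eb eW eo (Ev.add ev eh h6) h5) er
      (Ev.low hw' ex er) (by omega) (Nat.mod_lt _ (by positivity))).mono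
      (by simp [Expr.cost, headE, Expr.low, viewPosE]) fun _ _ h => by rw [h, hs']
  · intro h1
    rw [hc.eq] at h1
    have h2 : ¬ W - v % W < len := by
      intro h2; rw [if_pos h2] at h1; omega
    have h3 : v % W + len ≤ W := by
      rcases Nat.eq_zero_or_pos W with h4 | h4
      · rw [h4, hv0 h4]; simpa [h4] using hlen
      · have := Nat.mod_lt v h4; omega
    unfold setView
    rw [if_pos h3]
    have h4 : viewPos b W off v % b + len ≤ b := by
      rcases Nat.eq_zero_or_pos W with h4 | h4
      · rcases Nat.eq_zero_or_pos b with h5 | h5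
        · have : viewPos b W off v = 0 := by unfold viewPos; rw [h4, hv0 h4]; omega
          rw [this]; simp; omega
        · have := Nat.mod_lt (viewPos b W off v) h5; omega
      · rw [viewPos_mod hWb h4]; omega
    exact (runs_setFieldC hw eb (Ev.viewPos hw eb eW eo ev h0) el ex h4 hxl).mono
      (by simp [Expr.cost, viewPosE]) fun _ _ h => h

end WordRAM

namespace WordRAM

open EliasFano

/-! ### Loops that overwrite bit fields

Variables `40, …, 49` are scratch variables; in particular `40` is the loop counter. Variable `2`
holds the cell width. -/

/-- `s'` agrees with `s` up to the scratch variables and the contents of the array. -/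
structure Keep (s s' : State) : Prop where
  table : s'.table = s.table
  length : s'.arr.length = s.arr.length
  reg : ∀ r, ¬ (40 ≤ r ∧ r < 50) → s'.reg r = s.reg r

theorem Keep.refl (s : State) : Keep s s := ⟨rfl, rfl, fun _ _ => rfl⟩

theorem Keep.trans {s s' s'' : State} (h : Keep s s') (h' : Keep s' s'') : Keep s s'' :=
  ⟨h'.table.trans h.table, h'.length.trans h.length, fun r hr => (h'.reg r hr).trans (h.reg r hr)⟩

theorem Keep.set {s s' : State} (h : Keep s s') {r : ℕ} (v : ℕ) (h1 : 40 ≤ r) (h2 : r < 50) :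
    Keep s (s'.set r v) :=
  ⟨h.table, h.length, fun q hq => by
    rw [State.set_reg_of_ne _ _ (by omega)]; exact h.reg q hq⟩

theorem Keep.arr {s s' : State} (h : Keep s s') {Z : List ℕ} (hZ : Z.length = s.arr.length) :
    Keep s { s' with arr := Z } := ⟨h.table, hZ, h.reg⟩

/-- Overwrite `len` bits of a view, from the `eP`-th one on, by the number `eX`. -/
def writeC (W off len : ℕ) (eP eX : Expr) : Cmd :=
  .seq (assign 41 eP) (.seq (assign 42 eX) (setViewC 2 W off 41 len 42))

/-- Position and value are fixed in variables before the array changes. Hence the value may depend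
on the array, although the field may need two stores. -/
theorem runs_writeC {w b W off len P X : ℕ} {s : State} {rW ro rl : ℕ} {eP eX : Expr}
    (hr : rW < 40 ∧ ro < 40 ∧ rl < 40) (hb : s.reg 2 = b) (hW : s.reg rW = W) (ho : s.reg ro = off)
    (hl : s.reg rl = len) (hP : Ev w s eP P) (hX : Ev w (s.set 41 P) eX X)
    (hWb : off + W ≤ b) (hlen : len ≤ W) (hxl : X < 2 ^ len) (hnb : s.arr.length * b < 2 ^ w)
    (h0 : viewPos b W off P < 2 ^ w) (h : ∀ j < len, (P + j) / W < s.arr.length)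
    (hv0 : W = 0 → P = 0) :
    Runs w b (writeC rW ro rl eP eX) s (eP.cost + eX.cost + 1002)
      (fun s' => Keep s s' ∧ (∀ r, r ≠ 41 → r ≠ 42 → s'.reg r = s.reg r) ∧
        s'.arr = setView b W off s.arr P len X) := by
  have h1 : ∀ r, r < 41 → ((s.set 41 P).set 42 X).reg r = s.reg r := fun r hr => by
    rw [State.set_reg_of_ne _ _ (by omega), State.set_reg_of_ne _ _ (by omega)]
  refine ((Runs.assign hP (Q := fun s' => s' = s.set 41 P) rfl le_rfl).seq (T' := eX.cost + 1001)
    ?_).mono (by omega) fun _ _ h => h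
  rintro s' hw1 rfl
  refine ((Runs.assign hX (Q := fun s' => s' = (s.set 41 P).set 42 X) rfl le_rfl).seq
    (T' := 1000) ?_).mono (by omega) fun _ _ h => h
  rintro s' hw1 rfl
  refine (runs_setViewC (v := P) (x := X) _ _ _ _ _ _ ((h1 2 (by omega)).trans hb)
    ((h1 rW (by omega)).trans hW) ((h1 ro (by omega)).trans ho) ?_ ((h1 rl (by omega)).trans hl) ?_
    hWb hlen hxl hnb h0 h hv0).mono le_rfl ?_
  · rw [State.set_reg_of_ne _ _ (by omega)]; simp
  · simp
  · rintro s' - rfl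
    refine ⟨(((Keep.refl s).set P (r := 41) (by omega) (by omega)).set X (r := 42) (by omega)
      (by omega)).arr (by simp), fun r h41 h42 => ?_, rfl⟩
    show ((s.set 41 P).set 42 X).reg r = _
    rw [State.set_reg_of_ne _ _ h42, State.set_reg_of_ne _ _ h41]

/-- Execute `writeC` once for each value of the loop counter. -/
def writeLoop (c W off len : ℕ) (eP eX : Expr) : Cmd := forLoop 40 c (writeC W off len eP eX)

/-- The invariant `J` speaks of the bit string only, and each round is described by an update of
that string; applications need not look at cells any more. -/
theorem runs_writeLoop {w b W off len N : ℕ} {s : State} {c rW ro rl : ℕ} {eP eX : Expr}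
    (hr : c < 40 ∧ rW < 40 ∧ ro < 40 ∧ rl < 40) (hb : s.reg 2 = b) (hN : s.reg c = N)
    (hW : s.reg rW = W) (ho : s.reg ro = off) (hl : s.reg rl = len) (hw1 : 1 < 2 ^ w)
    (hWb : off + W ≤ b) (hlen : len ≤ W) (hnb : s.arr.length * b < 2 ^ w)
    (J : ℕ → (ℕ → Bool) → Prop) (h0 : J 0 (arrayBit b s.arr))
    (hstep : ∀ k < N, ∀ Z : List ℕ, Z.length = s.arr.length → J k (arrayBit b Z) → ∃ P X,
      X < 2 ^ len ∧ viewPos b W off P < 2 ^ w ∧ (∀ j < len, (P + j) / W < s.arr.length) ∧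
      (W = 0 → P = 0) ∧
      (∀ s', WF w b s' → Keep s s' → s'.reg 40 = k → s'.arr = Z → Ev w s' eP P ∧ Ev w s' eX X) ∧
      (∀ B', Upd b W off P len X (arrayBit b Z) B' → J (k + 1) B')) :
    Runs w b (writeLoop c rW ro rl eP eX) s (6 + N * (eP.cost + eX.cost + 1010))
      (fun s' => Keep s s' ∧ J N (arrayBit b s'.arr)) := by
  refine (runs_forLoop (by omega) hw1 (fun k s' => Keep s s' ∧ J k (arrayBit b s'.arr))
    (T := eP.cost + eX.cost + 1002) hN ⟨(Keep.refl s).set 0 (by omega) (by omega), h0⟩ ?_).mono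
    le_rfl fun _ _ h => h.1
  rintro k s' hk hwf ⟨hK, hJ⟩ hi hc
  obtain ⟨P, X, hX, hP, hj, hz, hev, hJ'⟩ := hstep k hk s'.arr hK.length hJ
  have e1 := (hev s' hwf hK hi rfl).1
  have hwf' : WF w b (s'.set 41 P) := by
    refine ⟨hwf.le, fun r => ?_, hwf.arr, hwf.table⟩
    rw [State.set_reg]
    split_ifs
    · exact e1.lt hwf
    · exact hwf.reg r
  -- The value is evaluated after the position has been put into variable 41, a scratch variable on
  -- which it does not depend.
  have e2 := (hev (s'.set 41 P) hwf' (hK.set _ (by omega) (by omega))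
    (by rw [State.set_reg_of_ne _ _ (by omega)]; exact hi) rfl).2
  have hreg : ∀ r, r < 40 → s'.reg r = s.reg r := fun r hr => hK.reg r (by omega)
  refine (runs_writeC (by omega) ((hreg 2 (by omega)).trans hb) ((hreg rW (by omega)).trans hW)
    ((hreg ro (by omega)).trans ho) ((hreg rl (by omega)).trans hl) e1 e2 hWb hlen hX
    (by rw [hK.length]; exact hnb) hP (by rw [hK.length]; exact hj) hz).mono le_rfl ?_
  rintro s'' - ⟨hK', hsame, harr⟩
  refine ⟨(hsame 40 (by omega) (by omega)).trans hi, (hsame c (by omega) (by omega)).trans hc,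
    (hK.trans hK').set _ (by omega) (by omega), hJ' _ ?_⟩
  rw [State.set_arr, harr]
  exact upd_setView hWb hlen hX (by rw [hK.length]; exact hj) hz

/-! ### Copying and filling -/

/-- The position of the loop counter's item in a sequence of items of `len` bits, from bit `base`
on. -/
def itemE (base len : ℕ) (idx : Expr) : Expr :=
  .bin .add (.var base) (.bin .mul idx (.var len))

/-- The loop counter. -/
def upE : Expr := .var 40

/-- The index, counted from the last of the items, of which variable `c` holds the number. -/
def downE (c : ℕ) : Expr := .bin .sub (.bin .sub (.var c) (.var 40)) (.lit 1)

/-- Copy items of `len` bits each from one view to another. -/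
def copyLoop (c len W off base W' off' base' : ℕ) (idx : Expr) : Cmd :=
  writeLoop c W' off' len (itemE base' len idx)
    (getViewE (.var 2) (.var W) (.var off) (itemE base len idx) (.var len))

theorem viewPos_lt {b W off v n : ℕ} (hW : off + W ≤ b) (h0 : 0 < W) (h : v / W < n) :
    viewPos b W off v < n * b := by
  have := Nat.mod_lt v h0
  have : (v / W + 1) * b ≤ n * b := Nat.mul_le_mul_right _ h
  unfold viewPos
  rw [add_mul] at this
  omega

theorem le_viewPos {b W off v : ℕ} (hW : off + W ≤ b) : v ≤ viewPos b W off v := by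
  have h1 := Nat.div_add_mod v W
  have h2 : v / W * W ≤ v / W * b := Nat.mul_le_mul_left _ (by omega)
  unfold viewPos
  rw [mul_comm] at h1
  omega

theorem Ev.item {w b base len t x y : ℕ} {s : State} {idx : Expr} (hw : WF w b s)
    (hb : s.reg base = x) (hl : s.reg len = y) (hi : Ev w s idx t) (h : y ≠ 0 → x + t * y < 2 ^ w) :
    Ev w s (itemE base len idx) (x + t * y) := by
  have h' : x + t * y < 2 ^ w := by
    rcases Nat.eq_zero_or_pos y with h0 | h0
    · rw [h0, mul_zero, add_zero, ← hb]; exact hw.reg _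
    · exact h h0.ne'
  exact Ev.add (Ev.var' hb) (Ev.mul hi (Ev.var' hl) (by omega)) h'

/-- Round `k` treats item `ρ k`; as `ρ` is an involution, item `t` is treated in round `ρ t`. After
`k` rounds the items with `ρ t < k` are in place and every other bit is as at the start. `hcol`
ensures that no round overwrites a source bit of a later one; within a round the item is read before
it is written. For `len = 0` nothing is moved, but positions are still computed and must not
overflow, whence `hz`. -/
theorem runs_copyLoop {w b N len W off base W' off' base' : ℕ} {s : State}
    {c rl rW ro rB rW' ro' rB' : ℕ} {idx : Expr}
    (hr : c < 40 ∧ rl < 40 ∧ rW < 40 ∧ ro < 40 ∧ rB < 40 ∧ rW' < 40 ∧ ro' < 40 ∧ rB' < 40)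
    (hb : s.reg 2 = b) (hN : s.reg c = N) (hl : s.reg rl = len)
    (hW : s.reg rW = W) (ho : s.reg ro = off) (hB : s.reg rB = base)
    (hW' : s.reg rW' = W') (ho' : s.reg ro' = off') (hB' : s.reg rB' = base')
    (hw1 : 1 < 2 ^ w) (hnb : s.arr.length * b < 2 ^ w)
    (hWb : off + W ≤ b) (hWb' : off' + W' ≤ b) (hlen : len ≤ W) (hlen' : len ≤ W')
    (hz : len = 0 → viewPos b W off base < 2 ^ w ∧ viewPos b W' off' base' < 2 ^ w ∧
      (W = 0 → base = 0) ∧ (W' = 0 → base' = 0))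
    (hS : ∀ u < N * len, (base + u) / W < s.arr.length)
    (hD : ∀ u < N * len, (base' + u) / W' < s.arr.length)
    (ρ : ℕ → ℕ) (hρ : ∀ k < N, ρ k < N ∧ ρ (ρ k) = k)
    (hidx : ∀ s' k, k < N → WF w b s' → s'.reg 40 = k → s'.reg c = N → Ev w s' idx (ρ k))
    (hcol : ∀ u v, u < N * len → v < N * len → ρ (u / len) < ρ (v / len) →
      viewPos b W' off' (base' + u) ≠ viewPos b W off (base + v)) :
    Runs w b (copyLoop c rl rW ro rB rW' ro' rB' idx) s (6 + N * (100 * (idx.cost + 100)))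
      (fun s' => Keep s s' ∧
        (∀ u < N * len, arrayBit b s'.arr (viewPos b W' off' (base' + u)) =
          arrayBit b s.arr (viewPos b W off (base + u))) ∧
        ∀ p, (∀ u < N * len, p ≠ viewPos b W' off' (base' + u)) →
          arrayBit b s'.arr p = arrayBit b s.arr p) := by
  have hu : ∀ t j, t < N → j < len → t * len + j < N * len := fun t j ht hj => by
    have : (t + 1) * len ≤ N * len := Nat.mul_le_mul_right _ ht
    rw [add_mul] at this; omega
  have hdiv : ∀ t j, j < len → (t * len + j) / len = t := fun t j hj => by
    rw [mul_comm, Nat.mul_add_div (by omega), Nat.div_eq_of_lt hj, add_zero]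
  have hposS : ∀ u < N * len, viewPos b W off (base + u) < 2 ^ w := fun u h => by
    have h0 : 0 < len := by
      rcases Nat.eq_zero_or_pos len with h1 | h1
      · simp [h1] at h
      · exact h1
    exact (viewPos_lt hWb (by omega) (hS u h)).trans hnb
  have hposD : ∀ u < N * len, viewPos b W' off' (base' + u) < 2 ^ w := fun u h => by
    have h0 : 0 < len := by
      rcases Nat.eq_zero_or_pos len with h1 | h1
      · simp [h1] at h
      · exact h1
    exact (viewPos_lt hWb' (by omega) (hD u h)).trans hnb
  refine (runs_writeLoop (by omega) hb hN hW' ho' hl hw1 hWb' hlen' hnb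
    (fun k B => (∀ u < N * len, ρ (u / len) < k → B (viewPos b W' off' (base' + u)) =
          arrayBit b s.arr (viewPos b W off (base + u))) ∧
        ∀ p, (∀ u < N * len, ρ (u / len) < k → p ≠ viewPos b W' off' (base' + u)) →
          B p = arrayBit b s.arr p) ⟨by omega, fun _ _ => rfl⟩ ?_).mono ?_ ?_
  · intro k hk Z hZ hJ
    obtain ⟨hk1, hk2⟩ := hρ k hk
    set t := ρ k with ht
    have hwS : len ≠ 0 → base + t * len < 2 ^ w := fun _ =>
      (le_viewPos hWb).trans_lt (hposS _ (by simpa using hu t 0 hk1 (by omega)))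
    have hwD : len ≠ 0 → base' + t * len < 2 ^ w := fun _ =>
      (le_viewPos hWb').trans_lt (hposD _ (by simpa using hu t 0 hk1 (by omega)))
    refine ⟨base' + t * len, getView b W off Z (base + t * len) len, getView_lt _, ?_, ?_, ?_, ?_,
      ?_⟩
    · rcases Nat.eq_zero_or_pos len with h0 | h0
      · rw [h0, mul_zero, add_zero]; exact (hz h0).2.1
      · exact hposD _ (by simpa using hu t 0 hk1 h0)
    · intro j hj
      rw [add_assoc]
      exact hD _ (hu t j hk1 hj)
    · intro h0
      have h1 : len = 0 := by omega
      rw [(hz h1).2.2.2 h0, h1, mul_zero, add_zero]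
    · intro s' hwf hK hi harr
      have hreg : ∀ r, r < 40 → s'.reg r = s.reg r := fun r hr => hK.reg r (by omega)
      have ei := hidx s' k hk hwf hi ((hreg c (by omega)).trans hN)
      refine ⟨Ev.item hwf ((hreg _ (by omega)).trans hB') ((hreg _ (by omega)).trans hl) ei hwD, ?_⟩
      rw [← harr]
      refine Ev.getView hwf (Ev.var' ((hreg 2 (by omega)).trans hb))
        (Ev.var' ((hreg _ (by omega)).trans hW)) (Ev.var' ((hreg _ (by omega)).trans ho))
        (Ev.item hwf ((hreg _ (by omega)).trans hB) ((hreg _ (by omega)).trans hl) ei hwS)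
        (Ev.var' ((hreg _ (by omega)).trans hl)) hWb hlen ?_ ?_ ?_
      · rcases Nat.eq_zero_or_pos len with h0 | h0
        · rw [h0, mul_zero, add_zero]; exact (hz h0).1
        · exact hposS _ (by simpa using hu t 0 hk1 h0)
      · intro j hj
        rw [add_assoc]
        exact hposS _ (hu t j hk1 hj)
      · intro h0
        have h1 : len = 0 := by omega
        rw [(hz h1).2.2.1 h0, h1, mul_zero, add_zero]
    · intro B' hB'
      have hinj : ∀ u v, u < N * len → viewPos b W' off' (base' + u) =
          viewPos b W' off' (base' + v) → u = v := fun u v h1 h2 => by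
        have h0 : 0 < len := by
          rcases Nat.eq_zero_or_pos len with h3 | h3
          · simp [h3] at h1
          · exact h3
        have := viewPos_inj hWb' (by omega) h2
        omega
      refine ⟨fun u hu1 hu2 => ?_, fun p hp => ?_⟩
      · have h0 : 0 < len := by
          rcases Nat.eq_zero_or_pos len with h3 | h3
          · simp [h3] at hu1
          · exact h3
        have hul : u / len < N := Nat.div_lt_of_lt_mul (by rwa [mul_comm])
        by_cases h3 : ρ (u / len) = k
        · have h4 : u / len = t := by rw [ht, ← h3, (hρ _ hul).2]
          have h5 : u = t * len + u % len := by
            rw [← h4, mul_comm]; exact (Nat.div_add_mod u len).symm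
          have h6 := Nat.mod_lt u h0
          have := hB'.set (u % len) h6
          rw [add_assoc, ← h5] at this
          rw [this, testBit_getView Z hWb hlen h6, add_assoc, ← h5]
          -- The source bit still has its initial value: by `hcol` it is not a destination of an
          -- earlier round.
          refine hJ.2 _ fun v hv hvk => ?_
          refine (hcol v u hv hu1 ?_).symm
          rw [h3]; exact hvk
        · rw [hB'.keep]
          · exact hJ.1 u hu1 (by omega)
          · intro j hj h4
            rw [add_assoc] at h4
            have := hinj _ _ hu1 h4
            apply h3
            rw [this, hdiv t j hj, ht, hk2]
      · rw [hB'.keep]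
        · exact hJ.2 p fun u h1 h2 => hp u h1 (by omega)
        · intro j hj
          rw [add_assoc]
          refine hp _ (hu t j hk1 hj) ?_
          rw [hdiv t j hj, ht, hk2]
          omega
  · refine Nat.add_le_add_left (Nat.mul_le_mul_left _ ?_) _
    simp [Expr.cost, itemE, getViewE, fieldE, Expr.low, shiftE, viewPosE, headE]
    omega
  · rintro s' - ⟨hK, h1, h2⟩
    have h3 : ∀ u < N * len, ρ (u / len) < N := fun u h =>
      (hρ _ (Nat.div_lt_of_lt_mul (by rwa [mul_comm]))).1
    exact ⟨hK, fun u h => h1 u h (h3 u h), fun p hp => h2 p fun u h _ => hp u h⟩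

end WordRAM

/-! ### Copying in both directions, and writing computed items -/

namespace WordRAM

open EliasFano

section Copy

variable {w b N len W off base W' off' base' : ℕ} {s : State} {c rl rW ro rB rW' ro' rB' : ℕ}

/-- Meant for moves towards the front: if bit `u` goes to a place not after its source, then this
place precedes the sources of all later bits. -/
theorem runs_copyUp
    (hr : c < 40 ∧ rl < 40 ∧ rW < 40 ∧ ro < 40 ∧ rB < 40 ∧ rW' < 40 ∧ ro' < 40 ∧ rB' < 40)
    (hb : s.reg 2 = b) (hN : s.reg c = N) (hl : s.reg rl = len)
    (hW : s.reg rW = W) (ho : s.reg ro = off) (hB : s.reg rB = base)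
    (hW' : s.reg rW' = W') (ho' : s.reg ro' = off') (hB' : s.reg rB' = base')
    (hw1 : 1 < 2 ^ w) (hnb : s.arr.length * b < 2 ^ w)
    (hWb : off + W ≤ b) (hWb' : off' + W' ≤ b) (hlen : len ≤ W) (hlen' : len ≤ W')
    (hz : len = 0 → viewPos b W off base < 2 ^ w ∧ viewPos b W' off' base' < 2 ^ w ∧
      (W = 0 → base = 0) ∧ (W' = 0 → base' = 0))
    (hS : ∀ u < N * len, (base + u) / W < s.arr.length)
    (hD : ∀ u < N * len, (base' + u) / W' < s.arr.length)
    (hcol : ∀ u v, u < v → v < N * len →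
      viewPos b W' off' (base' + u) ≠ viewPos b W off (base + v)) :
    Runs w b (copyLoop c rl rW ro rB rW' ro' rB' upE) s (6 + N * (100 * (upE.cost + 100)))
      (fun s' => Keep s s' ∧
        (∀ u < N * len, arrayBit b s'.arr (viewPos b W' off' (base' + u)) =
          arrayBit b s.arr (viewPos b W off (base + u))) ∧
        ∀ p, (∀ u < N * len, p ≠ viewPos b W' off' (base' + u)) →
          arrayBit b s'.arr p = arrayBit b s.arr p) := by
  refine runs_copyLoop hr hb hN hl hW ho hB hW' ho' hB' hw1 hnb hWb hWb' hlen hlen' hz hS hD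
    (fun k => k) (fun k hk => ⟨hk, rfl⟩) (fun s' k _ _ hi _ => Ev.var' hi) fun u v _ hv huv =>
      hcol u v ?_ hv
  by_contra h
  exact absurd (Nat.div_le_div_right (c := len) (not_lt.mp h)) (not_le.mpr huv)

/-- The mirror image, meant for moves towards the back. -/
theorem runs_copyDown
    (hr : c < 40 ∧ rl < 40 ∧ rW < 40 ∧ ro < 40 ∧ rB < 40 ∧ rW' < 40 ∧ ro' < 40 ∧ rB' < 40)
    (hb : s.reg 2 = b) (hN : s.reg c = N) (hl : s.reg rl = len)
    (hW : s.reg rW = W) (ho : s.reg ro = off) (hB : s.reg rB = base)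
    (hW' : s.reg rW' = W') (ho' : s.reg ro' = off') (hB' : s.reg rB' = base')
    (hw1 : 1 < 2 ^ w) (hnb : s.arr.length * b < 2 ^ w)
    (hWb : off + W ≤ b) (hWb' : off' + W' ≤ b) (hlen : len ≤ W) (hlen' : len ≤ W')
    (hz : len = 0 → viewPos b W off base < 2 ^ w ∧ viewPos b W' off' base' < 2 ^ w ∧
      (W = 0 → base = 0) ∧ (W' = 0 → base' = 0))
    (hS : ∀ u < N * len, (base + u) / W < s.arr.length)
    (hD : ∀ u < N * len, (base' + u) / W' < s.arr.length)
    (hcol : ∀ u v, v < u → u < N * len →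
      viewPos b W' off' (base' + u) ≠ viewPos b W off (base + v)) :
    Runs w b (copyLoop c rl rW ro rB rW' ro' rB' (downE c)) s
      (6 + N * (100 * ((downE c).cost + 100)))
      (fun s' => Keep s s' ∧
        (∀ u < N * len, arrayBit b s'.arr (viewPos b W' off' (base' + u)) =
          arrayBit b s.arr (viewPos b W off (base + u))) ∧
        ∀ p, (∀ u < N * len, p ≠ viewPos b W' off' (base' + u)) →
          arrayBit b s'.arr p = arrayBit b s.arr p) := by
  refine runs_copyLoop hr hb hN hl hW ho hB hW' ho' hB' hw1 hnb hWb hWb' hlen hlen' hz hS hD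
    (fun k => N - k - 1) (fun k hk => by omega)
    (fun s' k _ hwf hi hc => Ev.sub hwf (Ev.sub hwf (Ev.var' hc) (Ev.var' hi)) (Ev.lit hw1))
    fun u v hu _ huv => hcol u v ?_ hu
  by_contra h
  have h1 := Nat.div_le_div_right (c := len) (not_lt.mp h)
  have : v / len < N ∨ v / len ≥ N := by omega
  omega

/-- Overwrite items of `len` bits each by the values of an expression. -/
def putLoop (c len W off base : ℕ) (eX : Expr) : Cmd :=
  writeLoop c W off len (itemE base len upE) eX

theorem runs_putLoop {eX : Expr}
    (hr : c < 40 ∧ rl < 40 ∧ rW < 40 ∧ ro < 40 ∧ rB < 40)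
    (hb : s.reg 2 = b) (hN : s.reg c = N) (hl : s.reg rl = len)
    (hW : s.reg rW = W) (ho : s.reg ro = off) (hB : s.reg rB = base)
    (hw1 : 1 < 2 ^ w) (hnb : s.arr.length * b < 2 ^ w) (hWb : off + W ≤ b) (hlen : len ≤ W)
    (hz : len = 0 → viewPos b W off base < 2 ^ w ∧ (W = 0 → base = 0))
    (hD : ∀ u < N * len, (base + u) / W < s.arr.length)
    (X : ℕ → ℕ) (hX : ∀ k < N, X k < 2 ^ len)
    (hev : ∀ s' k, k < N → WF w b s' → Keep s s' → s'.reg 40 = k → Ev w s' eX (X k)) :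
    Runs w b (putLoop c rl rW ro rB eX) s (6 + N * (5 + eX.cost + 1010))
      (fun s' => Keep s s' ∧
        (∀ k < N, ∀ j < len, arrayBit b s'.arr (viewPos b W off (base + (k * len + j))) =
          (X k).testBit (len - 1 - j)) ∧
        ∀ p, (∀ u < N * len, p ≠ viewPos b W off (base + u)) →
          arrayBit b s'.arr p = arrayBit b s.arr p) := by
  have hu : ∀ t j, t < N → j < len → t * len + j < N * len := fun t j ht hj => by
    have : (t + 1) * len ≤ N * len := Nat.mul_le_mul_right _ ht
    rw [add_mul] at this; omega
  refine (runs_writeLoop (by omega) hb hN hW ho hl hw1 hWb hlen hnb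
    (fun k B => (∀ t < k, ∀ j < len, B (viewPos b W off (base + (t * len + j))) =
          (X t).testBit (len - 1 - j)) ∧
        ∀ p, (∀ u < N * len, p ≠ viewPos b W off (base + u)) → B p = arrayBit b s.arr p)
    ⟨by omega, fun _ _ => rfl⟩ ?_).mono ?_ ?_
  · intro k hk Z hZ hJ
    have hpos : len ≠ 0 → viewPos b W off (base + k * len) < 2 ^ w := fun h0 =>
      (viewPos_lt hWb (by omega) (hD _ (by simpa using hu k 0 hk (by omega)))).trans hnb
    refine ⟨base + k * len, X k, hX k hk, ?_, ?_, ?_, ?_, ?_⟩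
    · rcases Nat.eq_zero_or_pos len with h0 | h0
      · rw [h0, mul_zero, add_zero]; exact (hz h0).1
      · exact hpos h0.ne'
    · intro j hj
      rw [add_assoc]
      exact hD _ (hu k j hk hj)
    · intro h0
      have h1 : len = 0 := by omega
      rw [(hz h1).2 h0, h1, mul_zero, add_zero]
    · intro s' hwf hK hi harr
      have hreg : ∀ r, r < 40 → s'.reg r = s.reg r := fun r hr => hK.reg r (by omega)
      exact ⟨Ev.item hwf ((hreg _ (by omega)).trans hB) ((hreg _ (by omega)).trans hl)
        (Ev.var' hi) fun h0 => (le_viewPos hWb).trans_lt (hpos h0), hev s' k hk hwf hK hi⟩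
    · intro B' hB'
      refine ⟨fun t ht j hj => ?_, fun p hp => ?_⟩
      · by_cases htk : t = k
        · subst htk
          rw [← hB'.set j hj, add_assoc]
        · rw [hB'.keep]
          · exact hJ.1 t (by omega) j hj
          · intro i hi h1
            have h2 := viewPos_inj hWb (by omega) h1
            have h3 : (t + 1) * len ≤ k * len := Nat.mul_le_mul_right _ (by omega)
            rw [add_mul] at h3
            omega
      · rw [hB'.keep, hJ.2 p hp]
        intro j hj
        rw [add_assoc]
        exact hp _ (hu k j hk hj)
  · refine Nat.add_le_add_left (Nat.mul_le_mul_left _ ?_) _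
    simp [Expr.cost, itemE, upE]
  · rintro s' - ⟨hK, h1, h2⟩
    exact ⟨hK, h1, h2⟩

/-- Set the bits of a view with the numbers `base + (eH + i)`, where `i` is the loop counter. The
variable `one` holds the number `1`. -/
def scatterLoop (c one W off base : ℕ) (eH : Expr) : Cmd :=
  writeLoop c W off one (.bin .add (.var base) (.bin .add eH (.var 40))) (.lit 1)

/-- The expression for `H k` may read the array: `hev` supplies that all bits outside the vector are
still as at the start. -/
theorem runs_scatterLoop {eH : Expr} {U : ℕ}
    (hr : c < 40 ∧ rl < 40 ∧ rW < 40 ∧ ro < 40 ∧ rB < 40)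
    (hb : s.reg 2 = b) (hN : s.reg c = N) (hl : s.reg rl = 1)
    (hW : s.reg rW = W) (ho : s.reg ro = off) (hB : s.reg rB = base)
    (hw1 : 1 < 2 ^ w) (hnb : s.arr.length * b < 2 ^ w) (hWb : off + W ≤ b) (hlen : 0 < W)
    (hD : ∀ u < U, (base + u) / W < s.arr.length)
    (H : ℕ → ℕ) (hH : ∀ k < N, H k + k < U)
    (h0 : ∀ u < U, arrayBit b s.arr (viewPos b W off (base + u)) = false)
    (hev : ∀ s' k, k < N → WF w b s' → Keep s s' → s'.reg 40 = k →
      (∀ p, (∀ u < U, p ≠ viewPos b W off (base + u)) →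
          arrayBit b s'.arr p = arrayBit b s.arr p) → Ev w s' eH (H k)) :
    Runs w b (scatterLoop c rl rW ro rB eH) s (6 + N * (4 + eH.cost + 1 + 1010))
      (fun s' => Keep s s' ∧
        (∀ u < U, arrayBit b s'.arr (viewPos b W off (base + u)) =
          decide (∃ k < N, H k + k = u)) ∧
        ∀ p, (∀ u < U, p ≠ viewPos b W off (base + u)) →
          arrayBit b s'.arr p = arrayBit b s.arr p) := by
  refine (runs_writeLoop (by omega) hb hN hW ho hl hw1 hWb hlen hnb
    (fun k B => (∀ u < U, B (viewPos b W off (base + u)) =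
          decide (∃ t < k, H t + t = u)) ∧
        ∀ p, (∀ u < U, p ≠ viewPos b W off (base + u)) → B p = arrayBit b s.arr p)
    ⟨fun u hu => by simpa using h0 u hu, fun _ _ => rfl⟩ ?_).mono ?_ ?_
  · intro k hk Z hZ hJ
    have hpos : viewPos b W off (base + (H k + k)) < 2 ^ w :=
      (viewPos_lt hWb (by omega) (hD _ (hH k hk))).trans hnb
    have hle := le_viewPos hWb (v := base + (H k + k))
    refine ⟨base + (H k + k), 1, by norm_num, hpos, ?_, by omega, ?_, ?_⟩
    · intro j hj
      obtain rfl : j = 0 := by omega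
      exact hD _ (hH k hk)
    · intro s' hwf hK hi harr
      exact ⟨Ev.add (Ev.var' ((hK.reg _ (by omega)).trans hB))
        (Ev.add (hev s' k hk hwf hK hi (harr ▸ hJ.2)) (Ev.var' hi) (by omega)) (by omega),
        Ev.lit hw1⟩
    · intro B' hB'
      refine ⟨fun u hu => ?_, fun p hp => ?_⟩
      · by_cases huk : u = H k + k
        · have := hB'.set 0 (by omega)
          rw [add_zero] at this
          rw [huk, this]
          have : ∃ t < k + 1, H t + t = H k + k := ⟨k, by omega, rfl⟩
          rw [decide_eq_true this]; rfl
        · rw [hB'.keep, hJ.1 u hu]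
          · congr 1
            apply propext
            constructor
            · rintro ⟨t, ht, h⟩; exact ⟨t, by omega, h⟩
            · rintro ⟨t, ht, h⟩
              refine ⟨t, ?_, h⟩
              rcases Nat.lt_succ_iff_lt_or_eq.mp ht with h1 | h1
              · exact h1
              · rw [h1] at h; exact absurd h.symm huk
          · intro j hj h1
            obtain rfl : j = 0 := by omega
            have := viewPos_inj hWb hlen h1
            omega
      · rw [hB'.keep, hJ.2 p hp]
        intro j hj
        obtain rfl : j = 0 := by omega
        exact hp _ (hH k hk)
  · refine Nat.add_le_add_left (Nat.mul_le_mul_left _ ?_) _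
    simp [Expr.cost]
    omega
  · rintro s' - ⟨hK, h1, h2⟩
    exact ⟨hK, h1, h2⟩

end Copy

end WordRAM

namespace EliasFano

/-! ### Arithmetic of the encoding -/

section Width

variable {n m : ℕ}

theorem two_pow_lowWidth_mul_le (hn : 0 < n) (hm : n ≤ m) : 2 ^ lowWidth n m * n ≤ m := by
  have h1 : 2 ^ lowWidth n m ≤ m / n :=
    Nat.pow_log_le_self 2 (Nat.div_pos hm hn).ne'
  exact (Nat.mul_le_mul_right _ h1).trans (Nat.div_mul_le_self _ _)

theorem lt_two_pow_lowWidth_mul (hn : 0 < n) : m < 2 ^ (lowWidth n m + 1) * n := by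
  have h1 : m / n < 2 ^ (lowWidth n m + 1) := Nat.lt_pow_succ_log_self (by norm_num) _
  rwa [Nat.div_lt_iff_lt_mul hn] at h1

theorem le_two_pow_cellWidth (m : ℕ) : m ≤ 2 ^ cellWidth m := Nat.le_pow_clog (by norm_num) _

/-- Since `2^l * 2^k ≤ 2^l * n ≤ m ≤ 2^b`. It is used with `k = 2` for all lists and with `k = 6`
for `n ≥ 64`. -/
theorem lowWidth_add_le {k : ℕ} (hn : 2 ^ k ≤ n) (hm : n ≤ m) : lowWidth n m + k ≤ cellWidth m := by
  have h0 : 0 < n := lt_of_lt_of_le (by positivity) hn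
  have h1 : 2 ^ (lowWidth n m + k) ≤ 2 ^ cellWidth m := by
    rw [pow_add]
    exact (Nat.mul_le_mul_left _ hn).trans
      ((two_pow_lowWidth_mul_le h0 hm).trans (le_two_pow_cellWidth m))
  exact (Nat.pow_le_pow_iff_right (by norm_num)).mp h1

/-- High-order parts are short: from `m < 2^(l+1) * n` they have at most `1 + ⌈lg n⌉` bits, however
large the universe is. -/
theorem cellWidth_le (hn : 0 < n) : cellWidth m ≤ lowWidth n m + 1 + Nat.clog 2 n := by
  apply Nat.clog_le_of_le_pow
  rw [pow_add]
  exact (lt_two_pow_lowWidth_mul hn).le.trans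
    (Nat.mul_le_mul_left _ (Nat.le_pow_clog (by norm_num) _))

theorem cellWidth_le_of_fits {w : ℕ} (h : m < 2 ^ w) : cellWidth m ≤ w :=
  Nat.clog_le_of_le_pow h.le

/-- `r - 1 ≤ lg r` for `1 ≤ r ≤ 2`. -/
theorem sub_one_le_logb {r : ℝ} (h1 : 1 ≤ r) (h2 : r ≤ 2) : r - 1 ≤ Real.logb 2 r := by
  rw [Real.le_logb_iff_rpow_le (by norm_num) (by linarith)]
  -- Bernoulli's inequality with exponent `r - 1` in `[0, 1]`: `2^(r-1) ≤ 1 + (r-1)`.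
  have := rpow_one_add_le_one_add_mul_self (s := 1) (by norm_num) (p := r - 1) (by linarith)
    (by linarith)
  norm_num at this
  exact this

end Width

section List

variable {n m : ℕ} {A : List ℕ}

theorem IsSortedList.getD_lt (hA : IsSortedList n m A) {i : ℕ} (hi : i < n) :
    A.getD i 0 < m := by
  rw [List.getD_eq_getElem _ _ (by rw [hA.1]; exact hi)]
  exact hA.2.2 _ (List.getElem_mem _)

theorem IsSortedList.mono (hA : IsSortedList n m A) {i j : ℕ} (hij : i ≤ j) (hj : j < n) :
    A.getD i 0 ≤ A.getD j 0 := by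
  rcases hij.lt_or_eq with h | rfl
  · rw [List.getD_eq_getElem _ _ (by rw [hA.1]; omega),
      List.getD_eq_getElem _ _ (by rw [hA.1]; exact hj)]
    exact List.pairwise_iff_getElem.mp hA.2.1 _ _ _ _ h
  · exact le_rfl

/-- The high-order part of the `i`-th element. -/
def high (m : ℕ) (A : List ℕ) (i : ℕ) : ℕ := A.getD i 0 / 2 ^ lowWidth A.length m

theorem high_mono (hA : IsSortedList n m A) {i j : ℕ} (hij : i ≤ j) (hj : j < n) :
    high m A i ≤ high m A j := Nat.div_le_div_right (hA.mono hij hj)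

theorem high_lt (hA : IsSortedList n m A) {i : ℕ} (hi : i < n) : high m A i < 2 * n := by
  unfold high
  rw [hA.1]
  apply Nat.div_lt_of_lt_mul
  have := lt_two_pow_lowWidth_mul (m := m) (show 0 < n by omega)
  rw [pow_succ, mul_assoc] at this
  exact (hA.getD_lt hi).trans this

/-- The ones of the encoding precede its last `n lg n - 2 n` positions. -/
theorem high_add_lt_real (hA : IsSortedList n m A) (hn : 0 < n) (hm : n ≤ m) {i : ℕ} (hi : i < n) :
    (n * lowWidth n m + high m A i + i : ℝ) <
      n * cellWidth m - (n * Real.logb 2 n - 2 * n) := by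
  set l := lowWidth n m with hl
  have hn0 : (0 : ℝ) < n := by exact_mod_cast hn
  have hm0 : (0 : ℝ) < m := by exact_mod_cast (show 0 < m by omega)
  have h2l : (0 : ℝ) < 2 ^ l := by positivity
  -- The rounding in `l = ⌊lg (m/n)⌋` is measured by a factor `r` between 1 and 2.
  set r : ℝ := m / (2 ^ l * n) with hr
  have hmr : (m : ℝ) = 2 ^ l * n * r := by rw [hr]; field_simp
  have h1 : 1 ≤ r := by
    rw [hr, le_div_iff₀ (by positivity), one_mul]
    exact_mod_cast two_pow_lowWidth_mul_le hn hm
  have h2 : r ≤ 2 := by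
    rw [hr, div_le_iff₀ (by positivity)]
    have : (m : ℝ) < 2 ^ (l + 1) * n := by exact_mod_cast lt_two_pow_lowWidth_mul (m := m) hn
    rw [pow_succ] at this
    linarith
  have hb : Real.logb 2 m ≤ cellWidth m := by
    rw [Real.logb_le_iff_le_rpow (by norm_num) hm0, Real.rpow_natCast]
    exact_mod_cast le_two_pow_cellWidth m
  have hlog : Real.logb 2 m = l + Real.logb 2 n + Real.logb 2 r := by
    rw [hmr, Real.logb_mul (by positivity) (by positivity),
      Real.logb_mul (by positivity) (by positivity), Real.logb_pow]
    simp
  have hh : (high m A i : ℝ) < r * n := by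
    unfold high
    rw [hA.1, ← hl]
    have h3 : (((A.getD i 0) / 2 ^ l : ℕ) : ℝ) ≤ (A.getD i 0 : ℝ) / ((2 ^ l : ℕ) : ℝ) :=
      Nat.cast_div_le
    have h4 : (A.getD i 0 : ℝ) < m := by exact_mod_cast hA.getD_lt hi
    refine h3.trans_lt ?_
    push_cast
    rw [div_lt_iff₀ h2l]
    calc (A.getD i 0 : ℝ) < m := h4
      _ = r * n * 2 ^ l := by rw [hmr]; ring
  have hi' : (i : ℝ) < n := by exact_mod_cast hi
  have h3 := sub_one_le_logb h1 h2
  have h5 : (n : ℝ) * (l + Real.logb 2 n + Real.logb 2 r) ≤ n * cellWidth m :=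
    mul_le_mul_of_nonneg_left (hlog ▸ hb) hn0.le
  have h6 : (n : ℝ) * (r - 1) ≤ n * Real.logb 2 r := mul_le_mul_of_nonneg_left h3 hn0.le
  -- With `high < r * n` and `i < n` on the left and `b ≥ l + lg n + lg r` on the right, what
  -- remains is `n * (r - 1) ≤ n * lg r`.
  nlinarith

/-- For `n ≥ 4` the number `n lg n - 2 n` is not negative, so the ones lie inside the array. -/
theorem high_add_lt (hA : IsSortedList n m A) (hn : 4 ≤ n) (hm : n ≤ m) {i : ℕ} (hi : i < n) :
    n * lowWidth n m + (high m A i + i) < n * cellWidth m := by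
  have h1 := high_add_lt_real hA (by omega) hm hi
  have hn0 : (4 : ℝ) ≤ n := by exact_mod_cast hn
  have h2 : 2 ≤ Real.logb 2 n := by
    rw [Real.le_logb_iff_rpow_le (by norm_num) (by linarith)]
    norm_num
    exact hn
  have h3 : (n * lowWidth n m + (high m A i + i) : ℝ) < n * cellWidth m := by nlinarith
  exact_mod_cast h3

end List

/-! ### Arrays as bit strings -/

/-- Bound and bits are proved together: the summand `2 ^ b` does not interfere with the lower bits
because the sum so far is below it. -/
theorem sum_bits (f : ℕ → Bool) (b : ℕ) :
    (∑ k ∈ Finset.range b, if f k then 2 ^ k else 0) < 2 ^ b ∧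
      ∀ j, (∑ k ∈ Finset.range b, if f k then 2 ^ k else 0).testBit j =
        (decide (j < b) && f j) := by
  induction b with
  | zero => simp
  | succ b ih =>
    rw [Finset.sum_range_succ]
    set S := ∑ k ∈ Finset.range b, if f k then 2 ^ k else 0
    have h : (S + if f b then 2 ^ b else 0) = 2 ^ b * (f b).toNat + S := by
      cases f b <;> simp [add_comm]
    refine ⟨?_, fun j => ?_⟩
    · rw [pow_succ]
      split_ifs <;> omega
    · rw [h, Nat.testBit_two_pow_mul_add _ ih.1]
      split_ifs with hj
      · rw [ih.2]; simp [hj, Nat.lt_succ_of_lt hj]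
      · by_cases hjb : j = b
        · subst hjb; cases f j <;> simp
        · have : ¬ j < b + 1 := by omega
          have h2 : (f b).toNat < 2 ^ (j - b) := by
            have : 1 < 2 ^ (j - b) := Nat.one_lt_two_pow (by omega)
            have := Bool.toNat_le (f b)
            omega
          rw [Nat.testBit_lt_two_pow h2]
          simp [this]

theorem sum_bits_reflect (f : ℕ → Bool) (b : ℕ) :
    (∑ k ∈ Finset.range b, if f k then 2 ^ (b - 1 - k) else 0) =
      ∑ k ∈ Finset.range b, if f (b - 1 - k) then 2 ^ k else 0 := by
  rw [← Finset.sum_range_reflect]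
  refine Finset.sum_congr rfl fun k hk => ?_
  rw [Finset.mem_range] at hk
  rw [show b - 1 - (b - 1 - k) = k by omega]

@[simp] theorem length_packBits (b n : ℕ) (f : ℕ → Bool) : (packBits b n f).length = n := by
  simp [packBits]

theorem packBits_lt {b n : ℕ} {f : ℕ → Bool} : ∀ x ∈ packBits b n f, x < 2 ^ b := by
  intro x hx
  obtain ⟨c, -, rfl⟩ := List.mem_map.mp hx
  rw [sum_bits_reflect (fun k => f (c * b + k))]
  exact (sum_bits (fun k => f (c * b + (b - 1 - k))) b).1

theorem arrayBit_packBits {b n : ℕ} (f : ℕ → Bool) {p : ℕ} (hp : p < n * b) :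
    arrayBit b (packBits b n f) p = f p := by
  have hb : 0 < b := Nat.pos_of_ne_zero fun h => by simp [h] at hp
  have hc : p / b < n := Nat.div_lt_of_lt_mul (by rwa [mul_comm])
  have hm := Nat.mod_lt p hb
  unfold arrayBit
  rw [List.getD_eq_getElem _ _ (by simpa using hc)]
  simp only [packBits, List.getElem_map, List.getElem_range]
  rw [sum_bits_reflect (fun k => f (p / b * b + k)), (sum_bits (fun k => f (p / b * b + (b - 1 - k)))
    b).2]
  rw [show b - 1 - (b - 1 - p % b) = p % b by omega, mul_comm, Nat.div_add_mod]
  simp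
  omega

theorem arrayBit_of_length_le {b : ℕ} {Z : List ℕ} {p : ℕ} (hb : 0 < b) (h : Z.length * b ≤ p) :
    arrayBit b Z p = false := by
  have : Z.length ≤ p / b := by rwa [Nat.le_div_iff_mul_le hb]
  unfold arrayBit
  rw [List.getD_eq_default _ _ this]
  simp

theorem arrayBit_cell {b c j : ℕ} (Z : List ℕ) (hj : j < b) :
    arrayBit b Z (c * b + j) = (Z.getD c 0).testBit (b - 1 - j) := by
  unfold arrayBit
  have h1 : (c * b + j) / b = c := by
    rw [mul_comm, Nat.mul_add_div (by omega), Nat.div_eq_of_lt hj, add_zero]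
  have h2 : (c * b + j) % b = j := by
    rw [mul_comm, Nat.mul_add_mod, Nat.mod_eq_of_lt hj]
  rw [h1, h2]

theorem array_ext {b n : ℕ} {Y Z : List ℕ} (hY : Y.length = n) (hZ : Z.length = n)
    (hYb : ∀ x ∈ Y, x < 2 ^ b) (hZb : ∀ x ∈ Z, x < 2 ^ b)
    (h : ∀ p < n * b, arrayBit b Y p = arrayBit b Z p) : Y = Z := by
  apply List.ext_getElem (hY.trans hZ.symm)
  intro i h1 h2
  apply Nat.eq_of_testBit_eq
  intro j
  by_cases hj : j < b
  · have h3 : i * b + (b - 1 - j) < n * b := by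
      have : (i + 1) * b ≤ n * b := Nat.mul_le_mul_right _ (by omega)
      rw [add_mul] at this
      omega
    have := h _ h3
    rw [arrayBit_cell _ (by omega), arrayBit_cell _ (by omega), List.getD_eq_getElem _ _ h1,
      List.getD_eq_getElem _ _ h2, show b - 1 - (b - 1 - j) = j by omega] at this
    exact this
  · have hp : 2 ^ b ≤ 2 ^ j := Nat.pow_le_pow_right (by norm_num) (by omega)
    rw [Nat.testBit_lt_two_pow ((hYb _ (List.getElem_mem h1)).trans_le hp),
      Nat.testBit_lt_two_pow ((hZb _ (List.getElem_mem h2)).trans_le hp)]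

/-! ### The bits of the compact format -/

section Compact

variable {n m : ℕ} {A : List ℕ}

theorem length_compact (hA : IsSortedList n m A) : (compact m A).length = n := by
  rw [compact, length_packBits, hA.1]

theorem bit_low (hA : IsSortedList n m A) {p : ℕ} (hp : p < n * lowWidth n m) :
    bit m A p = (A.getD (p / lowWidth n m) 0).testBit (lowWidth n m - 1 - p % lowWidth n m) := by
  simp only [bit, hA.1, if_pos hp]

theorem bit_high (hA : IsSortedList n m A) (j : ℕ) :
    bit m A (n * lowWidth n m + j) = decide (∃ k < n, high m A k + k = j) := by
  simp only [bit, upperBit, high, hA.1]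
  rw [if_neg (by omega), Nat.add_sub_cancel_left]

theorem arrayBit_compact (hA : IsSortedList n m A) {p : ℕ} (hp : p < n * cellWidth m) :
    arrayBit (cellWidth m) (compact m A) p = bit m A p := by
  unfold compact
  rw [hA.1]
  exact arrayBit_packBits _ hp

/-- Valid for every `j`: reading beyond the array gives zeros, and no one lies there. Readers of the
bit vector thus need no boundary case. -/
theorem arrayBit_compact_high (hA : IsSortedList n m A) (hn : 4 ≤ n) (hm : n ≤ m) (j : ℕ) :
    arrayBit (cellWidth m) (compact m A) (n * lowWidth n m + j) =
      decide (∃ k < n, high m A k + k = j) := by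
  by_cases hp : n * lowWidth n m + j < n * cellWidth m
  · rw [arrayBit_compact hA hp, bit_high hA]
  · have h2 := lowWidth_add_le (k := 2) (n := n) (m := m) (by omega) hm
    rw [arrayBit_of_length_le (by omega) (by rw [length_compact hA]; omega)]
    symm
    rw [decide_eq_false_iff_not]
    rintro ⟨k, hk, rfl⟩
    exact hp (high_add_lt hA hn hm hk)

theorem compact_last_bits (hA : IsSortedList n m A) (hn : 4 ≤ n) (hm : n ≤ m) {j : ℕ}
    (hj : j < n * cellWidth m)
    (h : (n * cellWidth m : ℝ) - (n * Real.logb 2 n - 2 * n) ≤ j) :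
    arrayBit (cellWidth m) (compact m A) j = false := by
  have hn0 : (4 : ℝ) ≤ n := by exact_mod_cast hn
  have h0 := high_add_lt_real hA (by omega) hm (show 0 < n by omega)
  -- Already the one of element 0 precedes the final segment, so this segment contains no low-order
  -- bits.
  have hge : n * lowWidth n m ≤ j := by
    have : (n * lowWidth n m : ℝ) ≤ j := by
      have h1 : (0 : ℝ) ≤ high m A 0 := by positivity
      push_cast at h0
      linarith
    exact_mod_cast this
  obtain ⟨i, rfl⟩ := Nat.exists_eq_add_of_le hge
  rw [arrayBit_compact_high hA hn hm, decide_eq_false_iff_not]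
  rintro ⟨k, hk, rfl⟩
  have := high_add_lt_real hA (by omega) hm hk
  push_cast at h
  linarith

end Compact

end EliasFano

namespace WordRAM

/-! ### Threshold variables

A nondecreasing sequence `t 0 ≤ t 1 ≤ … ` of small numbers is represented by the numbers
`#{i | t i ≤ j}`, for `j = 0, 1, …`, which are held in the variables `50 + j`. -/

/-- The number of indices `i < k` with `t i ≤ j`. -/
def countLE (t : ℕ → ℕ) (k j : ℕ) : ℕ := ((Finset.range k).filter (t · ≤ j)).card

theorem countLE_zero (t : ℕ → ℕ) (j : ℕ) : countLE t 0 j = 0 := rfl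

theorem countLE_succ (t : ℕ → ℕ) (k j : ℕ) :
    countLE t (k + 1) j = countLE t k j + if t k ≤ j then 1 else 0 := by
  unfold countLE
  rw [Finset.range_add_one, Finset.filter_insert]
  split_ifs with h
  · rw [Finset.card_insert_of_notMem (by simp)]
  · rfl

theorem countLE_le (t : ℕ → ℕ) (k j : ℕ) : countLE t k j ≤ k :=
  (Finset.card_filter_le _ _).trans (Finset.card_range k).le

/-- By monotonicity the indices with `t ≤ j` form an initial segment, and its length tells whether
`i` belongs to it. -/
theorem countLE_le_iff {t : ℕ → ℕ} {n i : ℕ} (ht : ∀ i j, i ≤ j → j < n → t i ≤ t j) (hi : i < n)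
    (j : ℕ) : countLE t n j ≤ i ↔ j < t i := by
  constructor
  · intro h
    by_contra hj
    have h1 : Finset.range (i + 1) ⊆ (Finset.range n).filter (t · ≤ j) := by
      intro k hk
      rw [Finset.mem_range] at hk
      rw [Finset.mem_filter, Finset.mem_range]
      exact ⟨by omega, (ht k i (by omega) hi).trans (by omega)⟩
    have h2 := Finset.card_le_card h1
    rw [Finset.card_range] at h2
    unfold countLE at h
    omega
  · intro h
    have h1 : (Finset.range n).filter (t · ≤ j) ⊆ Finset.range i := by
      intro k hk
      rw [Finset.mem_filter, Finset.mem_range] at hk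
      rw [Finset.mem_range]
      by_contra hki
      have := ht i k (by omega) hk.1
      omega
    exact (Finset.card_le_card h1).trans (Finset.card_range i).le

/-- Record the number in variable `44` in the first `k` threshold variables. -/
def recordC : ℕ → Cmd
  | 0 => .skip
  | k + 1 => .seq (recordC k)
      (.seq (assign (50 + k) (.bin .add (.var (50 + k)) (.bin .eq (.var 44) (.lit 0))))
        (assign 44 (.bin .sub (.var 44) (.lit 1))))

/-- When threshold `j` is treated, variable 44 holds the truncated difference `t - j`, which is zero
exactly if `t ≤ j`. -/
theorem runs_recordC {w b t : ℕ} {s : State} {T : ℕ → ℕ} (hw1 : 1 < 2 ^ w) (ht : s.reg 44 = t)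
    (k : ℕ) (hT : ∀ j < k, s.reg (50 + j) = T j) (hTw : ∀ j < k, T j + 1 < 2 ^ w) :
    Runs w b (recordC k) s (10 * k + 1) fun s' =>
      s'.arr = s.arr ∧ s'.table = s.table ∧ s'.reg 44 = t - k ∧
      (∀ j < k, s'.reg (50 + j) = T j + if t ≤ j then 1 else 0) ∧
      ∀ r, r ≠ 44 → (∀ j < k, r ≠ 50 + j) → s'.reg r = s.reg r := by
  induction k with
  | zero => exact Runs.skip ⟨rfl, rfl, by simpa using ht, by omega, fun _ _ _ => rfl⟩
  | succ k ih =>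
    refine ((ih (fun j hj => hT j (by omega)) (fun j hj => hTw j (by omega))).seq (T' := 10)
      fun s' hw' ⟨h1, h2, h3, h4, h5⟩ => ?_).mono (by omega) fun _ _ h => h
    have h6 : s'.reg (50 + k) = T k := by
      rw [h5 _ (by omega) (fun j hj => by omega), hT k (by omega)]
    have hw0 := hTw k (by omega)
    have e1 : Ev w s' (.bin .add (.var (50 + k)) (.bin .eq (.var 44) (.lit 0)))
        (T k + if t - k = 0 then 1 else 0) :=
      Ev.add (Ev.var' h6) (Ev.eqOp hw1 (Ev.var' h3) (Ev.lit (by omega))) (by split_ifs <;> omega)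
    refine ((Runs.assign e1 (Q := fun s'' => s'' = s'.set (50 + k)
      (T k + if t - k = 0 then 1 else 0)) rfl le_rfl).seq (T' := 4) ?_).mono
      (by simp [Expr.cost]) fun _ _ h => h
    rintro s'' hw'' rfl
    have e2 : Ev w (s'.set (50 + k) (T k + if t - k = 0 then 1 else 0))
        (.bin .sub (.var 44) (.lit 1)) (t - k - 1) :=
      Ev.sub hw'' (Ev.var' (by rw [State.set_reg_of_ne _ _ (by omega), h3])) (Ev.lit hw1)
    refine Runs.assign e2 ⟨h1, h2, ?_, ?_, ?_⟩ (by simp [Expr.cost])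
    · rw [State.set_reg_self]; omega
    · intro j hj
      rw [State.set_reg_of_ne _ _ (by omega), State.set_reg]
      by_cases hjk : j = k
      · subst hjk
        rw [if_pos rfl]
        congr 1
        by_cases h : t ≤ j
        · rw [if_pos h, if_pos (by omega)]
        · rw [if_neg h, if_neg (by omega)]
      · rw [if_neg (by omega), h4 j (by omega)]
    · intro r hr1 hr2
      rw [State.set_reg_of_ne _ _ hr1, State.set_reg_of_ne _ _ (hr2 k (by omega)),
        h5 r hr1 fun j hj => hr2 j (by omega)]

/-- The value, limited to `k`, of the represented sequence at the loop counter. -/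
def topE : ℕ → Expr
  | 0 => .lit 0
  | k + 1 => .bin .add (topE k) (.cond (.bin .lt (.var 40) (.var (50 + k))) (.lit 0) (.lit 1))

/-- The number `t i` counts the `j` with `j < t i`, that is, the thresholds that do not exceed `i`;
with `k` thresholds the count is cut off at `k`. -/
theorem Ev.top {w i n : ℕ} {s : State} {t : ℕ → ℕ} (hw1 : 1 < 2 ^ w)
    (ht : ∀ i j, i ≤ j → j < n → t i ≤ t j) (hi : i < n) (hs : s.reg 40 = i) (k : ℕ)
    (hT : ∀ j < k, s.reg (50 + j) = countLE t n j) (hti : t i < 2 ^ w) :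
    Ev w s (topE k) (min (t i) k) := by
  induction k with
  | zero => exact (Ev.lit (by omega)).congr (by simp)
  | succ k ih =>
    have h := countLE_le_iff ht hi k
    have e1 : Ev w s (.bin .lt (.var 40) (.var (50 + k))) (if i < countLE t n k then 1 else 0) :=
      Ev.ltOp hw1 (Ev.var' hs) (Ev.var' (hT k (by omega)))
    have e2 : Ev w s (.cond (.bin .lt (.var 40) (.var (50 + k))) (.lit 0) (.lit 1))
        (if k < t i then 1 else 0) := by
      refine Ev.cond e1 (fun h1 => ?_) (fun h1 => ?_)
      · have : i < countLE t n k := by by_contra h2; exact h1 (if_neg h2)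
        rw [if_neg (by omega)]
        exact Ev.lit (by omega)
      · have : ¬ i < countLE t n k := fun h2 => by rw [if_pos h2] at h1; omega
        rw [if_pos (by omega)]
        exact Ev.lit hw1
    have h3 : min (t i) k + (if k < t i then 1 else 0) = min (t i) (k + 1) := by
      split_ifs <;> omega
    rw [← h3]
    exact Ev.add (ih fun j hj => hT j (by omega)) e2 (by omega)

theorem Ev.topE_eq {w i n k : ℕ} {s : State} {t : ℕ → ℕ} (hw1 : 1 < 2 ^ w)
    (ht : ∀ i j, i ≤ j → j < n → t i ≤ t j) (hi : i < n) (hs : s.reg 40 = i)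
    (hT : ∀ j < k, s.reg (50 + j) = countLE t n j) (hti : t i < 2 ^ w) (hk : t i ≤ k) :
    Ev w s (topE k) (t i) :=
  (Ev.top hw1 ht hi hs k hT hti).congr (min_eq_left hk)

/-- The number of threshold variables. -/
def numThresholds : ℕ := 127

/-- Represent the sequence of the array cells, shifted right by variable `7`, by thresholds. -/
def thresholdLoop : Cmd :=
  forLoop 40 0 (.seq (assign 44 (.bin .shr (.cell (.var 40)) (.var 7))) (recordC numThresholds))

theorem runs_thresholdLoop {w b n sh : ℕ} {s : State} (hw1 : 1 < 2 ^ w) (hn : s.reg 0 = n)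
    (hsh : s.reg 7 = sh) (h0 : ∀ j, s.reg (50 + j) = 0) :
    Runs w b thresholdLoop s (6 + n * (5 + (10 * numThresholds + 1) + 8)) fun s' =>
      s'.arr = s.arr ∧ s'.table = s.table ∧ (∀ r < 40, s'.reg r = s.reg r) ∧
      ∀ j < numThresholds,
        s'.reg (50 + j) = countLE (fun i => s.arr.getD i 0 >>> sh) n j := by
  refine Runs.of_wf fun hwf => ?_
  refine (runs_forLoop (by omega) hw1 (fun k s' =>
      s'.arr = s.arr ∧ s'.table = s.table ∧ (∀ r < 40, s'.reg r = s.reg r) ∧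
      ∀ j < numThresholds,
        s'.reg (50 + j) = countLE (fun i => s.arr.getD i 0 >>> sh) k j) hn ?_ ?_
      (T := 5 + (10 * numThresholds + 1))).mono le_rfl fun _ _ h => h.1
  · refine ⟨rfl, rfl, fun r hr => State.set_reg_of_ne _ _ (by omega), fun j _ => ?_⟩
    rw [State.set_reg_of_ne _ _ (by omega), h0, countLE_zero]
  · rintro k s' hk hw' ⟨h1, h2, h3, h4⟩ hi hc
    have e1 : Ev w s' (.bin .shr (.cell (.var 40)) (.var 7)) (s.arr.getD k 0 >>> sh) := by
      rw [← h1]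
      exact Ev.shr hw' (Ev.cell (Ev.var' hi)) (Ev.var' ((h3 7 (by omega)).trans hsh))
    refine (Runs.assign e1 (Q := fun s'' => s'' = s'.set 44 (s.arr.getD k 0 >>> sh)) rfl
      le_rfl).seq ?_
    rintro s'' hw'' rfl
    have hnw := hwf.reg 0
    refine (runs_recordC (t := s.arr.getD k 0 >>> sh)
      (T := fun j => countLE (fun i => s.arr.getD i 0 >>> sh) k j) hw1 (by simp) numThresholds ?_
      ?_).mono le_rfl ?_
    · intro j hj
      rw [State.set_reg_of_ne _ _ (by omega), h4 j hj]
    · intro j _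
      have := countLE_le (fun i => s.arr.getD i 0 >>> sh) k j
      omega
    · rintro s3 - ⟨g1, g2, g3, g4, g5⟩
      refine ⟨?_, ?_, g1.trans h1, g2.trans h2, ?_, ?_⟩
      · rw [g5 40 (by omega) (by omega), State.set_reg_of_ne _ _ (by omega), hi]
      · rw [g5 0 (by omega) (by omega), State.set_reg_of_ne _ _ (by omega), hc]
      · intro r hr
        rw [State.set_reg_of_ne _ _ (by omega), g5 r (by omega) (by omega),
          State.set_reg_of_ne _ _ (by omega), h3 r hr]
      · intro j hj
        rw [State.set_reg_of_ne _ _ (by omega), g4 j hj, countLE_succ]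

end WordRAM

/-! ### Reserved widths for short and for long lists -/

namespace EliasFano

/-- The number of high-order bits of each cell that are represented by thresholds. -/
def topWidth (n m : ℕ) : ℕ := if n < 64 then cellWidth m - lowWidth n m else 3

/-- The number of bits that are reserved for the bit vector of the high-order parts. -/
def vectorLength (n m : ℕ) : ℕ := if n < 64 then n * (cellWidth m - lowWidth n m) else 3 * n

section

variable {n m w : ℕ}

/-- Makes room for the literals of the encoder and the decoder, which are at most 6. -/
theorem WordFits.eight_le (h : WordFits n m w) (hn : 4 ≤ n) (hm : n ≤ m) : 8 ≤ 2 ^ w := by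
  have h1 : 2 ^ 2 < 2 ^ w := lt_of_le_of_lt (by omega) h.1
  have h2 := (Nat.pow_lt_pow_iff_right (by norm_num : 1 < 2)).mp h1
  exact (by norm_num : 8 = 2 ^ 3) ▸ Nat.pow_le_pow_right (by norm_num) h2

theorem lowWidth_add_two_le (hn : 4 ≤ n) (hm : n ≤ m) : lowWidth n m + 2 ≤ cellWidth m :=
  lowWidth_add_le (k := 2) (by omega) hm

theorem lowWidth_add_six_le (hn : ¬ n < 64) (hm : n ≤ m) : lowWidth n m + 6 ≤ cellWidth m :=
  lowWidth_add_le (k := 6) (by omega) hm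

theorem topWidth_add_le (hn : 4 ≤ n) (hm : n ≤ m) :
    lowWidth n m + topWidth n m ≤ cellWidth m := by
  have h2 := lowWidth_add_two_le hn hm
  unfold topWidth
  split_ifs with h
  · omega
  · have := lowWidth_add_six_le h hm
    omega

theorem vectorLength_add_le (hn : 4 ≤ n) (hm : n ≤ m) :
    n * lowWidth n m + vectorLength n m ≤ n * cellWidth m := by
  have h2 := lowWidth_add_two_le hn hm
  unfold vectorLength
  split_ifs with h
  · rw [← mul_add]
    exact Nat.mul_le_mul_left _ (by omega)
  · have := lowWidth_add_six_le h hm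
    rw [mul_comm 3, ← mul_add]
    exact Nat.mul_le_mul_left _ (by omega)

theorem div_lt_two_pow_iff (hn : 0 < n) (hm : n ≤ m) (j : ℕ) :
    m / n < 2 ^ j ↔ lowWidth n m < j := by
  unfold lowWidth
  rw [Nat.log_lt_iff_lt_pow (by norm_num) (Nat.div_pos hm hn).ne']

end

end EliasFano

/-! ### Computation of the parameters -/

namespace WordRAM

open EliasFano

/-- The values of the program variables that the encoder and the decoder use as parameters. -/
structure Params (n b l c U : ℕ) (s : State) : Prop where
  r0 : s.reg 0 = n
  r2 : s.reg 2 = b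
  r4 : s.reg 4 = l
  r5 : s.reg 5 = b - l
  r6 : s.reg 6 = c
  r7 : s.reg 7 = b - c
  r8 : s.reg 8 = n * l
  r9 : s.reg 9 = 0
  r10 : s.reg 10 = 1
  r11 : s.reg 11 = U
  r12 : s.reg 12 = b - l - c
  r13 : s.reg 13 = n * l + U
  r14 : s.reg 14 = b - 3
  r15 : s.reg 15 = 3

theorem Params.congr {n b l c U : ℕ} {s s' : State} (h : Params n b l c U s)
    (hs : ∀ r < 40, s'.reg r = s.reg r) : Params n b l c U s' := by
  constructor <;> rw [hs _ (by norm_num)]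
  exacts [h.r0, h.r2, h.r4, h.r5, h.r6, h.r7, h.r8, h.r9, h.r10, h.r11, h.r12, h.r13, h.r14, h.r15]

theorem Params.keep {n b l c U : ℕ} {s s' : State} (h : Params n b l c U s) (hs : Keep s s') :
    Params n b l c U s' := h.congr fun r hr => hs.reg r (by omega)

/-- Variable `5` becomes the number of high-order bits of a cell. -/
def highWidthLoop : Cmd :=
  loopWhile (.bin .eq (.bin .shr (.bin .div (.var 1) (.var 0)) (.bin .sub (.var 2) (.var 5)))
    (.lit 0)) (assign 5 (.bin .add (.var 5) (.lit 1)))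

/-- Computation of the parameters. -/
def prelude : Cmd :=
  .seq highWidthLoop <|
  .seq (assign 4 (.bin .sub (.var 2) (.var 5))) <|
  .seq (assign 8 (.bin .mul (.var 0) (.var 4))) <|
  .seq (assign 10 (.lit 1)) <|
  .seq (assign 15 (.lit 3)) <|
  .seq (assign 6 (.cond (.bin .shr (.var 0) (.lit 6)) (.lit 3) (.var 5))) <|
  .seq (assign 11 (.cond (.bin .shr (.var 0) (.lit 6)) (.bin .mul (.lit 3) (.var 0))
    (.bin .mul (.var 0) (.var 5)))) <|
  .seq (assign 7 (.bin .sub (.var 2) (.var 6))) <|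
  .seq (assign 12 (.bin .sub (.var 5) (.var 6))) <|
  .seq (assign 13 (.bin .add (.var 8) (.var 11))) <|
  (assign 14 (.bin .sub (.var 2) (.lit 3)))

variable {n m w : ℕ}

/-- No logarithm is available, so widths are tested one by one with shifts of `m / n`. The search
starts at the top: it takes `b - l` rounds, which is `O(lg n)`, whereas `l` is not bounded in terms
of `n`. -/
theorem runs_highWidthLoop {s : State} (hn : 4 ≤ n) (hm : n ≤ m) (hw : WordFits n m w)
    (h0 : s.reg 0 = n) (h1 : s.reg 1 = m) (h2 : s.reg 2 = cellWidth m) (h5 : s.reg 5 = 0) :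
    Runs w (cellWidth m) highWidthLoop s (10 + (cellWidth m - lowWidth n m) * 14) fun s' =>
      s' = s.set 5 (cellWidth m - lowWidth n m) := by
  have h8 := hw.eight_le hn hm
  refine (runs_while (T := 4) (fun k s' => s' = s.set 5 k) (cellWidth m - lowWidth n m) ?_ ?_
    ?_).mono (by simp [Expr.cost]) fun _ _ h => h
  · unfold State.set
    rw [← h5, Function.update_eq_self]
  · rintro k s' hk hwf rfl
    have hr : ∀ r, r ≠ 5 → (s.set 5 k).reg r = s.reg r := fun r hr => State.set_reg_of_ne _ _ hr
    have e := Ev.eqOp (by omega) (Ev.shr hwf (Ev.div hwf (Ev.var' ((hr 1 (by omega)).trans h1))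
      (Ev.var' ((hr 0 (by omega)).trans h0))) (Ev.sub hwf (Ev.var' ((hr 2 (by omega)).trans h2))
      (Ev.var' (s.set_reg_self 5 k)))) (Ev.lit (w := w) (x := 0) (by omega))
    refine ⟨e.fits, ?_⟩
    rw [e.eq]
    have h3 : (m / n) >>> (cellWidth m - k) = 0 ↔ lowWidth n m < cellWidth m - k := by
      rw [Nat.shiftRight_eq_div_pow, Nat.div_eq_zero_iff_lt (by positivity),
        div_lt_two_pow_iff (by omega) hm]
    by_cases h4 : lowWidth n m < cellWidth m - k
    · rw [if_pos (h3.mpr h4)]; omega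
    · rw [if_neg (mt h3.mp h4)]; omega
  · rintro k s' hk hwf rfl
    have := hwf.le
    have hb : cellWidth m < 2 ^ cellWidth m := Nat.lt_two_pow_self
    have hb' : 2 ^ cellWidth m ≤ 2 ^ w := Nat.pow_le_pow_right (by norm_num) this
    refine Runs.assign (Ev.add (Ev.var' (s.set_reg_self 5 k)) (Ev.lit (x := 1) (by omega))
      (by omega)) ?_ (by simp [Expr.cost])
    unfold State.set
    simp

theorem runs_prelude {s : State} (hn : 4 ≤ n) (hm : n ≤ m) (hw : WordFits n m w)
    (h0 : s.reg 0 = n) (h1 : s.reg 1 = m) (h2 : s.reg 2 = cellWidth m)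
    (h5 : s.reg 5 = 0) (h9 : s.reg 9 = 0) :
    Runs w (cellWidth m) prelude s (10 + (cellWidth m - lowWidth n m) * 14 + 100) fun s' =>
      Params n (cellWidth m) (lowWidth n m) (topWidth n m) (vectorLength n m) s' ∧
        s'.arr = s.arr ∧ s'.table = s.table ∧ ∀ r, 40 ≤ r → s'.reg r = s.reg r := by
  have h8 := hw.eight_le hn hm
  have hl := lowWidth_add_two_le hn hm
  have hnl : n * lowWidth n m ≤ n * cellWidth m := Nat.mul_le_mul_left _ (by omega)
  have hU := vectorLength_add_le hn hm
  have hw2 := hw.2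
  set b := cellWidth m with hb
  set l := lowWidth n m with hl'
  have hsh : n >>> 6 ≠ 0 ↔ ¬ n < 64 := by
    rw [Nat.shiftRight_eq_div_pow]; omega
  have step : ∀ {p : Cmd} {s : State} {r x c : ℕ} {e : Expr} {T : ℕ} {Q : State → Prop},
      (WF w b s → Ev w s e x) → e.cost + 1 = c → (WF w b (s.set r x) → Runs w b p (s.set r x) T Q) →
      Runs w b (.seq (assign r e) p) s (c + T) Q := by
    intro p s r x c e T Q he hc hp
    refine Runs.of_wf fun hwf => ?_
    refine ((Runs.assign (he hwf) (Q := fun s' => s' = s.set r x) rfl le_rfl).seq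
      (T' := T) ?_).mono (by omega) fun _ _ h => h
    rintro s' hwf' rfl
    exact hp hwf'
  refine ((runs_highWidthLoop hn hm hw h0 h1 h2 h5).seq (T' := 100) ?_).mono le_rfl fun _ _ h => h
  rintro s' - rfl
  rw [← hb, ← hl']
  -- The summands are the running times of the ten assignments after the loop.
  refine Runs.mono (T := 4 + (4 + (2 + (2 + (7 + (11 + (4 + (4 + (4 + 4))))))))) ?_ (by norm_num)
    fun _ _ h => h
  · refine step (x := l) (fun hwf => (Ev.sub hwf (Ev.var _ _ _) (Ev.var _ _ _)).congr ?_) rfl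
      fun _ => ?_
    · simp [State.set_reg, h2]; omega
    refine step (x := n * l) (fun hwf => (Ev.mul (Ev.var' (x := n) ?_) (Ev.var' (x := l) ?_) ?_))
      rfl fun _ => ?_
    · simp [State.set_reg, h0]
    · simp
    · omega
    refine step (x := 1) (fun hwf => Ev.lit (by omega)) rfl fun _ => ?_
    refine step (x := 3) (fun hwf => Ev.lit (by omega)) rfl fun _ => ?_
    refine step (x := topWidth n m) (fun hwf => Ev.cond (z := n >>> 6)
      (Ev.shr hwf (Ev.var' (x := n) ?_) (Ev.lit (x := 6) (by omega))) (fun hz => ?_) fun hz => ?_)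
      rfl fun _ => ?_
    · simp [State.set_reg, h0]
    · rw [topWidth, if_neg (hsh.mp hz)]
      exact Ev.lit (by omega)
    · rw [topWidth, if_pos (by by_contra h; exact hsh.mpr h hz)]
      exact Ev.var' (by simp [State.set_reg, hb, hl'])
    refine step (x := vectorLength n m) (fun hwf => Ev.cond (z := n >>> 6)
      (Ev.shr hwf (Ev.var' (x := n) ?_) (Ev.lit (x := 6) (by omega))) (fun hz => ?_) fun hz => ?_)
      rfl fun _ => ?_
    · simp [State.set_reg, h0]
    · have h3 : vectorLength n m = 3 * n := by rw [vectorLength, if_neg (hsh.mp hz)]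
      rw [h3]
      exact Ev.mul (Ev.lit (by omega)) (Ev.var' (by simp [State.set_reg, h0])) (by omega)
    · have h3 : vectorLength n m = n * (b - l) := by
        rw [vectorLength, if_pos (by by_contra h; exact hsh.mpr h hz)]
      rw [h3]
      exact Ev.mul (Ev.var' (by simp [State.set_reg, h0])) (Ev.var' (by simp [State.set_reg]))
        (by omega)
    refine step (x := b - topWidth n m) (fun hwf => Ev.sub hwf (Ev.var' ?_) (Ev.var' ?_)) rfl
      fun _ => ?_
    · simp [State.set_reg, h2]
    · simp [State.set_reg]
    refine step (x := b - l - topWidth n m) (fun hwf => Ev.sub hwf (Ev.var' ?_) (Ev.var' ?_)) rfl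
      fun _ => ?_
    · simp [State.set_reg]
    · simp [State.set_reg]
    refine step (x := n * l + vectorLength n m)
      (fun hwf => Ev.add (Ev.var' ?_) (Ev.var' ?_) (by omega)) rfl fun _ => ?_
    · simp [State.set_reg]
    · simp [State.set_reg]
    refine Runs.of_wf fun hwf => ?_
    refine Runs.assign (x := b - 3) (Ev.sub hwf (Ev.var' ?_) (Ev.lit (by omega))) ?_ le_rfl
    · simp [State.set_reg, h2]
    · refine ⟨?_, rfl, rfl, fun r hr => ?_⟩
      · constructor <;> simp [State.set_reg, h0, h2, h9]
      · rw [State.set_reg_of_ne _ _ (by omega), State.set_reg_of_ne _ _ (by omega),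
          State.set_reg_of_ne _ _ (by omega), State.set_reg_of_ne _ _ (by omega),
          State.set_reg_of_ne _ _ (by omega), State.set_reg_of_ne _ _ (by omega),
          State.set_reg_of_ne _ _ (by omega), State.set_reg_of_ne _ _ (by omega),
          State.set_reg_of_ne _ _ (by omega), State.set_reg_of_ne _ _ (by omega),
          State.set_reg_of_ne _ _ (by omega)]

end WordRAM

namespace WordRAM

open EliasFano

/-! ### Views -/

theorem viewPos_real (b v : ℕ) : viewPos b b 0 v = v := by
  unfold viewPos
  rw [add_zero, mul_comm, Nat.div_add_mod]

theorem viewPos_right {b W : ℕ} (hW : W ≤ b) (v : ℕ) :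
    viewPos b W (b - W) v = v + (v / W + 1) * (b - W) := by
  obtain ⟨d, rfl⟩ := Nat.exists_eq_add_of_le hW
  unfold viewPos
  have h := Nat.div_add_mod v W
  rw [Nat.add_sub_cancel_left, mul_add, add_mul, mul_comm (v / W) W]
  omega

/-- Among the views of trailing bits, the wider one places bit `v` earlier: fewer cells are begun,
and fewer bits are skipped in each. So packing the low-order bits into a wider trailing view is a
move towards the front. -/
theorem viewPos_right_anti {b W W' : ℕ} (h0 : 0 < W') (h : W' ≤ W) (hW : W ≤ b) (v : ℕ) :
    viewPos b W (b - W) v ≤ viewPos b W' (b - W') v := by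
  rw [viewPos_right hW, viewPos_right (h.trans hW)]
  have h1 : v / W ≤ v / W' := Nat.div_le_div_left h h0
  exact Nat.add_le_add_left (Nat.mul_le_mul (by omega) (by omega)) _

theorem arrayBit_lowView {b l v : ℕ} (Z : List ℕ) (hl : l ≤ b) (h0 : 0 < l) :
    arrayBit b Z (viewPos b l (b - l) v) = (Z.getD (v / l) 0).testBit (l - 1 - v % l) := by
  have := Nat.mod_lt v h0
  unfold viewPos
  rw [add_assoc, arrayBit_cell _ (by omega)]
  congr 1
  omega

theorem getField_congr {b : ℕ} {Y Z : List ℕ} {p k : ℕ} (h : p % b + k ≤ b)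
    (hYZ : ∀ j < k, arrayBit b Y (p + j) = arrayBit b Z (p + j)) :
    getField b Y p k = getField b Z p k := by
  apply Nat.eq_of_testBit_eq
  intro j
  by_cases hj : j < k
  · have h1 : j = k - 1 - (k - 1 - j) := by omega
    rw [h1, testBit_getField Y h (by omega), testBit_getField Z h (by omega), hYZ _ (by omega)]
  · have hp : 2 ^ k ≤ 2 ^ j := Nat.pow_le_pow_right (by norm_num) (by omega)
    rw [Nat.testBit_lt_two_pow ((getField_lt ..).trans_le hp),
      Nat.testBit_lt_two_pow ((getField_lt ..).trans_le hp)]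

/-- Overwrite items of `len` bits each by zeros. -/
def fillLoop (c len W off base : ℕ) : Cmd := putLoop c len W off base (.lit 0)

theorem runs_fillLoop {w b N len W off base : ℕ} {s : State} {c rl rW ro rB : ℕ}
    (hr : c < 40 ∧ rl < 40 ∧ rW < 40 ∧ ro < 40 ∧ rB < 40)
    (hb : s.reg 2 = b) (hN : s.reg c = N) (hl : s.reg rl = len)
    (hW : s.reg rW = W) (ho : s.reg ro = off) (hB : s.reg rB = base)
    (hw1 : 1 < 2 ^ w) (hnb : s.arr.length * b < 2 ^ w) (hWb : off + W ≤ b) (hlen : len ≤ W)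
    (hz : len = 0 → viewPos b W off base < 2 ^ w ∧ (W = 0 → base = 0))
    (hD : ∀ u < N * len, (base + u) / W < s.arr.length) :
    Runs w b (fillLoop c rl rW ro rB) s (6 + N * 1100)
      (fun s' => Keep s s' ∧
        (∀ u < N * len, arrayBit b s'.arr (viewPos b W off (base + u)) = false) ∧
        ∀ p, (∀ u < N * len, p ≠ viewPos b W off (base + u)) →
          arrayBit b s'.arr p = arrayBit b s.arr p) := by
  refine (runs_putLoop hr hb hN hl hW ho hB hw1 hnb hWb hlen hz hD (fun _ => 0)
    (fun _ _ => by positivity) fun _ _ _ _ _ _ => Ev.lit (by omega)).mono ?_ ?_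
  · exact Nat.add_le_add_left (Nat.mul_le_mul_left _ (by norm_num [Expr.cost])) _
  · rintro s' - ⟨hK, h1, h2⟩
    refine ⟨hK, fun u hu => ?_, h2⟩
    have h0 : 0 < len := by
      rcases Nat.eq_zero_or_pos len with h | h
      · simp [h] at hu
      · exact h
    have h3 := h1 (u / len) (Nat.div_lt_of_lt_mul (by rwa [mul_comm])) (u % len)
      (Nat.mod_lt _ h0)
    rw [mul_comm, Nat.div_add_mod] at h3
    rw [h3, Nat.zero_testBit]

/-! ### The encoder -/

/-- The thresholds represent the `topWidth n m` most significant bits of the elements of `A`. -/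
def Thresholds (n m : ℕ) (A : List ℕ) (s : State) : Prop :=
  ∀ j < numThresholds,
    s.reg (50 + j) = countLE (fun i => A.getD i 0 >>> (cellWidth m - topWidth n m)) n j

theorem Thresholds.keep {n m : ℕ} {A : List ℕ} {s s' : State} (h : Thresholds n m A s)
    (hs : Keep s s') : Thresholds n m A s' :=
  fun j hj => (hs.reg _ (by omega)).trans (h j hj)

section

variable {n m w : ℕ} {A : List ℕ} {s : State}

theorem clog_le_self (n : ℕ) : Nat.clog 2 n ≤ n :=
  Nat.clog_le_of_le_pow Nat.lt_two_pow_self.le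

theorem clog_le_six (hn : n < 64) : Nat.clog 2 n ≤ 6 :=
  Nat.clog_le_of_le_pow (by norm_num; omega)

theorem vectorLength_le (hn : 4 ≤ n) : vectorLength n m ≤ 8 * n := by
  unfold vectorLength
  split_ifs with h
  · have h1 := cellWidth_le (m := m) (show 0 < n by omega)
    have h2 := clog_le_six h
    rw [mul_comm]
    exact Nat.mul_le_mul_right _ (by omega)
  · omega

/-- For short lists the vector has the whole remainder of the array at its disposal; for long ones
`high < 2 n` and `i < n` give `3 n`. -/
theorem high_add_lt_vectorLength (hA : IsSortedList n m A) (hn : 4 ≤ n) (hm : n ≤ m) {i : ℕ}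
    (hi : i < n) : high m A i + i < vectorLength n m := by
  unfold vectorLength
  split_ifs with h
  · have h1 := high_add_lt hA hn hm hi
    rw [Nat.mul_sub]
    omega
  · have := high_lt hA hi
    omega

theorem sorted_cell_lt (hA : IsSortedList n m A) {i : ℕ} (hi : i < n) :
    A.getD i 0 < 2 ^ cellWidth m := (hA.getD_lt hi).trans_le (le_two_pow_cellWidth m)

/-- For `n < 64` the represented numbers are the high-order parts, below `2 n ≤ 126`; otherwise they
have three bits. So 127 thresholds suffice in both cases. -/
theorem top_le (hA : IsSortedList n m A) (hn : 4 ≤ n) (hm : n ≤ m) {i : ℕ} (hi : i < n) :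
    A.getD i 0 >>> (cellWidth m - topWidth n m) ≤ numThresholds := by
  have h2 := lowWidth_add_two_le hn hm
  unfold topWidth numThresholds
  split_ifs with h
  · have h1 := high_lt hA hi
    rw [high, hA.1] at h1
    rw [show cellWidth m - (cellWidth m - lowWidth n m) = lowWidth n m by omega,
      Nat.shiftRight_eq_div_pow]
    omega
  · have h3 := lowWidth_add_six_le h hm
    rw [Nat.shiftRight_eq_div_pow]
    have : A.getD i 0 / 2 ^ (cellWidth m - 3) < 2 ^ 3 := by
      apply Nat.div_lt_of_lt_mul
      rw [← pow_add, show cellWidth m - 3 + 3 = cellWidth m by omega]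
      exact sorted_cell_lt hA hi
    omega

theorem top_mono (hA : IsSortedList n m A) (sh : ℕ) (i j : ℕ) (hij : i ≤ j) (hj : j < n) :
    A.getD i 0 >>> sh ≤ A.getD j 0 >>> sh := by
  rw [Nat.shiftRight_eq_div_pow, Nat.shiftRight_eq_div_pow]
  exact Nat.div_le_div_right (hA.mono hij hj)

theorem Ev.thresholds (hA : IsSortedList n m A) (hn : 4 ≤ n) (hm : n ≤ m) (hw : WordFits n m w)
    (hs : Thresholds n m A s) {i : ℕ} (hi : i < n) (h40 : s.reg 40 = i) :
    Ev w s (topE numThresholds) (A.getD i 0 >>> (cellWidth m - topWidth n m)) := by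
  have h8 := hw.eight_le hn hm
  refine Ev.topE_eq (t := fun i => A.getD i 0 >>> (cellWidth m - topWidth n m)) (by omega)
    (top_mono hA _) hi h40 hs ?_ (top_le hA hn hm hi)
  exact (Nat.shiftRight_le _ _).trans_lt ((hA.getD_lt hi).trans hw.1)

/-- Move the low-order bits to the front, and build the bit vector after them. -/
def encodeSmall : Cmd :=
  .seq (copyLoop 0 4 4 5 9 2 9 9 upE) <|
  .seq (fillLoop 0 5 2 9 8) (scatterLoop 0 10 2 9 8 (topE numThresholds))

/-- The thresholds hold the high-order parts completely, so only the low-order bits of the cells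
still matter. Their move to the front is safe in ascending order because `v ≤ viewPos b l (b - l)
v`; everything after them is then free for the vector. -/
theorem runs_encodeSmall (hA : IsSortedList n m A) (hn : 4 ≤ n) (hm : n ≤ m)
    (hw : WordFits n m w) (hsm : n < 64)
    (hp : Params n (cellWidth m) (lowWidth n m) (topWidth n m) (vectorLength n m) s)
    (ht : Thresholds n m A s) (harr : s.arr = A) :
    Runs w (cellWidth m) encodeSmall s
      ((6 + n * (100 * (upE.cost + 100))) + ((6 + n * 1100) +
        (6 + n * (4 + (topE numThresholds).cost + 1 + 1010))))
      fun s' => s'.arr.length = n ∧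
        ∀ p < n * cellWidth m, arrayBit (cellWidth m) s'.arr p = bit m A p := by
  have h8 := hw.eight_le hn hm
  have hl := lowWidth_add_two_le hn hm
  have hU : vectorLength n m = n * (cellWidth m - lowWidth n m) := if_pos hsm
  have hc : topWidth n m = cellWidth m - lowWidth n m := if_pos hsm
  have hlen : s.arr.length = n := by rw [harr, hA.1]
  have hw2 : n * cellWidth m < 2 ^ w := hw.2
  have hbw := Nat.lt_two_pow_self (n := cellWidth m)
  have hbw' : 2 ^ cellWidth m ≤ 2 ^ w :=
    Nat.pow_le_pow_right (by norm_num) (cellWidth_le_of_fits hw.1)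
  have hnl : n * lowWidth n m ≤ n * cellWidth m := Nat.mul_le_mul_left _ (by omega)
  have hnq : n * lowWidth n m + n * (cellWidth m - lowWidth n m) = n * cellWidth m := by
    rw [← mul_add]; congr 1; omega
  have hbit := fun p => bit_low (p := p) hA
  have hbh := bit_high hA
  have hH := fun i => high_add_lt_vectorLength (i := i) hA hn hm
  have hhigh : ∀ i, high m A i = A.getD i 0 >>> lowWidth n m := fun i => by
    rw [high, hA.1, Nat.shiftRight_eq_div_pow]
  have hev := fun s' i hi (hs' : Keep s s') h40 =>
    Ev.thresholds (s := s') (i := i) hA hn hm hw (ht.keep hs') hi h40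
  rw [hc, show cellWidth m - (cellWidth m - lowWidth n m) = lowWidth n m by omega] at hev
  rw [hU] at hH hp
  rw [hc] at hp
  set b := cellWidth m with hb
  set l := lowWidth n m with hl'
  have hb0 : 0 < b := by omega
  have hreal := viewPos_real b
  refine (runs_copyUp (b := b) (by omega) hp.r2 hp.r0 hp.r4 hp.r4 hp.r5 hp.r9 hp.r2 hp.r9 hp.r9
    (by omega) (by rwa [hlen]) (by omega) (by omega) le_rfl (by omega) ?_ ?_ ?_ ?_).seq ?_
  · intro h0
    refine ⟨?_, ?_, fun _ => rfl, fun _ => rfl⟩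
    · simp [viewPos]; omega
    · rw [hreal]; omega
  · intro u hu
    rw [zero_add, hlen]
    exact Nat.div_lt_of_lt_mul (by rwa [mul_comm])
  · intro u hu
    rw [zero_add, hlen]
    exact Nat.div_lt_of_lt_mul (by rw [mul_comm]; omega)
  · intro u v huv hv
    rw [zero_add, zero_add, hreal]
    have := le_viewPos (b := b) (W := l) (off := b - l) (v := v) (by omega)
    omega
  rintro s1 hwf1 ⟨hK1, h1a, h1b⟩
  have hp1 := hp.keep hK1
  have hlen1 := hK1.length.trans hlen
  refine (runs_fillLoop (b := b) (by omega) hp1.r2 hp1.r0 hp1.r5 hp1.r2 hp1.r9 hp1.r8 (by omega)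
    (by rwa [hlen1]) (by omega) (by omega) (by omega) ?_).seq ?_
  · intro u hu
    rw [hlen1]
    exact Nat.div_lt_of_lt_mul (by rw [mul_comm b n]; omega)
  rintro s2 hwf2 ⟨hK2, h2a, h2b⟩
  have hp2 := hp1.keep hK2
  have hlen2 := hK2.length.trans hlen1
  refine (runs_scatterLoop (b := b) (U := n * (b - l)) (by omega) hp2.r2 hp2.r0 hp2.r10 hp2.r2
    hp2.r9 hp2.r8 (by omega) (by rwa [hlen2]) (by omega) (by omega) ?_ (high m A) hH h2a ?_).mono
    le_rfl ?_
  · intro u hu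
    rw [hlen2]
    exact Nat.div_lt_of_lt_mul (by rw [mul_comm b n]; omega)
  · intro s' k hk hwf' hK' h40 _
    rw [hhigh]
    exact hev s' k hk ((hK1.trans hK2).trans hK') h40
  · rintro s3 - ⟨hK3, h3a, h3b⟩
    refine ⟨hK3.length.trans hlen2, fun p hpb => ?_⟩
    by_cases hpl : p < n * l
    · rw [h3b, h2b]
      · have := h1a p hpl
        rw [zero_add, hreal, harr] at this
        rw [this, hbit p hpl, arrayBit_lowView _ (by omega)]
        by_contra h
        have : l = 0 := by omega
        rw [this] at hpl
        omega
      · intro u hu; rw [hreal]; omega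
      · intro u hu; rw [hreal]; omega
    · obtain ⟨u, rfl⟩ := Nat.exists_eq_add_of_le (not_lt.mp hpl)
      have := h3a u (by omega)
      rw [hreal] at this
      rw [this, hbh]

end

end WordRAM

/-! ### The encoder for long lists -/

namespace WordRAM

open EliasFano

/-- The high-order part of the element at the loop counter, for an array whose cells have lost the
bits that the thresholds represent. -/
def highE : Expr :=
  .bin .add (.bin .shl (topE numThresholds) (.var 12))
    (fieldE (.var 2) (.bin .add (.bin .mul (.var 40) (.var 2)) (.var 6)) (.var 12))

section

variable {n m w : ℕ} {A : List ℕ} {s : State}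

theorem cell_add_mod {b i c : ℕ} (h : c < b) : (i * b + c) % b = c := by
  rw [mul_comm, Nat.mul_add_mod, Nat.mod_eq_of_lt h]

theorem cell_add_div {b i c : ℕ} (h : c < b) : (i * b + c) / b = i := by
  rw [mul_comm, Nat.mul_add_div (by omega), Nat.div_eq_of_lt h, add_zero]

theorem top_add_field {b l c x : ℕ} (h : l + c ≤ b) :
    (x >>> (b - c)) <<< (b - l - c) + (x >>> l) % 2 ^ (b - l - c) = x >>> l := by
  rw [show b - c = l + (b - l - c) by omega, Nat.shiftRight_add, Nat.shiftLeft_eq,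
    Nat.shiftRight_eq_div_pow (x >>> l), mul_comm]
  exact Nat.div_add_mod _ _

/-- The thresholds give the leading bits of the high-order part and the cell gives the middle ones.
The leading bits of the cells are not read, so they may already contain the bit vector. -/
theorem Ev.highPart (hA : IsSortedList n m A) (hn : 4 ≤ n) (hm : n ≤ m) (hw : WordFits n m w)
    (hwf : WF w (cellWidth m) s)
    (hp : Params n (cellWidth m) (lowWidth n m) (topWidth n m) (vectorLength n m) s)
    (ht : Thresholds n m A s) {i : ℕ} (hi : i < n) (h40 : s.reg 40 = i)
    (hc : topWidth n m < cellWidth m)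
    (harr : ∀ j < cellWidth m - lowWidth n m - topWidth n m,
      arrayBit (cellWidth m) s.arr (i * cellWidth m + topWidth n m + j) =
        arrayBit (cellWidth m) A (i * cellWidth m + topWidth n m + j)) :
    Ev w s highE (high m A i) := by
  have hl := topWidth_add_le hn hm
  have e1 := Ev.thresholds hA hn hm hw ht hi h40
  have hw2 : n * cellWidth m < 2 ^ w := hw.2
  have hhigh : high m A i = A.getD i 0 >>> lowWidth n m := by
    rw [high, hA.1, Nat.shiftRight_eq_div_pow]
  set b := cellWidth m with hb
  set l := lowWidth n m with hl'
  set c := topWidth n m with hc'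
  have hib : (i + 1) * b ≤ n * b := Nat.mul_le_mul_right _ hi
  rw [add_mul] at hib
  have e2 := Ev.field hwf (Ev.var' hp.r2) (Ev.add (Ev.mul (Ev.var' h40) (Ev.var' hp.r2)
    (by omega)) (Ev.var' hp.r6) (by omega)) (Ev.var' hp.r12)
  rw [getField_congr (by rw [cell_add_mod hc]; omega) harr] at e2
  have h1 : getField b A (i * b + c) (b - l - c) = A.getD i 0 >>> l % 2 ^ (b - l - c) := by
    unfold getField
    rw [cell_add_mod hc, cell_add_div hc]
    congr 2
    omega
  rw [h1] at e2
  have h2 := top_add_field (x := A.getD i 0) hl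
  have h3 : A.getD i 0 >>> l < 2 ^ w :=
    (Nat.shiftRight_le _ _).trans_lt ((hA.getD_lt hi).trans hw.1)
  rw [hhigh, ← h2]
  exact Ev.add (Ev.shl e1 (Ev.var' hp.r12) (by omega)) e2 (by omega)

/-- Collect the bit vector in the leading bits of the cells, pack the low-order bits and the bit
vector in the other bits of the cells, and finally move both to the front. -/
def encodeLarge : Cmd :=
  .seq (fillLoop 0 6 6 9 9) <|
  .seq (scatterLoop 0 10 6 9 9 highE) <|
  .seq (copyLoop 0 4 4 5 9 14 15 9 upE) <|
  .seq (copyLoop 11 10 6 9 9 14 15 8 upE) <|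
  .seq (copyLoop 0 4 14 15 9 2 9 9 upE) <|
  .seq (copyLoop 11 10 14 15 8 2 9 8 upE) <|
  (fillLoop 0 12 2 9 13)

/-- The middle bits are needed until the last one of the vector is set, hence the vector is first
built in the leading three bits. Afterwards `n * l + 3 * n ≤ n * (b - 3)` lets low-order bits and
vector be packed into the trailing bits, which are disjoint from the leading ones. The final moves
to the front handle the low-order bits before the vector, so that each destination precedes all
sources that are still to be read. -/
theorem runs_encodeLarge (hA : IsSortedList n m A) (hn : 4 ≤ n) (hm : n ≤ m)
    (hw : WordFits n m w) (hbig : ¬ n < 64)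
    (hp : Params n (cellWidth m) (lowWidth n m) (topWidth n m) (vectorLength n m) s)
    (ht : Thresholds n m A s) (harr : s.arr = A) :
    Runs w (cellWidth m) encodeLarge s
      ((6 + n * 1100) + ((6 + n * (4 + highE.cost + 1 + 1010)) +
        ((6 + n * (100 * (upE.cost + 100))) + ((6 + 3 * n * (100 * (upE.cost + 100))) +
          ((6 + n * (100 * (upE.cost + 100))) + ((6 + 3 * n * (100 * (upE.cost + 100))) +
            (6 + n * 1100)))))))
      fun s' => s'.arr.length = n ∧
        ∀ p < n * cellWidth m, arrayBit (cellWidth m) s'.arr p = bit m A p := by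
  have h8 := hw.eight_le hn hm
  have hl := lowWidth_add_six_le hbig hm
  have hU : vectorLength n m = 3 * n := if_neg hbig
  have hc : topWidth n m = 3 := if_neg hbig
  have hlen : s.arr.length = n := by rw [harr, hA.1]
  have hw2 : n * cellWidth m < 2 ^ w := hw.2
  have hbw := Nat.lt_two_pow_self (n := cellWidth m)
  have hbw' : 2 ^ cellWidth m ≤ 2 ^ w :=
    Nat.pow_le_pow_right (by norm_num) (cellWidth_le_of_fits hw.1)
  have hnv : n * lowWidth n m + 3 * n ≤ n * (cellWidth m - 3) := by
    rw [mul_comm 3, ← mul_add]; exact Nat.mul_le_mul_left _ (by omega)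
  have hnb : n * (cellWidth m - 3) ≤ n * cellWidth m := Nat.mul_le_mul_left _ (by omega)
  have hnz : n * lowWidth n m + 3 * n + n * (cellWidth m - lowWidth n m - 3) =
      n * cellWidth m := by
    rw [mul_comm 3, ← mul_add, ← mul_add]; congr 1; omega
  have hbit := fun p => bit_low (p := p) hA
  have hbh := bit_high hA
  have hH := fun i => high_add_lt_vectorLength (i := i) hA hn hm
  have hev := fun s' i hi hwf hp (hs' : Keep s s') h40 =>
    Ev.highPart (s := s') (i := i) hA hn hm hw hwf hp (ht.keep hs') hi h40 (by omega)
  rw [hU] at hH hp hev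
  rw [hc] at hp hev
  set b := cellWidth m with hb
  set l := lowWidth n m with hl'
  have hb0 : 0 < b := by omega
  have hreal := viewPos_real b
  have hR : ∀ v, v ≤ viewPos b (b - 3) 3 v := fun v => le_viewPos (by omega)
  have hRR : ∀ u v, u < v → viewPos b (b - 3) 3 u < viewPos b (b - 3) 3 v := fun u v h =>
    viewPos_lt_viewPos (by omega) (by omega) h
  have hRm : ∀ v, viewPos b (b - 3) 3 v % b = 3 + v % (b - 3) := fun v =>
    viewPos_mod (by omega) (by omega)
  have hTm : ∀ v, viewPos b 3 0 v % b < 3 := fun v => by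
    have := viewPos_mod (b := b) (W := 3) (off := 0) (v := v) (by omega) (by omega)
    have := Nat.mod_lt v (show 0 < 3 by omega)
    omega
  have hLm : ∀ v, 0 < l → viewPos b l (b - l) v % b = (b - l) + v % l := fun v h =>
    viewPos_mod (by omega) h
  have hRT : ∀ u v, viewPos b (b - 3) 3 u ≠ viewPos b 3 0 v := fun u v h => by
    have h1 := hRm u
    have h2 := hTm v
    rw [h] at h1
    omega
  have hRL : ∀ v, 0 < l → viewPos b (b - 3) 3 v ≤ viewPos b l (b - l) v := fun v h => by
    have := viewPos_right_anti (b := b) (W := b - 3) (W' := l) h (by omega) (by omega) v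
    rwa [show b - (b - 3) = 3 by omega] at this
  have hl0 : ∀ u, u < n * l → 0 < l := fun u hu => by
    by_contra h
    rw [show l = 0 by omega] at hu
    omega
  have hdivV : ∀ u, u < n * l + 3 * n → u / (b - 3) < n := fun u hu =>
    Nat.div_lt_of_lt_mul (by rw [mul_comm (b - 3) n]; omega)
  have hdivb : ∀ u, u < n * b → u / b < n := fun u hu =>
    Nat.div_lt_of_lt_mul (by rwa [mul_comm b n])
  have hdiv3 : ∀ u, u < 3 * n → u / 3 < n := fun u hu => Nat.div_lt_of_lt_mul hu
  have hz1 : viewPos b (b - 3) 3 0 < 2 ^ w := by simp [viewPos]; omega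
  have hz2 : viewPos b l (b - l) 0 < 2 ^ w := by simp [viewPos]; omega
  refine (runs_fillLoop (b := b) (by omega) hp.r2 hp.r0 hp.r6 hp.r6 hp.r9 hp.r9 (by omega)
    (by rwa [hlen]) (by omega) (by omega) (by omega) ?_).seq ?_
  · intro u hu
    rw [zero_add, hlen]
    exact hdiv3 u (by omega)
  rintro s1 hwf1 ⟨hK1, h1a, h1b⟩
  have hp1 := hp.keep hK1
  have hlen1 := hK1.length.trans hlen
  refine (runs_scatterLoop (b := b) (U := 3 * n) (by omega) hp1.r2 hp1.r0 hp1.r10 hp1.r6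
    hp1.r9 hp1.r9 (by omega) (by rwa [hlen1]) (by omega) (by omega) ?_ (high m A) hH ?_ ?_).seq ?_
  · intro u hu
    rw [zero_add, hlen1]
    exact hdiv3 u hu
  · intro u hu
    exact h1a u (by omega)
  · intro s' k hk hwf' hK' h40 hsame
    -- The middle bits are intact: so far only positions in the first three bits of the cells have
    -- been written.
    refine hev s' k hk hwf' (hp1.keep hK') (hK1.trans hK') h40 fun j hj => ?_
    have h3 : (k * b + 3 + j) % b = 3 + j := by
      rw [add_assoc]; exact cell_add_mod (by omega)
    have h4 : ∀ u, k * b + 3 + j ≠ viewPos b 3 0 (0 + u) := fun u h => by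
      have := hTm (0 + u)
      rw [← h] at this
      omega
    rw [hsame _ fun u _ => h4 u, h1b _ fun u _ => h4 u, harr]
  rintro s2 hwf2 ⟨hK2, h2a, h2b⟩
  have hp2 := hp1.keep hK2
  have hlen2 := hK2.length.trans hlen1
  refine (runs_copyUp (b := b) (by omega) hp2.r2 hp2.r0 hp2.r4 hp2.r4 hp2.r5 hp2.r9 hp2.r14
    hp2.r15 hp2.r9 (by omega) (by rwa [hlen2]) (by omega) (by omega) le_rfl (by omega) ?_ ?_ ?_
    ?_).seq ?_
  · exact fun h0 => ⟨hz2, hz1, fun _ => rfl, fun _ => rfl⟩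
  · intro u hu
    rw [zero_add, hlen2]
    exact Nat.div_lt_of_lt_mul (by rwa [mul_comm])
  · intro u hu
    rw [zero_add, hlen2]
    exact hdivV u (by omega)
  -- The destination of `u` precedes that of `v`, which does not lie after the source of `v`.
  · intro u v huv hv
    rw [zero_add, zero_add]
    exact ((hRR u v huv).trans_le (hRL v (hl0 v hv))).ne
  rintro s3 hwf3 ⟨hK3, h3a, h3b⟩
  have hp3 := hp2.keep hK3
  have hlen3 := hK3.length.trans hlen2
  refine (runs_copyUp (b := b) (by omega) hp3.r2 hp3.r11 hp3.r10 hp3.r6 hp3.r9 hp3.r9 hp3.r14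
    hp3.r15 hp3.r8 (by omega) (by rwa [hlen3]) (by omega) (by omega) (by omega) (by omega)
    (by omega) ?_ ?_ ?_).seq ?_
  · intro u hu
    rw [zero_add, hlen3]
    exact hdiv3 u (by omega)
  · intro u hu
    rw [hlen3]
    exact hdivV _ (by omega)
  · intro u v _ _
    exact hRT _ _
  rintro s4 hwf4 ⟨hK4, h4a, h4b⟩
  have hp4 := hp3.keep hK4
  have hlen4 := hK4.length.trans hlen3
  refine (runs_copyUp (b := b) (by omega) hp4.r2 hp4.r0 hp4.r4 hp4.r14 hp4.r15 hp4.r9 hp4.r2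
    hp4.r9 hp4.r9 (by omega) (by rwa [hlen4]) (by omega) (by omega) (by omega) (by omega)
    ?_ ?_ ?_ ?_).seq ?_
  · exact fun h0 => ⟨hz1, by rw [hreal]; omega, fun _ => rfl, fun _ => rfl⟩
  · intro u hu
    rw [zero_add, hlen4]
    exact hdivV _ (by omega)
  · intro u hu
    rw [zero_add, hlen4]
    exact hdivb _ (by omega)
  · intro u v huv hv
    rw [zero_add, zero_add, hreal]
    have := hR v
    omega
  rintro s5 hwf5 ⟨hK5, h5a, h5b⟩
  have hp5 := hp4.keep hK5
  have hlen5 := hK5.length.trans hlen4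
  refine (runs_copyUp (b := b) (by omega) hp5.r2 hp5.r11 hp5.r10 hp5.r14 hp5.r15 hp5.r8 hp5.r2
    hp5.r9 hp5.r8 (by omega) (by rwa [hlen5]) (by omega) (by omega) (by omega) (by omega)
    (by omega) ?_ ?_ ?_).seq ?_
  · intro u hu
    rw [hlen5]
    exact hdivV _ (by omega)
  · intro u hu
    rw [hlen5]
    exact hdivb _ (by omega)
  · intro u v huv hv
    rw [hreal]
    have := hR (n * l + v)
    omega
  rintro s6 hwf6 ⟨hK6, h6a, h6b⟩
  have hp6 := hp5.keep hK6
  have hlen6 := hK6.length.trans hlen5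
  refine (runs_fillLoop (b := b) (by omega) hp6.r2 hp6.r0 hp6.r12 hp6.r2 hp6.r9 hp6.r13 (by omega)
    (by rwa [hlen6]) (by omega) (by omega) (by omega) ?_).mono le_rfl ?_
  · intro u hu
    rw [hlen6]
    exact hdivb _ (by omega)
  rintro s7 - ⟨hK7, h7a, h7b⟩
  refine ⟨hK7.length.trans hlen6, fun p hpb => ?_⟩
  by_cases hpl : p < n * l
  · have hl1 := hl0 p hpl
    rw [h7b p (fun u _ => by rw [hreal]; omega), h6b p (fun u _ => by rw [hreal]; omega)]
    have e5 := h5a p hpl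
    have e3 := h3a p hpl
    rw [zero_add, hreal] at e5
    rw [zero_add] at e3
    rw [e5, h4b _ (fun u _ => (hRR _ _ (by omega)).ne), e3]
    have h4 : ∀ u, viewPos b l (b - l) p ≠ viewPos b 3 0 (0 + u) := fun u h => by
      have h1 := hTm (0 + u)
      have h2 := hLm p hl1
      rw [h] at h2
      omega
    rw [h2b _ (fun u _ => h4 u), h1b _ (fun u _ => h4 u), harr, arrayBit_lowView _ (by omega) hl1,
      hbit p hpl]
  · obtain ⟨u, rfl⟩ := Nat.exists_eq_add_of_le (not_lt.mp hpl)
    rw [hbh]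
    by_cases hu : u < 3 * n
    · have e6 := h6a u (by omega)
      rw [hreal] at e6
      have h5 : ∀ u' < n * l, viewPos b (b - 3) 3 (n * l + u) ≠ viewPos b b 0 (0 + u') :=
        fun u' hu' => by
          rw [hreal]
          have := hR (n * l + u)
          omega
      have e2 := h2a u hu
      rw [h7b _ (fun u' _ => by rw [hreal]; omega), e6, h5b _ h5, h4a u (by omega),
        h3b _ (fun u' _ => (hRT _ _).symm), e2]
    -- Behind the reserved `3 * n` bits the last loop has written zeros, and the encoding has no
    -- ones there.
    · obtain ⟨u', rfl⟩ := Nat.exists_eq_add_of_le (not_lt.mp hu)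
      have e7 := h7a u' (by omega)
      rw [hreal, add_assoc] at e7
      rw [e7]
      symm
      rw [decide_eq_false_iff_not]
      rintro ⟨k, hk, h⟩
      have := hH k hk
      omega

/-- The encoder. -/
def encode : Cmd :=
  .seq prelude <| .seq thresholdLoop <|
    branch (.bin .shr (.var 0) (.lit 6)) encodeLarge encodeSmall

theorem highWidth_le (hn : 4 ≤ n) : cellWidth m - lowWidth n m ≤ n + 1 := by
  have h1 := cellWidth_le (m := m) (show 0 < n by omega)
  have h2 := clog_le_self n
  omega

theorem eval_large (hn : 4 ≤ n) (hm : n ≤ m) (hw : WordFits n m w) (hwf : WF w (cellWidth m) s)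
    (h0 : s.reg 0 = n) :
    Ev w s (.bin .shr (.var 0) (.lit 6)) (n >>> 6) ∧ (n >>> 6 ≠ 0 ↔ ¬ n < 64) := by
  have h8 := hw.eight_le hn hm
  refine ⟨Ev.shr hwf (Ev.var' h0) (Ev.lit (by omega)), ?_⟩
  rw [Nat.shiftRight_eq_div_pow]
  omega

/-- All variables from 4 on start as zero; the width search and the thresholds rely on it. The
parameters cost `O(lg n)` steps and each loop `O(n)`. -/
theorem runs_encode : ∃ C, ∀ n m w A s, 4 ≤ n → n ≤ m → WordFits n m w → IsSortedList n m A →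
    s.reg 0 = n → s.reg 1 = m → s.reg 2 = cellWidth m → (∀ r, 4 ≤ r → s.reg r = 0) → s.arr = A →
    Runs w (cellWidth m) encode s (C * n) fun s' => s'.arr = compact m A := by
  refine ⟨124 + (10 * numThresholds + 20) + (18 + (40 + 10 * (1100 +
    (highE.cost + 1015) + (100 * (upE.cost + 100)) + ((topE numThresholds).cost + 1015)))), ?_⟩
  intro n m w A s hn hm hw hA h0 h1 h2 h3 harr
  have h8 := hw.eight_le hn hm
  have hq := highWidth_le (m := m) hn
  have t1 := Nat.zero_le (n * highE.cost)
  have t2 := Nat.zero_le (n * (topE numThresholds).cost)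
  have t3 := Nat.zero_le (n * upE.cost)
  have t4 := Nat.zero_le (n * numThresholds)
  refine ((runs_prelude hn hm hw h0 h1 h2 (h3 5 (by omega)) (h3 9 (by omega))).seq
    (T' := (6 + n * (5 + (10 * numThresholds + 1) + 8)) + (5 + (40 + n * (10 * (1100 +
    (highE.cost + 1015) + (100 * (upE.cost + 100)) + ((topE numThresholds).cost + 1015))))))
    (Q := fun s' => s'.arr.length = n ∧
      ∀ p < n * cellWidth m, arrayBit (cellWidth m) s'.arr p = bit m A p) ?_).mono ?_ ?_
  · rintro s1 hwf1 ⟨hp1, harr1, -, hr1⟩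
    refine (runs_thresholdLoop (by omega) hp1.r0 hp1.r7 fun j => ?_).seq ?_
    · rw [hr1 _ (by omega), h3 _ (by omega)]
    rintro s2 hwf2 ⟨harr2, -, hr2, ht2⟩
    have hp2 := hp1.congr hr2
    have ht : Thresholds n m A s2 := fun j hj => by rw [ht2 j hj, harr1, harr]
    have harr' : s2.arr = A := by rw [harr2, harr1, harr]
    obtain ⟨ev, hiff⟩ := eval_large hn hm hw hwf2 hp2.r0
    refine (runs_branch (T := 40 + n * (10 * (1100 +
      (highE.cost + 1015) + (100 * (upE.cost + 100)) + ((topE numThresholds).cost + 1015))))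
      ev.fits (fun h => ?_) fun h => ?_).mono ?_ fun _ _ h => h
    · rw [ev.eq, hiff] at h
      refine (runs_encodeLarge hA hn hm hw h hp2 ht harr').mono ?_ fun _ _ h => h
      -- The running times of fixed expressions are constants; their values are irrelevant and are
      -- hidden from the arithmetic.
      generalize highE.cost = κ1 at *
      generalize (topE numThresholds).cost = κ2 at *
      generalize upE.cost = κ3 at *
      linarith
    · rw [ev.eq] at h
      have h' : n < 64 := by by_contra h''; exact hiff.mpr h'' h
      refine (runs_encodeSmall hA hn hm hw h' hp2 ht harr').mono ?_ fun _ _ h => h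
      generalize highE.cost = κ1 at *
      generalize (topE numThresholds).cost = κ2 at *
      generalize upE.cost = κ3 at *
      linarith
    · generalize highE.cost = κ1 at *
      generalize (topE numThresholds).cost = κ2 at *
      generalize upE.cost = κ3 at *
      simp only [Expr.cost]
      linarith
  · generalize highE.cost = κ1 at *
    generalize (topE numThresholds).cost = κ2 at *
    generalize upE.cost = κ3 at *
    generalize numThresholds = κ4 at *
    linarith
  · rintro s' hwf' ⟨hlen, hbits⟩
    refine array_ext hlen (length_compact hA) hwf'.arr packBits_lt fun p hp => ?_
    rw [hbits p hp, arrayBit_compact hA hp]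

end

end WordRAM

namespace WordRAM

open EliasFano

/-! ### The decoder -/

/-- Process the element with index `i`, in variable `43`, whose one in the bit vector has the
position in variable `40`. -/
def scanStep : Cmd :=
  .seq (assign 44 (.bin .shr (.bin .sub (.var 40) (.var 43)) (.var 12))) <|
  .seq (recordC numThresholds) <|
  .seq (setFieldC (.var 2) (.bin .add (.bin .mul (.var 43) (.var 2)) (.var 6)) (.var 12)
    ((Expr.bin .sub (.var 40) (.var 43)).low (.var 12))) <|
  assign 43 (.bin .add (.var 43) (.lit 1))

/-- Scan the bit vector in a view from bit `base` on. -/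
def scanLoop (W off base : ℕ) : Cmd :=
  .seq (assign 43 (.lit 0)) <|
  forLoop 40 11 <|
  .seq (assign 44 (getViewE (.var 2) (.var W) (.var off) (.bin .add (.var base) (.var 40))
    (.var 10))) <|
  branch (.var 44) scanStep .skip

/-- The state after the first `k` bits of the bit vector have been scanned. -/
structure Scanned (n m : ℕ) (A : List ℕ) (s : State) (k : ℕ) (s' : State) : Prop where
  table : s'.table = s.table
  length : s'.arr.length = s.arr.length
  reg : ∀ r < 40, s'.reg r = s.reg r
  le : s'.reg 43 ≤ n
  lt_iff : ∀ i < n, i < s'.reg 43 ↔ high m A i + i < k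
  thresholds : ∀ j < numThresholds, s'.reg (50 + j) =
    countLE (fun i => A.getD i 0 >>> (cellWidth m - topWidth n m)) (s'.reg 43) j
  mid : ∀ i < s'.reg 43, ∀ j < cellWidth m - lowWidth n m - topWidth n m,
    arrayBit (cellWidth m) s'.arr (i * cellWidth m + topWidth n m + j) =
      arrayBit (cellWidth m) A (i * cellWidth m + topWidth n m + j)
  keep : ∀ p, (∀ i < n, ∀ j < cellWidth m - lowWidth n m - topWidth n m,
      p ≠ i * cellWidth m + topWidth n m + j) →
    arrayBit (cellWidth m) s'.arr p = arrayBit (cellWidth m) s.arr p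

section

variable {n m w : ℕ} {A : List ℕ} {s : State}

theorem high_add_strictMono (hA : IsSortedList n m A) {i j : ℕ} (hij : i < j) (hj : j < n) :
    high m A i + i < high m A j + j := by
  have := high_mono hA hij.le hj
  omega

theorem Scanned.set {k : ℕ} {s' : State} (h : Scanned n m A s k s') {r : ℕ} (v : ℕ)
    (hr : r = 40 ∨ r = 44) : Scanned n m A s k (s'.set r v) := by
  have h43 : (s'.set r v).reg 43 = s'.reg 43 := State.set_reg_of_ne _ _ (by omega)
  refine ⟨h.table, h.length, fun q hq => ?_, ?_, ?_, fun j hj => ?_, ?_, h.keep⟩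
  · rw [State.set_reg_of_ne _ _ (by omega), h.reg q hq]
  · rw [h43]; exact h.le
  · rw [h43]; exact h.lt_iff
  · rw [h43, State.set_reg_of_ne _ _ (by omega), h.thresholds j hj]
  · rw [h43]; exact h.mid

/-- The ones occur in the order of the elements, so the one found at position `k` belongs to the
element `i` counted in variable 43, and `k - i` is its high-order part. Its leading bits go into the
thresholds, and the others into the middle of cell `i`. -/
theorem runs_scanStep (hA : IsSortedList n m A) (hn : 4 ≤ n) (hm : n ≤ m)
    (hw : WordFits n m w)
    (hp : Params n (cellWidth m) (lowWidth n m) (topWidth n m) (vectorLength n m) s)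
    (hlen : s.arr.length = n) {k : ℕ} {s' : State} (hs : Scanned n m A s k s')
    (h40 : s'.reg 40 = k) (hbit : ∃ i < n, high m A i + i = k) :
    Runs w (cellWidth m) scanStep s' (400 + 10 * numThresholds)
      (fun s'' => s''.reg 40 = k ∧ Scanned n m A s (k + 1) s'') := by
  have h8 := hw.eight_le hn hm
  have hl := topWidth_add_le hn hm
  have hl2 := lowWidth_add_two_le hn hm
  have hw2 : n * cellWidth m < 2 ^ w := hw.2
  obtain ⟨i, hi, hik⟩ := hbit
  have hc : s'.reg 43 = i := by
    have h1 := hs.lt_iff i hi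
    rcases Nat.lt_trichotomy (s'.reg 43) i with h | h | h
    · have h2 := hs.lt_iff _ (h.trans hi)
      have := high_add_strictMono hA h hi
      omega
    · exact h
    · omega
  have hhigh : high m A i = A.getD i 0 >>> lowWidth n m := by
    rw [high, hA.1, Nat.shiftRight_eq_div_pow]
  have htop : (k - i) >>> (cellWidth m - lowWidth n m - topWidth n m) =
      A.getD i 0 >>> (cellWidth m - topWidth n m) := by
    rw [show k - i = high m A i by omega, hhigh, ← Nat.shiftRight_add]
    congr 1; omega
  have hthr := hs.thresholds
  have hmid := hs.mid
  have hlt := hs.lt_iff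
  have hle := hs.le
  rw [hc] at hthr hmid hlt hle
  have hkeep := hs.keep
  have hp' := hp.congr hs.reg
  have htopc : topWidth n m ≤ cellWidth m := by omega
  set b := cellWidth m with hb
  set l := lowWidth n m with hl'
  set c := topWidth n m with hc'
  have hib : (i + 1) * b ≤ n * b := Nat.mul_le_mul_right _ hi
  rw [add_mul] at hib
  have hnw : n < 2 ^ w := by have := hw.1; omega
  have step : ∀ {p : Cmd} {s : State} {r x c : ℕ} {e : Expr} {T : ℕ} {Q : State → Prop},
      (WF w b s → Ev w s e x) → e.cost + 1 = c → (WF w b (s.set r x) → Runs w b p (s.set r x) T Q) →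
      Runs w b (.seq (assign r e) p) s (c + T) Q := by
    intro p s r x c e T Q he hc hp
    refine Runs.of_wf fun hwf => ?_
    refine ((Runs.assign (he hwf) (Q := fun s' => s' = s.set r x) rfl le_rfl).seq
      (T' := T) ?_).mono (by omega) fun _ _ h => h
    rintro s' hwf' rfl
    exact hp hwf'
  refine (step (x := A.getD i 0 >>> (b - c)) (T := (10 * numThresholds + 1) + (350 + 10))
    (fun hwf => (Ev.shr hwf (Ev.sub hwf (Ev.var' h40) (Ev.var' hc)) (Ev.var' hp'.r12)).congr htop)
    rfl fun hwf1 => ?_).mono (by generalize numThresholds = κ; simp only [Expr.cost]; omega)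
    fun _ _ h => h
  refine (runs_recordC (T := fun j => countLE (fun i => A.getD i 0 >>> (b - c)) i j) (by omega)
    (s'.set_reg_self 44 _) numThresholds (fun j hj => ?_) fun j _ => ?_).seq ?_
  · rw [State.set_reg_of_ne _ _ (by omega)]; exact hthr j hj
  · have := countLE_le (fun i => A.getD i 0 >>> (b - c)) i j
    omega
  rintro s1 hwf2 ⟨g1, g2, g3, g4, g5⟩
  rw [State.set_arr] at g1
  rw [State.set_table] at g2
  have g6 : ∀ r, r ≠ 44 → r < 50 → s1.reg r = s'.reg r := fun r h1 h2 => by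
    rw [g5 r h1 (fun j _ => by omega), State.set_reg_of_ne _ _ h1]
  have hp1 := hp'.congr (s' := s1) fun r hr => g6 r (by omega) (by omega)
  have k40 := (g6 40 (by omega) (by omega)).trans h40
  have k43 := (g6 43 (by omega) (by omega)).trans hc
  have epos : Ev w s1 (.bin .add (.bin .mul (.var 43) (.var 2)) (.var 6)) (i * b + c) :=
    Ev.add (Ev.mul (Ev.var' k43) (Ev.var' hp1.r2) (by omega)) (Ev.var' hp1.r6) (by omega)
  have eval := Ev.low hwf2 (Ev.sub hwf2 (Ev.var' k40) (Ev.var' k43)) (Ev.var' hp1.r12)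
  have hfit : (i * b + c) % b + (b - l - c) ≤ b := by
    by_cases hcb : c < b
    · rw [cell_add_mod hcb]; omega
    · have : b - l - c = 0 := by omega
      rw [this]
      exact (Nat.mod_lt _ (by omega)).le
  refine ((runs_setFieldC hwf2 (Ev.var' hp1.r2) epos (Ev.var' hp1.r12) eval hfit
    (Nat.mod_lt _ (by positivity))).mono (T' := 350) (by simp [Expr.cost, Expr.low])
    (fun _ _ h => h)).seq ?_
  rintro s2 hwf3 rfl
  refine Runs.assign (x := i + 1) (Ev.add (Ev.var' k43) (Ev.lit (by omega)) (by omega)) ?_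
    (by simp [Expr.cost])
  have hi1 : ∀ j, j < n → (j < i + 1 ↔ high m A j + j < k + 1) := by
    intro j hj
    have h1 := hlt j hj
    rcases Nat.lt_trichotomy j i with h | rfl | h
    · omega
    · omega
    · have := high_add_strictMono hA h hj
      omega
  have hset := fun r => arrayBit_setField (Z := s1.arr) (r := r)
    (x := (k - i) % 2 ^ (b - l - c)) hfit (Nat.mod_lt _ (by positivity)) (fun h => by
      rw [cell_add_div (by omega), g1, hs.length, hlen]; exact hi)
  refine ⟨?_, ?_, ?_, ?_, ?_, ?_, ?_, ?_, ?_⟩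
  · rw [State.set_reg_of_ne _ _ (by omega)]; exact k40
  · exact g2.trans hs.table
  · show (setField b s1.arr _ _ _).length = _
    rw [length_setField, g1, hs.length]
  · intro r hr
    rw [State.set_reg_of_ne _ _ (by omega)]
    exact (g6 r (by omega) (by omega)).trans (hs.reg r hr)
  · rw [State.set_reg_self]; omega
  · rw [State.set_reg_self]; exact hi1
  · intro j hj
    rw [State.set_reg_self, State.set_reg_of_ne _ _ (by omega)]
    show s1.reg (50 + j) = _
    rw [g4 j hj, countLE_succ]
  · rw [State.set_reg_self]
    intro i' hi' j hj
    rw [← hb, ← hl', ← hc'] at hj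
    rw [← hb, ← hc']
    show arrayBit b (setField b s1.arr _ _ _) _ = _
    rw [hset, g1]
    by_cases hii : i' = i
    · subst hii
      rw [if_pos (by omega), Nat.testBit_mod_two_pow, add_assoc, arrayBit_cell _ (by omega),
        show k - i' = high m A i' by omega, hhigh, Nat.testBit_shiftRight]
      have h1 : b - l - c - 1 - (i' * b + (c + j) - (i' * b + c)) < b - l - c := by omega
      rw [decide_eq_true h1, Bool.true_and]
      congr 1
      omega
    · rw [if_neg, hmid i' (by omega) j hj]
      have h1 : (i' + 1) * b ≤ i * b := Nat.mul_le_mul_right _ (by omega)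
      rw [add_mul] at h1
      omega
  · intro p hpp
    rw [← hb, ← hl', ← hc'] at hpp
    rw [← hb]
    show arrayBit b (setField b s1.arr _ _ _) _ = _
    rw [hset, g1, if_neg, hkeep p hpp]
    rintro ⟨h1, h2⟩
    exact hpp i hi (p - (i * b + c)) (by omega) (by omega)

/-- By `hdis` the middle bits written during the scan lie outside the vector, which is therefore
read in its original state. All ones lie within the scanned range, so in the end all `n` elements
have been counted. -/
theorem runs_scanLoop {rW ro rB W off base : ℕ} (hr : rW < 40 ∧ ro < 40 ∧ rB < 40)
    (hA : IsSortedList n m A) (hn : 4 ≤ n) (hm : n ≤ m) (hw : WordFits n m w)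
    (hp : Params n (cellWidth m) (lowWidth n m) (topWidth n m) (vectorLength n m) s)
    (hlen : s.arr.length = n) (hW : s.reg rW = W) (ho : s.reg ro = off) (hB : s.reg rB = base)
    (hWb : off + W ≤ cellWidth m) (h0 : 0 < W)
    (hT : ∀ j, s.reg (50 + j) = 0)
    (hS : ∀ u < vectorLength n m, (base + u) / W < n)
    (hbits : ∀ u < vectorLength n m, arrayBit (cellWidth m) s.arr
      (viewPos (cellWidth m) W off (base + u)) = decide (∃ i < n, high m A i + i = u))
    (hdis : ∀ u < vectorLength n m, ∀ i < n,
      ∀ j < cellWidth m - lowWidth n m - topWidth n m,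
        viewPos (cellWidth m) W off (base + u) ≠ i * cellWidth m + topWidth n m + j) :
    Runs w (cellWidth m) (scanLoop rW ro rB) s
      (2 + (6 + vectorLength n m * (1000 + 10 * numThresholds)))
      (fun s' => Scanned n m A s (vectorLength n m) s' ∧ s'.reg 43 = n) := by
  have h8 := hw.eight_le hn hm
  have hw2 : n * cellWidth m < 2 ^ w := hw.2
  refine (Runs.assign (Ev.lit (x := 0) (by omega)) (Q := fun s' => s' = s.set 43 0) rfl
    le_rfl).seq ?_
  rintro s1 - rfl
  have hr1 : ∀ r, r ≠ 43 → (s.set 43 0).reg r = s.reg r := fun r h => State.set_reg_of_ne _ _ h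
  refine (runs_forLoop (by omega) (by omega) (Scanned n m A s) (T := 992 + 10 * numThresholds)
    ((hr1 11 (by omega)).trans hp.r11) ?_ ?_).mono
    (by rw [show 992 + 10 * numThresholds + 8 = 1000 + 10 * numThresholds by omega]) ?_
  · refine Scanned.set (s := s) (s' := s.set 43 0) ⟨rfl, rfl, fun r hr => hr1 r (by omega),
      by simp, ?_, ?_, ?_, fun _ _ => rfl⟩ _ (Or.inl rfl)
    · simp
    · intro j _
      rw [State.set_reg_self, hr1 _ (by omega), hT, countLE_zero]
    · simp
  · intro k s' hk hwf hs h40 h11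
    have hp' := hp.congr hs.reg
    have hpos : viewPos (cellWidth m) W off (base + k) < 2 ^ w :=
      (viewPos_lt hWb h0 (hS k hk)).trans hw2
    have hle := le_viewPos hWb (v := base + k)
    have ev := Ev.getView hwf (Ev.var' hp'.r2) (Ev.var' ((hs.reg _ hr.1).trans hW))
      (Ev.var' ((hs.reg _ hr.2.1).trans ho))
      (Ev.add (Ev.var' ((hs.reg _ hr.2.2).trans hB)) (Ev.var' h40) (by omega))
      (Ev.var' hp'.r10) hWb (by omega) hpos (fun j hj => by
        obtain rfl : j = 0 := by omega
        exact hpos) (by omega)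
    have hbit := testBit_getView s'.arr hWb (v := base + k) (len := 1) (by omega) (j := 0)
      (by omega)
    rw [add_zero, hs.keep _ (hdis k hk), hbits k hk] at hbit
    have hlt2 := getView_lt s'.arr (b := cellWidth m) (W := W) (off := off) (v := base + k)
      (len := 1)
    set g := getView (cellWidth m) W off s'.arr (base + k) 1 with hg
    have hgb : g ≠ 0 ↔ ∃ i < n, high m A i + i = k := by
      rw [← decide_eq_true_iff (p := ∃ i < n, high m A i + i = k), ← hbit]
      have : g = 0 ∨ g = 1 := by omega
      rcases this with h | h <;> rw [h] <;> simp
    refine ((Runs.assign ev (Q := fun s'' => s'' = s'.set 44 g) rfl le_rfl).seq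
      (T' := 420 + 10 * numThresholds) ?_).mono ?_ fun _ _ h => h
    · rintro s2 - rfl
      have hs2 := hs.set g (Or.inr rfl : 44 = 40 ∨ 44 = 44)
      have e44 : Ev w (s'.set 44 g) (.var 44) g := Ev.var' (by simp)
      have k40 : (s'.set 44 g).reg 40 = k := (State.set_reg_of_ne _ _ (by omega)).trans h40
      refine (runs_branch (T := 400 + 10 * numThresholds) e44.fits (fun h => ?_) fun h => ?_).mono
        (by simp only [Expr.cost]; omega) (Q := fun s'' => s''.reg 40 = k ∧
          Scanned n m A s (k + 1) s'') fun s3 _ h => ?_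
      · rw [e44.eq, hgb] at h
        exact runs_scanStep hA hn hm hw hp hlen hs2 k40 h
      · rw [e44.eq] at h
        refine (Runs.skip ⟨k40, hs2.table, hs2.length, hs2.reg, hs2.le, fun i hi => ?_,
          hs2.thresholds, hs2.mid, hs2.keep⟩).mono (by omega) fun _ _ h => h
        have h1 := hs2.lt_iff i hi
        have h2 : high m A i + i ≠ k := fun h3 => hgb.mpr ⟨i, hi, h3⟩ h
        omega
      · refine ⟨h.1, ?_, h.2.set _ (Or.inl rfl)⟩
        rw [h.2.reg 11 (by omega), hp.r11]
    · generalize numThresholds = κ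
      simp [Expr.cost, getViewE, fieldE, Expr.low, shiftE, viewPosE, headE]
      omega
  · rintro s2 - ⟨h, -⟩
    refine ⟨h, ?_⟩
    have h1 := h.le
    by_contra h2
    have h3 : s2.reg 43 < n := by omega
    have := (h.lt_iff _ h3).mpr (high_add_lt_vectorLength hA hn hm h3)
    omega

theorem Scanned.toThresholds {k : ℕ} {s' : State} (h : Scanned n m A s k s')
    (h43 : s'.reg 43 = n) : Thresholds n m A s' := fun j hj => by
  rw [h.thresholds j hj, h43]

/-- An array with the right high-order, middle and low-order bits in each cell. -/
theorem eq_of_parts {Z : List ℕ} {b l c : ℕ} (hA : A.length = n) (hAb : ∀ x ∈ A, x < 2 ^ b)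
    (hZ : Z.length = n) (hZb : ∀ x ∈ Z, x < 2 ^ b) (hl : l + c ≤ b)
    (htop : ∀ i < n, ∀ j < c, arrayBit b Z (i * b + j) = arrayBit b A (i * b + j))
    (hmid : ∀ i < n, ∀ j < b - l - c,
      arrayBit b Z (i * b + c + j) = arrayBit b A (i * b + c + j))
    (hlow : ∀ u < n * l, arrayBit b Z (viewPos b l (b - l) u) =
      arrayBit b A (viewPos b l (b - l) u)) : Z = A := by
  refine array_ext hZ hA hZb hAb fun p hp => ?_
  have hb : 0 < b := Nat.pos_of_ne_zero fun h => by simp [h] at hp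
  have hi : p / b < n := Nat.div_lt_of_lt_mul (by rwa [mul_comm])
  have hm := Nat.mod_lt p hb
  have hpe : p = p / b * b + p % b := by rw [mul_comm, Nat.div_add_mod]
  rw [hpe]
  generalize p / b = i at *
  generalize p % b = r at *
  by_cases h1 : r < c
  · exact htop i hi r h1
  by_cases h2 : r < b - l
  · have := hmid i hi (r - c) (by omega)
    rwa [show i * b + c + (r - c) = i * b + r by omega] at this
  · have h3 : i * l + (r - (b - l)) < n * l := by
      have : (i + 1) * l ≤ n * l := Nat.mul_le_mul_right _ hi
      rw [add_mul] at this
      omega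
    have := hlow _ h3
    have h4 : viewPos b l (b - l) (i * l + (r - (b - l))) = i * b + r := by
      unfold viewPos
      rw [cell_add_mod (by omega), cell_add_div (by omega)]
      omega
    rwa [h4] at this

/-- Restore the bits that the thresholds represent. -/
def restoreLoop : Cmd := putLoop 0 6 6 9 9 (topE numThresholds)

/-- This has to be the last phase: for long lists the leading bits of the cells contain the bit
vector until it has been scanned. -/
theorem runs_restoreLoop (hA : IsSortedList n m A) (hn : 4 ≤ n) (hm : n ≤ m)
    (hw : WordFits n m w)
    (hp : Params n (cellWidth m) (lowWidth n m) (topWidth n m) (vectorLength n m) s)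
    (hlen : s.arr.length = n) (ht : Thresholds n m A s)
    (hmid : ∀ i < n, ∀ j < cellWidth m - lowWidth n m - topWidth n m,
      arrayBit (cellWidth m) s.arr (i * cellWidth m + topWidth n m + j) =
        arrayBit (cellWidth m) A (i * cellWidth m + topWidth n m + j))
    (hlow : ∀ u < n * lowWidth n m, arrayBit (cellWidth m) s.arr
      (viewPos (cellWidth m) (lowWidth n m) (cellWidth m - lowWidth n m) u) = bit m A u) :
    Runs w (cellWidth m) restoreLoop s (6 + n * (5 + (topE numThresholds).cost + 1010))
      (fun s' => s'.arr = A) := by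
  have h8 := hw.eight_le hn hm
  have hl := topWidth_add_le hn hm
  have hl2 := lowWidth_add_two_le hn hm
  have hw2 : n * cellWidth m < 2 ^ w := hw.2
  have hc2 : 2 ≤ topWidth n m := by
    unfold topWidth; split_ifs <;> omega
  have hbit := fun p => bit_low (p := p) hA
  have hAb : ∀ x ∈ A, x < 2 ^ cellWidth m := fun x hx =>
    (hA.2.2 x hx).trans_le (le_two_pow_cellWidth m)
  have hev := fun s' i hi (hs' : Keep s s') h40 =>
    Ev.thresholds (s := s') (i := i) hA hn hm hw (ht.keep hs') hi h40
  set b := cellWidth m with hb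
  set l := lowWidth n m with hl'
  set c := topWidth n m with hc'
  have hX : ∀ k < n, A.getD k 0 >>> (b - c) < 2 ^ c := fun k hk => by
    rw [Nat.shiftRight_eq_div_pow]
    apply Nat.div_lt_of_lt_mul
    rw [← pow_add, show b - c + c = b by omega]
    exact sorted_cell_lt hA hk
  have hpos : ∀ k j, j < c → viewPos b c 0 (0 + (k * c + j)) = k * b + j := fun k j hj => by
    unfold viewPos
    rw [zero_add, cell_add_mod hj, cell_add_div hj]
    omega
  refine (runs_putLoop (b := b) (by omega) hp.r2 hp.r0 hp.r6 hp.r6 hp.r9 hp.r9 (by omega)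
    (by rwa [hlen]) (by omega) le_rfl (by omega) ?_ _ hX ?_).mono le_rfl ?_
  · intro u hu
    rw [zero_add, hlen]
    exact Nat.div_lt_of_lt_mul (by rwa [mul_comm])
  · intro s' k hk _ hK h40
    exact hev s' k hk hK h40
  · rintro s' hwf ⟨hK, h1, h2⟩
    have hother : ∀ i r, c ≤ r → r < b →
        arrayBit b s'.arr (i * b + r) = arrayBit b s.arr (i * b + r) := fun i r hr hr' => by
      refine h2 _ fun u _ h => ?_
      have h3 := viewPos_mod (b := b) (W := c) (off := 0) (v := 0 + u) (by omega) (by omega)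
      rw [← h, cell_add_mod hr'] at h3
      have := Nat.mod_lt (0 + u) (show 0 < c by omega)
      omega
    refine eq_of_parts hA.1 hAb (hK.length.trans hlen) hwf.arr hl (fun i hi j hj => ?_)
      (fun i hi j hj => ?_) fun u hu => ?_
    · have h3 := h1 i hi j hj
      rw [hpos i j hj] at h3
      rw [h3, arrayBit_cell _ (by omega), Nat.testBit_shiftRight]
      congr 1
      omega
    · rw [add_assoc, hother i _ (by omega) (by omega), ← add_assoc]
      exact hmid i hi j hj
    · have hl0 : 0 < l := by
        by_contra h
        rw [show l = 0 by omega] at hu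
        omega
      have h3 := Nat.mod_lt u hl0
      have h4 := hlow u hu
      rw [hbit u hu, ← arrayBit_lowView A (b := b) (by omega) hl0] at h4
      rw [← h4]
      unfold viewPos
      rw [add_assoc]
      exact hother _ _ (by omega) (by omega)

end

end WordRAM

/-! ### The programs of the decoder and their correctness -/

namespace WordRAM

open EliasFano

/-- Scan the bit vector, then move the low-order bits to the trailing bits of the cells. -/
def decodeSmall : Cmd :=
  .seq (scanLoop 2 9 8) <|
  .seq (copyLoop 0 4 2 9 9 4 5 9 (downE 0)) restoreLoop

/-- Move the bit vector to the leading bits of the cells and the low-order bits to the trailing bits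
of the cells, then scan the bit vector. -/
def decodeLarge : Cmd :=
  .seq (copyLoop 11 10 2 9 8 14 15 8 (downE 11)) <|
  .seq (copyLoop 0 4 2 9 9 14 15 9 (downE 0)) <|
  .seq (copyLoop 11 10 14 15 8 6 9 9 upE) <|
  .seq (copyLoop 0 4 14 15 9 4 5 9 (downE 0)) <|
  .seq (scanLoop 6 9 9) restoreLoop

/-- The decoder. -/
def decode : Cmd :=
  .seq prelude <| branch (.bin .shr (.var 0) (.lit 6)) decodeLarge decodeSmall

section

variable {n m w : ℕ} {A : List ℕ} {s : State}

/-- Here the middle part of a cell is empty, so the scan changes no bit of the array; it moves the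
whole high-order information into the thresholds. The low-order bits may then spread over the space
of the vector. -/
theorem runs_decodeSmall (hA : IsSortedList n m A) (hn : 4 ≤ n) (hm : n ≤ m)
    (hw : WordFits n m w) (hsm : n < 64)
    (hp : Params n (cellWidth m) (lowWidth n m) (topWidth n m) (vectorLength n m) s)
    (hT : ∀ j, s.reg (50 + j) = 0) (harr : s.arr = compact m A) :
    Runs w (cellWidth m) decodeSmall s
      ((2 + (6 + vectorLength n m * (1000 + 10 * numThresholds))) +
        ((6 + n * (100 * ((downE 0).cost + 100))) +
          (6 + n * (5 + (topE numThresholds).cost + 1010)))) fun s' => s'.arr = A := by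
  have h8 := hw.eight_le hn hm
  have hl := lowWidth_add_two_le hn hm
  have hU : vectorLength n m = n * (cellWidth m - lowWidth n m) := if_pos hsm
  have hc : topWidth n m = cellWidth m - lowWidth n m := if_pos hsm
  have hlen : s.arr.length = n := by rw [harr, length_compact hA]
  have hw2 : n * cellWidth m < 2 ^ w := hw.2
  have hbw := Nat.lt_two_pow_self (n := cellWidth m)
  have hbw' : 2 ^ cellWidth m ≤ 2 ^ w :=
    Nat.pow_le_pow_right (by norm_num) (cellWidth_le_of_fits hw.1)
  have hnl : n * lowWidth n m ≤ n * cellWidth m := Nat.mul_le_mul_left _ (by omega)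
  have hUb := vectorLength_add_le hn hm
  have hreal := viewPos_real (cellWidth m)
  have hdiv : ∀ u, u < n * cellWidth m → u / cellWidth m < n := fun u hu =>
    Nat.div_lt_of_lt_mul (by rwa [mul_comm (cellWidth m) n])
  refine (runs_scanLoop (by omega) hA hn hm hw hp hlen hp.r2 hp.r9 hp.r8 (by omega) (by omega) hT
    (fun u hu => hdiv _ (by omega)) (fun u _ => ?_) fun u _ i _ j hj => by omega).seq ?_
  · rw [hreal, harr, arrayBit_compact_high hA hn hm]
  rintro s1 hwf1 ⟨hS, h43⟩
  have hp1 := hp.congr hS.reg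
  have hlen1 := hS.length.trans hlen
  have ht := hS.toThresholds h43
  refine (runs_copyDown (b := cellWidth m) (by omega) hp1.r2 hp1.r0 hp1.r4 hp1.r2 hp1.r9 hp1.r9
    hp1.r4 hp1.r5 hp1.r9 (by omega) (by rwa [hlen1]) (by omega) (by omega) (by omega) le_rfl
    ?_ ?_ ?_ ?_).seq ?_
  · intro h0
    refine ⟨?_, ?_, fun _ => rfl, fun _ => rfl⟩
    · rw [hreal]; omega
    · simp [viewPos]; omega
  · intro u hu
    rw [zero_add, hlen1]
    exact hdiv _ (by omega)
  · intro u hu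
    rw [zero_add, hlen1]
    exact Nat.div_lt_of_lt_mul (by rwa [mul_comm])
  · intro u v huv hu
    rw [zero_add, zero_add, hreal]
    have := le_viewPos (b := cellWidth m) (W := lowWidth n m)
      (off := cellWidth m - lowWidth n m) (v := u) (by omega)
    omega
  rintro s2 - ⟨hK2, h2a, -⟩
  refine runs_restoreLoop hA hn hm hw (hp1.keep hK2) (hK2.length.trans hlen1) (ht.keep hK2)
    (fun i _ j hj => by omega) fun u hu => ?_
  have h1 := h2a u hu
  rw [zero_add, hreal] at h1
  rw [h1, hS.keep _ (fun i _ j hj => by omega), harr, arrayBit_compact hA (by omega)]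

/-- The moves of the encoder in reverse. Now the vector has to be moved before the low-order bits:
its destinations lie behind all of them, while their destinations may lie in the old place of the
vector. The low-order bits are spread to the ends of the cells only after the vector has left the
trailing view. -/
theorem runs_decodeLarge (hA : IsSortedList n m A) (hn : 4 ≤ n) (hm : n ≤ m)
    (hw : WordFits n m w) (hbig : ¬ n < 64)
    (hp : Params n (cellWidth m) (lowWidth n m) (topWidth n m) (vectorLength n m) s)
    (hT : ∀ j, s.reg (50 + j) = 0) (harr : s.arr = compact m A) :
    Runs w (cellWidth m) decodeLarge s
      ((6 + 3 * n * (100 * ((downE 11).cost + 100))) +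
        ((6 + n * (100 * ((downE 0).cost + 100))) +
          ((6 + 3 * n * (100 * (upE.cost + 100))) +
            ((6 + n * (100 * ((downE 0).cost + 100))) +
              ((2 + (6 + 3 * n * (1000 + 10 * numThresholds))) +
                (6 + n * (5 + (topE numThresholds).cost + 1010))))))) fun s' => s'.arr = A := by
  have h8 := hw.eight_le hn hm
  have hl := lowWidth_add_six_le hbig hm
  have hU : vectorLength n m = 3 * n := if_neg hbig
  have hc : topWidth n m = 3 := if_neg hbig
  have hlen : s.arr.length = n := by rw [harr, length_compact hA]
  have hw2 : n * cellWidth m < 2 ^ w := hw.2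
  have hbw := Nat.lt_two_pow_self (n := cellWidth m)
  have hbw' : 2 ^ cellWidth m ≤ 2 ^ w :=
    Nat.pow_le_pow_right (by norm_num) (cellWidth_le_of_fits hw.1)
  have hnv : n * lowWidth n m + 3 * n ≤ n * (cellWidth m - 3) := by
    rw [mul_comm 3, ← mul_add]; exact Nat.mul_le_mul_left _ (by omega)
  have hnb : n * (cellWidth m - 3) ≤ n * cellWidth m := Nat.mul_le_mul_left _ (by omega)
  have hcl := fun p => arrayBit_compact (p := p) hA
  have hch := arrayBit_compact_high hA hn hm
  have hscan := fun s' => runs_scanLoop (s := s') (rW := 6) (ro := 9) (rB := 9) (W := 3) (off := 0)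
    (base := 0) (by omega) hA hn hm hw
  have hrest := fun s' => runs_restoreLoop (s := s') hA hn hm hw
  rw [hU] at hp
  rw [hc] at hp
  simp only [hU, hc] at hscan hrest
  set b := cellWidth m with hb
  set l := lowWidth n m with hl'
  have hb0 : 0 < b := by omega
  have hreal := viewPos_real b
  have hR : ∀ v, v ≤ viewPos b (b - 3) 3 v := fun v => le_viewPos (by omega)
  have hRR : ∀ u v, u < v → viewPos b (b - 3) 3 u < viewPos b (b - 3) 3 v := fun u v h =>
    viewPos_lt_viewPos (by omega) (by omega) h
  have hRm : ∀ v, viewPos b (b - 3) 3 v % b = 3 + v % (b - 3) := fun v =>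
    viewPos_mod (by omega) (by omega)
  have hTm : ∀ v, viewPos b 3 0 v % b < 3 := fun v => by
    have := viewPos_mod (b := b) (W := 3) (off := 0) (v := v) (by omega) (by omega)
    have := Nat.mod_lt v (show 0 < 3 by omega)
    omega
  have hLm : ∀ v, 0 < l → viewPos b l (b - l) v % b = (b - l) + v % l := fun v h =>
    viewPos_mod (by omega) h
  have hRT : ∀ u v, viewPos b (b - 3) 3 u ≠ viewPos b 3 0 v := fun u v h => by
    have h1 := hRm u
    have h2 := hTm v
    rw [h] at h1
    omega
  have hRL : ∀ v, 0 < l → viewPos b (b - 3) 3 v ≤ viewPos b l (b - l) v := fun v h => by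
    have := viewPos_right_anti (b := b) (W := b - 3) (W' := l) h (by omega) (by omega) v
    rwa [show b - (b - 3) = 3 by omega] at this
  have hl0 : ∀ u, u < n * l → 0 < l := fun u hu => by
    by_contra h
    rw [show l = 0 by omega] at hu
    omega
  have hdivV : ∀ u, u < n * l + 3 * n → u / (b - 3) < n := fun u hu =>
    Nat.div_lt_of_lt_mul (by rw [mul_comm (b - 3) n]; omega)
  have hdivb : ∀ u, u < n * b → u / b < n := fun u hu =>
    Nat.div_lt_of_lt_mul (by rwa [mul_comm b n])
  have hdiv3 : ∀ u, u < 3 * n → u / 3 < n := fun u hu => Nat.div_lt_of_lt_mul hu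
  have hz1 : viewPos b (b - 3) 3 0 < 2 ^ w := by simp [viewPos]; omega
  have hz2 : viewPos b l (b - l) 0 < 2 ^ w := by simp [viewPos]; omega
  have hcell : ∀ i r, r < b → (i * b + r) % b = r := fun i r h => cell_add_mod h
  refine (runs_copyDown (b := b) (by omega) hp.r2 hp.r11 hp.r10 hp.r2 hp.r9 hp.r8 hp.r14
    hp.r15 hp.r8 (by omega) (by rwa [hlen]) (by omega) (by omega) (by omega) (by omega)
    (by omega) ?_ ?_ ?_).seq ?_
  · intro u hu
    rw [hlen]
    exact hdivb _ (by omega)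
  · intro u hu
    rw [hlen]
    exact hdivV _ (by omega)
  · intro u v huv hu
    rw [hreal]
    have := hR (n * l + u)
    omega
  rintro s1 - ⟨hK1, h1a, h1b⟩
  have hp1 := hp.keep hK1
  have hlen1 := hK1.length.trans hlen
  refine (runs_copyDown (b := b) (by omega) hp1.r2 hp1.r0 hp1.r4 hp1.r2 hp1.r9 hp1.r9 hp1.r14
    hp1.r15 hp1.r9 (by omega) (by rwa [hlen1]) (by omega) (by omega) (by omega) (by omega)
    ?_ ?_ ?_ ?_).seq ?_
  · exact fun h0 => ⟨by rw [hreal]; omega, hz1, fun _ => rfl, fun _ => rfl⟩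
  · intro u hu
    rw [zero_add, hlen1]
    exact hdivb _ (by omega)
  · intro u hu
    rw [zero_add, hlen1]
    exact hdivV _ (by omega)
  · intro u v huv hu
    rw [zero_add, zero_add, hreal]
    have := hR u
    omega
  rintro s2 - ⟨hK2, h2a, h2b⟩
  have hp2 := hp1.keep hK2
  have hlen2 := hK2.length.trans hlen1
  refine (runs_copyUp (b := b) (by omega) hp2.r2 hp2.r11 hp2.r10 hp2.r14 hp2.r15 hp2.r8 hp2.r6
    hp2.r9 hp2.r9 (by omega) (by rwa [hlen2]) (by omega) (by omega) (by omega) (by omega)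
    (by omega) ?_ ?_ ?_).seq ?_
  · intro u hu
    rw [hlen2]
    exact hdivV _ (by omega)
  · intro u hu
    rw [zero_add, hlen2]
    exact hdiv3 u (by omega)
  · intro u v _ _
    exact (hRT _ _).symm
  rintro s3 - ⟨hK3, h3a, h3b⟩
  have hp3 := hp2.keep hK3
  have hlen3 := hK3.length.trans hlen2
  refine (runs_copyDown (b := b) (by omega) hp3.r2 hp3.r0 hp3.r4 hp3.r14 hp3.r15 hp3.r9 hp3.r4
    hp3.r5 hp3.r9 (by omega) (by rwa [hlen3]) (by omega) (by omega) (by omega) le_rfl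
    ?_ ?_ ?_ ?_).seq ?_
  · exact fun h0 => ⟨hz1, hz2, fun _ => rfl, fun _ => rfl⟩
  · intro u hu
    rw [zero_add, hlen3]
    exact hdivV _ (by omega)
  · intro u hu
    rw [zero_add, hlen3]
    exact Nat.div_lt_of_lt_mul (by rwa [mul_comm])
  · intro u v huv hu
    rw [zero_add, zero_add]
    exact ((hRR v u huv).trans_le (hRL u (hl0 u hu))).ne'
  rintro s4 - ⟨hK4, h4a, h4b⟩
  have hp4 := hp3.keep hK4
  have hlen4 := hK4.length.trans hlen3
  have hK := ((hK1.trans hK2).trans hK3).trans hK4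
  have hLT : ∀ u < n * l, ∀ v, viewPos b l (b - l) u ≠ viewPos b 3 0 v := fun u hu v h => by
    have h1 := hLm u (hl0 u hu)
    have h2 := hTm v
    rw [h] at h1
    omega
  refine (hscan s4 hp4 hlen4 hp4.r6 hp4.r9 hp4.r9 (by omega) (by omega) (fun j => ?_)
    (fun u hu => ?_) (fun u hu => ?_) fun u hu i hi j hj h => ?_).seq ?_
  · rw [hK.reg _ (by omega), hT]
  · rw [zero_add]
    exact hdiv3 u hu
  · rw [h4b _ (fun u' hu' => by rw [zero_add u']; exact (hLT u' (by omega) _).symm), h3a u (by omega),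
      h2b _ (fun u' hu' => (hRR _ _ (by omega)).ne'), h1a u (by omega), hreal, harr, hch]
  · have h1 := hTm (0 + u)
    rw [h, add_assoc, hcell i _ (by omega)] at h1
    omega
  rintro s5 - ⟨hS, h43⟩
  have hp5 := hp4.congr hS.reg
  have hlen5 := hS.length.trans hlen4
  have ht := hS.toThresholds h43
  have hmid := hS.mid
  rw [h43] at hmid
  have hkeep := hS.keep
  rw [hc] at hmid hkeep
  refine hrest s5 hp5 hlen5 ht hmid fun u hu => ?_
  have hl1 := hl0 u hu
  rw [hkeep, ← hb]
  · have h4 := h4a u hu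
    have h2 := h2a u hu
    rw [zero_add] at h4 h2
    rw [hreal] at h2
    rw [h4, h3b _ (fun u' _ => hRT _ _), h2, h1b _ (fun u' hu' => by
      have := hR (n * l + u')
      omega), harr, hcl _ (by omega)]
  · intro i hi j hj h
    have h1 := hLm u hl1
    rw [h, add_assoc, hcell i _ (by omega)] at h1
    omega

theorem runs_decode : ∃ C, ∀ n m w A s, 4 ≤ n → n ≤ m → WordFits n m w → IsSortedList n m A →
    s.reg 0 = n → s.reg 1 = m → s.reg 2 = cellWidth m → (∀ r, 4 ≤ r → s.reg r = 0) →
    s.arr = compact m A → Runs w (cellWidth m) decode s (C * n) fun s' => s'.arr = A := by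
  refine ⟨200 + 10 * (300 + 3 * (100 * ((downE 11).cost + 100)) + 2 * (100 * ((downE 0).cost + 100)) +
    3 * (100 * (upE.cost + 100)) + 8 * (1000 + 10 * numThresholds) +
    (5 + (topE numThresholds).cost + 1010)), ?_⟩
  intro n m w A s hn hm hw hA h0 h1 h2 h3 harr
  have hq := highWidth_le (m := m) hn
  have hV := vectorLength_le (m := m) hn
  have hV' := Nat.mul_le_mul_right (1000 + 10 * numThresholds) hV
  have t1 := Nat.zero_le (n * (downE 11).cost)
  have t2 := Nat.zero_le (n * (topE numThresholds).cost)
  have t3 := Nat.zero_le (n * upE.cost)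
  have t4 := Nat.zero_le (n * numThresholds)
  have t5 := Nat.zero_le (n * (downE 0).cost)
  refine ((runs_prelude hn hm hw h0 h1 h2 (h3 5 (by omega)) (h3 9 (by omega))).seq
    (T' := 10 + (50 + n * (300 + 3 * (100 * ((downE 11).cost + 100)) +
      2 * (100 * ((downE 0).cost + 100)) +
    3 * (100 * (upE.cost + 100)) + 8 * (1000 + 10 * numThresholds) +
    (5 + (topE numThresholds).cost + 1010))))
    (Q := fun s' => s'.arr = A) ?_).mono ?_ fun _ _ h => h
  · rintro s1 hwf1 ⟨hp1, harr1, -, hr1⟩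
    have hT : ∀ j, s1.reg (50 + j) = 0 := fun j => by rw [hr1 _ (by omega), h3 _ (by omega)]
    obtain ⟨ev, hiff⟩ := eval_large hn hm hw hwf1 hp1.r0
    refine (runs_branch (T := 50 + n * (300 + 3 * (100 * ((downE 11).cost + 100)) +
      2 * (100 * ((downE 0).cost + 100)) +
      3 * (100 * (upE.cost + 100)) + 8 * (1000 + 10 * numThresholds) +
      (5 + (topE numThresholds).cost + 1010)))
      ev.fits (fun h => ?_) fun h => ?_).mono ?_ fun _ _ h => h
    · rw [ev.eq, hiff] at h
      refine (runs_decodeLarge hA hn hm hw h hp1 hT (harr1.trans harr)).mono ?_ fun _ _ h => h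
      generalize (downE 11).cost = κ1 at *
      generalize (topE numThresholds).cost = κ2 at *
      generalize upE.cost = κ3 at *
      generalize (downE 0).cost = κ5 at *
      generalize numThresholds = κ4 at *
      linarith
    · rw [ev.eq] at h
      have h' : n < 64 := by by_contra h''; exact hiff.mpr h'' h
      refine (runs_decodeSmall hA hn hm hw h' hp1 hT (harr1.trans harr)).mono ?_ fun _ _ h => h
      generalize (downE 11).cost = κ1 at *
      generalize (topE numThresholds).cost = κ2 at *
      generalize upE.cost = κ3 at *
      generalize (downE 0).cost = κ5 at *
      generalize numThresholds = κ4 at *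
      linarith
    · generalize (downE 11).cost = κ1 at *
      generalize (topE numThresholds).cost = κ2 at *
      generalize upE.cost = κ3 at *
      generalize (downE 0).cost = κ5 at *
      generalize numThresholds = κ4 at *
      simp only [Expr.cost]
      linarith
  · generalize (downE 11).cost = κ1 at *
    generalize (topE numThresholds).cost = κ2 at *
    generalize upE.cost = κ3 at *
    generalize (downE 0).cost = κ5 at *
    generalize numThresholds = κ4 at *
    linarith

end

end WordRAM

namespace EliasFano

/-! ### The select structure

Let `x` be strictly increasing. A group of `G` consecutive indices is sparse if its values spread
over at least `S` positions. -/

section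

variable {x : ℕ → ℕ} {G S φ K : ℕ}

/-- The `g`-th group of `G` indices is sparse. -/
def IsSparse (x : ℕ → ℕ) (G S g : ℕ) : Prop := x (g * G) + S ≤ x ((g + 1) * G)

instance (x : ℕ → ℕ) (G S g : ℕ) : Decidable (IsSparse x G S g) :=
  inferInstanceAs (Decidable (_ ≤ _))

/-- The sparse group that starts in the `z`-th block of `S` positions. -/
noncomputable def sparseGroup (x : ℕ → ℕ) (G S z : ℕ) : ℕ :=
  sInf {g | IsSparse x G S g ∧ x (g * G) / S = z}

/-- A sparse group ends at least `S` positions after its start, so every later group starts in a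
later block: each block contains the start of at most one sparse group. -/
theorem sparseGroup_eq (hx : StrictMono x) (hS : 0 < S) {g : ℕ} (hg : IsSparse x G S g) :
    sparseGroup x G S (x (g * G) / S) = g := by
  have key : ∀ a b, a < b → IsSparse x G S a → x (a * G) / S ≠ x (b * G) / S := by
    intro a b hab ha h
    have h1 : x ((a + 1) * G) ≤ x (b * G) := hx.monotone (Nat.mul_le_mul_right _ hab)
    have h2 := Nat.div_le_div_right (c := S) (ha.trans h1)
    rw [Nat.add_div_right _ hS] at h2
    omega
  have hmem : sparseGroup x G S (x (g * G) / S) ∈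
      {g' | IsSparse x G S g' ∧ x (g' * G) / S = x (g * G) / S} := Nat.sInf_mem ⟨g, hg, rfl⟩
  rcases Nat.lt_trichotomy (sparseGroup x G S (x (g * G) / S)) g with h | h | h
  · exact absurd hmem.2 (key _ _ h hmem.1)
  · exact h
  · exact absurd hmem.2.symm (key _ _ h hg)

theorem lt_of_not_isSparse (hx : StrictMono x) (hG : 0 < G) {i : ℕ}
    (h : ¬ IsSparse x G S (i / G)) : x i < x (i / G * G) + S := by
  have h1 : i < (i / G + 1) * G := by
    rw [mul_comm]; exact Nat.lt_mul_div_succ i hG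
  have := hx h1
  unfold IsSparse at h
  omega

/-- The sum of the first `k` numbers of a cell that packs numbers of `φ` bits. -/
def packSum (φ : ℕ) (f : ℕ → ℕ) (k : ℕ) : ℕ := ∑ r ∈ Finset.range k, f r % 2 ^ φ * 2 ^ (φ * r)

theorem packSum_lt (φ : ℕ) (f : ℕ → ℕ) (k : ℕ) : packSum φ f k < 2 ^ (φ * k) := by
  induction k with
  | zero => simp [packSum]
  | succ k ih =>
    unfold packSum at *
    rw [Finset.sum_range_succ, mul_add, pow_add, mul_one]
    have h1 : f k % 2 ^ φ + 1 ≤ 2 ^ φ := Nat.mod_lt _ (by positivity)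
    have h2 := Nat.mul_le_mul_left (2 ^ (φ * k)) h1
    rw [mul_add, mul_one, mul_comm (2 ^ (φ * k)) (f k % 2 ^ φ)] at h2
    omega

/-- The fields below `r` sum to less than `2 ^ (φ * r)`, and those above are multiples of `2 ^ (φ *
(r + 1))`. -/
theorem packSum_field {f : ℕ → ℕ} {r k : ℕ} (hr : r < k) :
    packSum φ f k >>> (φ * r) % 2 ^ φ = f r % 2 ^ φ := by
  induction k with
  | zero => omega
  | succ k ih =>
    have hs : packSum φ f (k + 1) = packSum φ f k + f k % 2 ^ φ * 2 ^ (φ * k) :=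
      Finset.sum_range_succ _ _
    rw [hs, Nat.shiftRight_eq_div_pow]
    rcases Nat.lt_succ_iff_lt_or_eq.mp hr with h | rfl
    · rw [← ih h, Nat.shiftRight_eq_div_pow]
      have : f k % 2 ^ φ * 2 ^ (φ * k) =
          2 ^ (φ * r) * (2 ^ φ * (f k % 2 ^ φ * 2 ^ (φ * (k - r - 1)))) := by
        have : φ * k = φ * r + φ + φ * (k - r - 1) := by
          obtain ⟨d, rfl⟩ := Nat.exists_eq_add_of_lt h
          rw [show r + d + 1 - r - 1 = d by omega]
          ring
        rw [this, pow_add, pow_add]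
        ring
      rw [this, Nat.add_mul_div_left _ _ (by positivity), Nat.add_mul_mod_self_left]
    · rw [Nat.add_mul_div_right _ _ (by positivity), Nat.div_eq_of_lt (packSum_lt ..), zero_add,
        Nat.mod_mod]

/-- The position of the `k`-th one among the `S` bits of `p`, the most significant one first. -/
noncomputable def patternSelect (S p k : ℕ) : ℕ :=
  Nat.nth (fun j => j < S ∧ p.testBit (S - 1 - j) = true) k

/-- Exactly `i - i₀` ones of the pattern precede the offset `x i - x i₀`, and a one stands there.
Bits after this offset have no influence, so `hp` does not constrain them. -/
theorem patternSelect_eq (hx : StrictMono x) {p i₀ i : ℕ} (hi : i₀ ≤ i) (hS : x i < x i₀ + S)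
    (hp : ∀ j ≤ x i - x i₀, p.testBit (S - 1 - j) = true ↔ ∃ k, x k = x i₀ + j) :
    patternSelect S p (i - i₀) = x i - x i₀ := by
  classical
  have h0 : x i₀ ≤ x i := hx.monotone hi
  have hcount : Nat.count (fun j => j < S ∧ p.testBit (S - 1 - j) = true) (x i - x i₀) = i - i₀ := by
    rw [Nat.count_eq_card_filter_range]
    have : (Finset.range (x i - x i₀)).filter (fun j => j < S ∧ p.testBit (S - 1 - j) = true) =
        (Finset.range (i - i₀)).image fun k => x (i₀ + k) - x i₀ := by
      ext j
      simp only [Finset.mem_filter, Finset.mem_range, Finset.mem_image]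
      constructor
      · rintro ⟨h1, h2, h3⟩
        obtain ⟨k, hk⟩ := (hp j (by omega)).mp h3
        have hk0 : i₀ ≤ k := hx.le_iff_le.mp (by omega)
        have hki : k < i := hx.lt_iff_lt.mp (by omega)
        refine ⟨k - i₀, by omega, ?_⟩
        rw [show i₀ + (k - i₀) = k by omega]
        omega
      · rintro ⟨k, hk, rfl⟩
        have h1 : x (i₀ + k) < x i := hx (by omega)
        have h2 : x i₀ ≤ x (i₀ + k) := hx.monotone (by omega)
        refine ⟨by omega, by omega, (hp _ (by omega)).mpr ⟨i₀ + k, by omega⟩⟩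
    rw [this, Finset.card_image_of_injOn, Finset.card_range]
    intro a _ b _ hab
    have h1 : x i₀ ≤ x (i₀ + a) := hx.monotone (by omega)
    have h2 : x i₀ ≤ x (i₀ + b) := hx.monotone (by omega)
    have := hx.injective (show x (i₀ + a) = x (i₀ + b) by simp only at hab; omega)
    omega
  unfold patternSelect
  rw [← hcount]
  exact Nat.nth_count ⟨by omega, (hp _ le_rfl).mpr ⟨i, by omega⟩⟩

end

/-- Position of the one of the `i`-th element in the bit vector, continued to all indices. -/
def onePosition (n m : ℕ) (A : List ℕ) (i : ℕ) : ℕ := if i < n then high m A i + i else 2 * n + i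

section

variable {n m : ℕ} {A : List ℕ}

/-- The continuation makes the last, incomplete group an ordinary one. It starts beyond all true
positions since high-order parts are below `2 * n`. -/
theorem onePosition_strictMono (hA : IsSortedList n m A) : StrictMono (onePosition n m A) := by
  intro i j hij
  unfold onePosition
  split_ifs with h1 h2 h2
  · have := high_mono hA hij.le h2
    omega
  · have := high_lt hA h1
    omega
  · omega
  · omega

theorem onePosition_lt (hA : IsSortedList n m A) {i : ℕ} (hi : i < n) :
    onePosition n m A i < 3 * n := by
  have := high_lt hA hi
  rw [onePosition, if_pos hi]
  omega

end

end EliasFano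

/-! ### Layout and size of the select table -/

namespace EliasFano

/-- The number of bits of the packed fields of the select structure. -/
def fieldWidth (n : ℕ) : ℕ := 4 * (Nat.log 2 (Nat.clog 2 n) + 1)

/-- The lists for which the select structure has the asymptotic form. -/
def IsLarge (n : ℕ) : Prop := fieldWidth n ^ 4 + fieldWidth n + 1 ≤ Nat.clog 2 n

instance (n : ℕ) : Decidable (IsLarge n) := inferInstanceAs (Decidable (_ ≤ _))

/-- Field of the directory of groups: start relative to the start of the surrounding larger group,
or flag for sparse groups. -/
noncomputable def groupField (x : ℕ → ℕ) (M G S r : ℕ) : ℕ :=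
  if r % 2 = 0 then x (r / 2 * G) - x (r / 2 * G / M * M)
  else if IsSparse x G S (r / 2) then 1 else 0

/-- Field of the directory of the sparse groups. -/
noncomputable def sparseField (x : ℕ → ℕ) (M G S t : ℕ) : ℕ :=
  x (sparseGroup x G S (t / G) * G + t % G) - x (sparseGroup x G S (t / G) * G / M * M)

/-- The sequences that are interleaved in the select structure. -/
noncomputable def stream (L φ q : ℕ) (x : ℕ → ℕ) : ℕ → ℕ → ℕ
  | 1, _ => q
  | 2, _ => φ
  | 3, _ => L / φ
  | 4, _ => φ ^ 2
  | 5, _ => φ ^ 4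
  | 6, _ => L * φ ^ 2
  | 7, _ => L ^ 3
  | 8, s => x (s * (L * φ ^ 2)) / 4
  | 9, s => x (s * (L * φ ^ 2)) % 4
  | 10, s => if IsSparse x (L * φ ^ 2) (L ^ 3) s then 1 else 0
  | 11, t => x (sparseGroup x (L * φ ^ 2) (L ^ 3) (t / (L * φ ^ 2)) * (L * φ ^ 2) +
      t % (L * φ ^ 2)) / 4
  | 12, t => x (sparseGroup x (L * φ ^ 2) (L ^ 3) (t / (L * φ ^ 2)) * (L * φ ^ 2) +
      t % (L * φ ^ 2)) % 4
  | 13, c => packSum φ (fun r => groupField x (L * φ ^ 2) (φ ^ 2) (φ ^ 4) (c * (L / φ) + r)) (L / φ)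
  | 14, c => packSum φ (fun r => sparseField x (L * φ ^ 2) (φ ^ 2) (φ ^ 4) (c * (L / φ) + r)) (L / φ)
  | 15, t => patternSelect (φ ^ 4) (t / φ ^ 2) (t % φ ^ 2)
  | _, _ => 0

/-- An upper bound for the lengths of the sequences. -/
def streamLength (L φ n : ℕ) : ℕ :=
  (n / (L * φ ^ 2) + 1) + (3 * n / L ^ 3 + 1) * (L * φ ^ 2) + (2 * (n / φ ^ 2 + 1) / (L / φ) + 1) +
    ((3 * n / φ ^ 4 + 1) * φ ^ 2 / (L / φ) + 1) + 2 ^ φ ^ 4 * φ ^ 2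

/-- The select structure of long lists. -/
noncomputable def selectTable (n q : ℕ) (x : ℕ → ℕ) : List ℕ :=
  (List.range (16 * streamLength (Nat.clog 2 n) (fieldWidth n) n)).map fun a =>
    stream (Nat.clog 2 n) (fieldWidth n) q x (a % 16) (a / 16) % 2 ^ Nat.clog 2 n

/-- The select structure of short lists. -/
def plainTable (n q : ℕ) (x : ℕ → ℕ) : List ℕ :=
  (List.range (2 * n + 1)).map fun a =>
    if a = 0 then q else if a % 2 = 1 then x (a / 2) / 4 else x (a / 2 - 1) % 4

/-- The number of bits of the select structure. -/
def auxBits (n : ℕ) : ℕ :=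
  (if IsLarge n then 16 * streamLength (Nat.clog 2 n) (fieldWidth n) n else 2 * n + 1) * Nat.clog 2 n

theorem getD_map_range (f : ℕ → ℕ) {N a : ℕ} (h : a < N) :
    ((List.range N).map f).getD a 0 = f a := by
  rw [List.getD_eq_getElem _ _ (by simpa using h)]
  simp

theorem selectTable_getD {n q j t : ℕ} {x : ℕ → ℕ} (hj : j < 16)
    (ht : t < streamLength (Nat.clog 2 n) (fieldWidth n) n)
    (h : stream (Nat.clog 2 n) (fieldWidth n) q x j t < 2 ^ Nat.clog 2 n) :
    (selectTable n q x).getD (16 * t + j) 0 = stream (Nat.clog 2 n) (fieldWidth n) q x j t := by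
  rw [selectTable, getD_map_range _ (by omega), show (16 * t + j) % 16 = j by omega,
    show (16 * t + j) / 16 = t by omega, Nat.mod_eq_of_lt h]

/-- The inequalities between the parameters of the select structure. -/
structure Sizes (n L φ : ℕ) : Prop where
  four_le : 4 ≤ φ
  large : φ ^ 4 + φ + 1 ≤ L
  pow_lt : L ^ 4 < 2 ^ φ
  le : n ≤ 2 ^ L
  lt : 2 ^ (L - 1) < n

/-- The factor 4 in `fieldWidth` yields `L ^ 4 < 2 ^ φ`: fields of `φ` bits can hold differences
below `L ^ 3`, with a factor to spare for the size estimates. -/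
theorem sizes {n : ℕ} (hn : 2 ≤ n) (h : IsLarge n) : Sizes n (Nat.clog 2 n) (fieldWidth n) where
  four_le := by unfold fieldWidth; omega
  large := h
  pow_lt := by
    have h1 := Nat.lt_pow_succ_log_self (b := 2) (by norm_num) (Nat.clog 2 n)
    rw [fieldWidth, mul_comm, pow_mul]
    exact Nat.pow_lt_pow_left h1 (by norm_num)
  le := Nat.le_pow_clog (by norm_num) n
  lt := Nat.pow_pred_clog_lt_self (by norm_num) hn

namespace Sizes

variable {n L φ : ℕ}

/-- From `φ^4 + φ ≤ L - 1`: the number of patterns of `φ^4` bits is smaller than `n` by the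
polylogarithmic factor `L ^ 4`. -/
theorem pow_mul_le (h : Sizes n L φ) : 2 ^ φ ^ 4 * L ^ 4 ≤ n := by
  have h1 : 2 ^ φ ^ 4 * 2 ^ φ ≤ 2 ^ (L - 1) := by
    rw [← pow_add]
    exact Nat.pow_le_pow_right (by norm_num) (by have := h.large; omega)
  exact (Nat.mul_le_mul_left _ h.pow_lt.le).trans (h1.trans h.lt.le)

theorem pow_le (h : Sizes n L φ) : L ^ 4 ≤ n := by
  have h1 : 1 ≤ 2 ^ φ ^ 4 := Nat.one_le_two_pow
  have h2 := h.pow_mul_le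
  nlinarith

theorem pow_lt_two_pow (h : Sizes n L φ) : L ^ 4 < 2 ^ L :=
  h.pow_lt.trans_le (Nat.pow_le_pow_right (by norm_num) (by
    have := h.large
    have := Nat.zero_le (φ ^ 4)
    omega))

theorem cube_le (h : Sizes n L φ) : φ ^ 3 ≤ L :=
  (Nat.pow_le_pow_right (by have := h.four_le; omega) (show 3 ≤ 4 by norm_num)).trans
    (by have := h.large; omega)

theorem le_div_mul (h : Sizes n L φ) : L ≤ 2 * (L / φ * φ) := by
  have h1 := h.four_le
  have h2 := Nat.lt_mul_div_succ L (show 0 < φ by omega)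
  have h3 : 1 ≤ L / φ := (Nat.one_le_div_iff (by omega)).mpr (by have := h.large; omega)
  nlinarith

theorem lower (h : Sizes n L φ) : 260 ≤ L := by
  have h1 := Nat.pow_le_pow_left h.four_le 4
  have := h.large
  have := h.four_le
  omega

/-- Rounding `L / φ` down wastes at most half of a cell, so `Q` packed fields take at most `2 * φ *
Q` bits apart from one incomplete cell. Both sides carry a further factor `φ`, the gain to be shown.
-/
theorem packed_le (h : Sizes n L φ) (Q : ℕ) : (Q / (L / φ) + 1) * (L * φ) ≤ Q * (2 * φ ^ 2) + n := by
  have h1 := h.le_div_mul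
  have h2 := Nat.div_mul_le_self Q (L / φ)
  have h3 : L * φ ≤ n := by
    have h4 := h.pow_le
    have h5 := h.large
    have h6 := h.lower
    have : φ ≤ L := by have := Nat.zero_le (φ ^ 4); omega
    calc L * φ ≤ L * L := Nat.mul_le_mul_left _ this
      _ = L ^ 2 := by ring
      _ ≤ L ^ 4 := Nat.pow_le_pow_right (by omega) (by norm_num)
      _ ≤ n := h4
  calc (Q / (L / φ) + 1) * (L * φ) = Q / (L / φ) * (L * φ) + L * φ := by ring
    _ ≤ Q / (L / φ) * (2 * (L / φ * φ) * φ) + n :=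
      add_le_add (Nat.mul_le_mul_left _ (Nat.mul_le_mul_right _ h1)) h3
    _ = Q / (L / φ) * (L / φ) * (2 * φ ^ 2) + n := by ring
    _ ≤ _ := by gcongr

/-- The five kinds of entries are, in this order: starts of large groups, answers for sparse large
groups (at most one such group in each block of `L^3` positions), the packed directory of small
groups, packed answers for sparse small groups, and patterns. Multiplied by `L * φ` they contribute
`2n`, `4n`, `9n`, `9n` and `n`. -/
theorem streamLength_mul_le (h : Sizes n L φ) : streamLength L φ n * (L * φ) ≤ 25 * n := by
  have h4 := h.four_le
  have hL := h.lower
  have hn := h.pow_le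
  have hcube := h.cube_le
  have hLL : L ^ 3 ≤ n := (Nat.pow_le_pow_right (by omega) (by norm_num)).trans hn
  have hLL2 : L ^ 2 ≤ n := (Nat.pow_le_pow_right (by omega) (by norm_num)).trans hn
  have hφ : φ ≤ L := by
    have := h.large
    have := Nat.zero_le (φ ^ 4)
    omega
  have hφ4 : φ ^ 4 ≤ L := by have := h.large; omega
  have hLn : L ≤ n := (Nat.le_self_pow (by norm_num) L).trans hn
  have e1 : (n / (L * φ ^ 2) + 1) * (L * φ) ≤ 2 * n := by
    have h1 := Nat.div_mul_le_self n (L * φ ^ 2)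
    have h2 : L * φ ≤ L * φ ^ 2 := Nat.mul_le_mul_left _ (Nat.le_self_pow (by norm_num) φ)
    have h3 := Nat.mul_le_mul_left (n / (L * φ ^ 2)) h2
    have h5 : L * φ ≤ L ^ 2 := by rw [pow_two]; exact Nat.mul_le_mul_left _ hφ
    rw [add_mul, one_mul]
    omega
  have e2 : (3 * n / L ^ 3 + 1) * (L * φ ^ 2) * (L * φ) ≤ 4 * n := by
    have h1 := Nat.div_mul_le_self (3 * n) (L ^ 3)
    calc _ = (3 * n / L ^ 3 + 1) * (L ^ 2 * φ ^ 3) := by ring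
      _ ≤ (3 * n / L ^ 3 + 1) * (L ^ 2 * L) := by gcongr
      _ = 3 * n / L ^ 3 * L ^ 3 + L ^ 3 := by ring
      _ ≤ _ := by omega
  have e3 := h.packed_le (2 * (n / φ ^ 2 + 1))
  have e3' : 2 * (n / φ ^ 2 + 1) * (2 * φ ^ 2) ≤ 8 * n := by
    have h1 := Nat.div_mul_le_self n (φ ^ 2)
    have h2 : φ ^ 2 ≤ φ ^ 4 := Nat.pow_le_pow_right (by omega) (by norm_num)
    calc _ = 4 * (n / φ ^ 2 * φ ^ 2) + 4 * φ ^ 2 := by ring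
      _ ≤ _ := by omega
  have e4 := h.packed_le ((3 * n / φ ^ 4 + 1) * φ ^ 2)
  have e4' : (3 * n / φ ^ 4 + 1) * φ ^ 2 * (2 * φ ^ 2) ≤ 8 * n := by
    have h1 := Nat.div_mul_le_self (3 * n) (φ ^ 4)
    calc _ = 2 * (3 * n / φ ^ 4 * φ ^ 4) + 2 * φ ^ 4 := by ring
      _ ≤ _ := by omega
  have e5 : 2 ^ φ ^ 4 * φ ^ 2 * (L * φ) ≤ n := by
    calc _ = 2 ^ φ ^ 4 * (φ ^ 3 * L) := by ring
      _ ≤ 2 ^ φ ^ 4 * (L * L) := by gcongr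
      _ = 2 ^ φ ^ 4 * L ^ 2 := by ring
      _ ≤ 2 ^ φ ^ 4 * L ^ 4 := by gcongr <;> omega
      _ ≤ n := h.pow_mul_le
  unfold streamLength
  rw [add_mul, add_mul, add_mul, add_mul]
  omega

/-- As `16 * 25 = 400 ≤ L * φ`, the table has at most `n` cells, so its addresses fit into words. -/
theorem streamLength_le (h : Sizes n L φ) : 16 * streamLength L φ n ≤ n := by
  have h1 := h.streamLength_mul_le
  have h2 : 400 ≤ L * φ := by
    calc 400 ≤ 260 * 4 := by norm_num
      _ ≤ L * φ := Nat.mul_le_mul h.lower h.four_le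
  have h3 := Nat.mul_le_mul_left (streamLength L φ n) h2
  omega

end Sizes

theorem le_log_clog {c n : ℕ} (h : 2 ^ 2 ^ c ≤ n) : c ≤ Nat.log 2 (Nat.clog 2 n) := by
  have h1 : 2 ^ c ≤ Nat.clog 2 n := by
    have h2 := h.trans (Nat.le_pow_clog (b := 2) (by norm_num) n)
    exact (Nat.pow_le_pow_iff_right (by norm_num)).mp h2
  exact Nat.le_log_of_pow_le (by norm_num) h1

theorem eventually_le_log_clog (c : ℕ) :
    ∀ᶠ n in Filter.atTop, c ≤ Nat.log 2 (Nat.clog 2 n) :=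
  (Filter.eventually_ge_atTop (2 ^ 2 ^ c)).mono fun _ h => le_log_clog h

theorem mul_pow_four_le {k : ℕ} (hk : 30 ≤ k) : 300 * (k + 1) ^ 4 ≤ 2 ^ k := by
  induction k, hk using Nat.le_induction with
  | base => norm_num
  | succ k hk ih =>
    have h1 : (k + 1 + 1) ^ 4 ≤ 2 * (k + 1) ^ 4 := by
      have hy : 31 ≤ k + 1 := by omega
      generalize k + 1 = y at *
      have h2 : 31 * y ≤ y ^ 2 := by rw [pow_two]; exact Nat.mul_le_mul_right _ hy
      have h3 : 31 * y ^ 2 ≤ y ^ 3 := by rw [pow_succ' y 2]; exact Nat.mul_le_mul_right _ hy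
      have h4 : 31 * y ^ 3 ≤ y ^ 4 := by rw [pow_succ' y 3]; exact Nat.mul_le_mul_right _ hy
      have : (y + 1) ^ 4 = y ^ 4 + 4 * y ^ 3 + 6 * y ^ 2 + 4 * y + 1 := by ring
      omega
    rw [pow_succ 2 k]
    omega

/-- With `φ = 4 y` the condition needs `256 * y ^ 4` and lower terms; the constant 300 absorbs the
latter. -/
theorem isLarge_of_le {n : ℕ} (h : 30 ≤ Nat.log 2 (Nat.clog 2 n)) : IsLarge n := by
  have h1 := mul_pow_four_le h
  have h2 : 2 ^ Nat.log 2 (Nat.clog 2 n) ≤ Nat.clog 2 n :=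
    Nat.pow_log_le_self 2 fun h0 => by simp [h0] at h
  unfold IsLarge fieldWidth
  have hy : 1 ≤ Nat.log 2 (Nat.clog 2 n) + 1 := by omega
  generalize Nat.log 2 (Nat.clog 2 n) + 1 = y at *
  have h3 : y ≤ y ^ 4 := Nat.le_self_pow (by norm_num) y
  have h4 : (4 * y) ^ 4 = 256 * y ^ 4 := by ring
  omega

/-- The number of bits times `φ` is at most `400 * n`, and `φ` tends to infinity. Lists that are not
large occur for finitely many `n` only. -/
theorem auxBits_isLittleO : (fun n => (auxBits n : ℝ)) =o[Filter.atTop] fun n : ℕ => (n : ℝ) := by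
  rw [Asymptotics.isLittleO_iff]
  intro ε hε
  obtain ⟨c, hc⟩ := exists_nat_gt (400 / ε)
  filter_upwards [eventually_le_log_clog 30, eventually_le_log_clog c,
    Filter.eventually_ge_atTop 2] with n h30 hcn hn
  have hlarge := isLarge_of_le h30
  have h1 := (sizes hn hlarge).streamLength_mul_le
  have h2 : c ≤ fieldWidth n := by unfold fieldWidth; omega
  rw [auxBits, if_pos hlarge, Real.norm_natCast, Real.norm_natCast]
  have h3 : 16 * streamLength (Nat.clog 2 n) (fieldWidth n) n * Nat.clog 2 n * c ≤ 400 * n := by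
    calc _ ≤ 16 * streamLength (Nat.clog 2 n) (fieldWidth n) n * Nat.clog 2 n * fieldWidth n := by
          gcongr
      _ = 16 * (streamLength (Nat.clog 2 n) (fieldWidth n) n * (Nat.clog 2 n * fieldWidth n)) := by
          ring
      _ ≤ _ := by omega
  generalize 16 * streamLength (Nat.clog 2 n) (fieldWidth n) n * Nat.clog 2 n = a at *
  have h4 : (a : ℝ) * c ≤ 400 * n := by exact_mod_cast h3
  rw [div_lt_iff₀ hε] at hc
  have hc0 : (0 : ℝ) < c := by
    by_contra h
    have : (c : ℝ) * ε ≤ 0 := mul_nonpos_of_nonpos_of_nonneg (by linarith) hε.le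
    linarith
  have h5 : 400 * (n : ℝ) ≤ c * ε * n := mul_le_mul_of_nonneg_right hc.le (by positivity)
  have h6 : (a : ℝ) * c ≤ ε * n * c := by linarith
  exact le_of_mul_le_mul_right h6 hc0

end EliasFano

namespace WordRAM

open EliasFano

/-! ### Access -/

/-- A parameter in the header of the table. -/
def paramE (j : ℕ) : Expr := .look (.lit j)

/-- An element of the `j`-th of 16 interleaved sequences. -/
def streamE (j : ℕ) (e : Expr) : Expr :=
  .look (.bin .add (.bin .mul (.lit 16) e) (.lit j))

/-- A number that is stored in two parts. -/
def pairE (e f : Expr) : Expr := .bin .add (.bin .mul e (.lit 4)) f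

/-- A field of a packed sequence. -/
def packedE (j : ℕ) (e : Expr) : Expr :=
  (Expr.bin .shr (streamE j (.bin .div e (paramE 3)))
    (.bin .mul (paramE 2) (.bin .mod e (paramE 3)))).low (paramE 2)

/-- The index `⌊e / f⌋ g + (i mod g)`, where variable `3` holds `i`. -/
def slotE (e f g : Expr) : Expr :=
  .bin .add (.bin .mul (.bin .div e f) g) (.bin .mod (.var 3) g)

/-- Position of the first one of the large group. -/
def startE : Expr :=
  pairE (streamE 8 (.bin .div (.var 3) (paramE 6))) (streamE 9 (.bin .div (.var 3) (paramE 6)))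

/-- Position of the first one of the small group. -/
def offsetE : Expr :=
  .bin .add startE (packedE 13 (.bin .mul (.lit 2) (.bin .div (.var 3) (paramE 4))))

/-- The number of low-order bits. -/
def lowE : Expr := .bin .sub (.var 2) (.cond (paramE 0) (paramE 0) (paramE 1))

/-- The part of the bit vector that starts with the small group. -/
def patternE : Expr :=
  getViewE (.var 2) (.var 2) (.lit 0) (.bin .add (.bin .mul (.var 0) lowE) offsetE) (paramE 5)

/-- The position of the one with the index in variable `3`, from the table of a long list. -/
def largePositionE : Expr :=
  .cond (streamE 10 (.bin .div (.var 3) (paramE 6)))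
    (pairE (streamE 11 (slotE startE (paramE 7) (paramE 6)))
      (streamE 12 (slotE startE (paramE 7) (paramE 6))))
    (.cond (packedE 13 (.bin .add (.bin .mul (.lit 2) (.bin .div (.var 3) (paramE 4))) (.lit 1)))
      (.bin .add startE (packedE 14 (slotE offsetE (paramE 5) (paramE 4))))
      (.bin .add offsetE (streamE 15 (.bin .add (.bin .mul patternE (paramE 4))
        (.bin .mod (.var 3) (paramE 4))))))

/-- The position of the one with the index in variable `3`. -/
def positionE : Expr :=
  .cond (paramE 0)
    (pairE (.look (.bin .add (.bin .mul (.lit 2) (.var 3)) (.lit 1)))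
      (.look (.bin .add (.bin .mul (.lit 2) (.var 3)) (.lit 2))))
    largePositionE

/-- The element with the index in variable `3`. -/
def accessE : Expr :=
  .bin .add (.bin .shl (.bin .sub positionE (.var 3)) lowE)
    (getViewE (.var 2) (.var 2) (.lit 0) (.bin .mul (.var 3) lowE) lowE)

/-- The program for access. -/
def access : Cmd := assign 0 accessE

section

variable {w b : ℕ} {s : State} {n L φ q : ℕ} {x : ℕ → ℕ}

/-- Positions range up to `3 * n` and may exceed a cell of `⌈lg n⌉` bits; their quotient and
remainder by 4 fit. -/
theorem Ev.pair {e f : Expr} {y : ℕ} (h : Ev w s e (y / 4)) (h' : Ev w s f (y % 4))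
    (hy : y < 2 ^ w) (h4 : 4 < 2 ^ w) : Ev w s (pairE e f) y :=
  (Ev.add (Ev.mul h (Ev.lit h4) (by omega)) h' (by omega)).congr (by omega)

theorem Ev.stream {j t v : ℕ} {e : Expr} (ht : Ev w s e t) (hj : j < 16) (h16 : 16 < 2 ^ w)
    (hw : 16 * t + 16 ≤ 2 ^ w) (h : s.table.getD (16 * t + j) 0 = v) :
    Ev w s (streamE j e) v := by
  rw [← h]
  exact Ev.look (Ev.add (Ev.mul (Ev.lit h16) ht (by omega)) (Ev.lit (by omega)) (by omega))

theorem lt_add_five {a b c d e t : ℕ} (h : t < a ∨ t < b ∨ t < c ∨ t < d ∨ t < e) :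
    t < a + b + c + d + e := by omega

/-- The bit vector enters only through `hpat`, which provides the `φ^4` bits from the start of the
small group on, and these need to be right only up to position `x i`. -/
theorem Ev.largePosition (hS : Sizes n L φ) (hx : StrictMono x) (hwf : WF w b s)
    (hw : 4 * n ≤ 2 ^ w) (hq : q < 2 ^ L)
    (hlook : ∀ j < 16, ∀ t < streamLength L φ n, EliasFano.stream L φ q x j t < 2 ^ L →
      s.table.getD (16 * t + j) 0 = EliasFano.stream L φ q x j t)
    {i : ℕ} (hi : i < n) (h3 : s.reg 3 = i) (hxi : x i < 3 * n)
    (hpat : ∀ v, v ≤ x i → x i < v + φ ^ 4 → Ev w s offsetE v → Ev w s (paramE 5) (φ ^ 4) →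
      Ev w s (paramE 1) q →
      ∃ p, p < 2 ^ φ ^ 4 ∧ Ev w s patternE p ∧
        ∀ j ≤ x i - v, p.testBit (φ ^ 4 - 1 - j) = true ↔ ∃ k, x k = v + j) :
    Ev w s largePositionE (x i) := by
  have hL := hS.lower
  have h4 := hS.four_le
  have hlarge := hS.large
  have hL4 := hS.pow_lt_two_pow
  have hn4 := hS.pow_le
  have hT := hS.streamLength_le
  have hn := hS.le
  have hpow : ∀ k, k ≤ 4 → L ^ k < 2 ^ L := fun k hk =>
    (Nat.pow_le_pow_right (by omega) hk).trans_lt hL4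
  have hL3 : L ^ 3 < 2 ^ L := hpow 3 (by norm_num)
  have hφL : φ ^ 2 ≤ L := (Nat.pow_le_pow_right (by omega) (show 2 ≤ 4 by norm_num)).trans
    (by omega)
  have hML : L * φ ^ 2 < 2 ^ L := by
    have := hpow 2 (by norm_num)
    have := Nat.mul_le_mul_left L hφL
    rw [pow_two] at *
    omega
  have hLL := hpow 1 (by norm_num)
  rw [pow_one] at hLL
  have hK1 : 1 ≤ L / φ := (Nat.one_le_div_iff (by omega)).mpr (by omega)
  have hKL : L / φ ≤ L := Nat.div_le_self _ _
  have hφK : φ * (L / φ) ≤ L := Nat.mul_div_le _ _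
  -- Hence a difference within a large group that is not sparse survives the reduction to `φ` bits.
  -- Fields of sparse large groups may be truncated, but they are not used.
  have hXφ : L ^ 3 ≤ 2 ^ φ :=
    (Nat.pow_le_pow_right (by omega) (by norm_num)).trans hS.pow_lt.le
  have hGM : L * φ ^ 2 / φ ^ 2 * φ ^ 2 = L * φ ^ 2 := by
    rw [Nat.mul_div_cancel _ (by positivity)]
  have hnL : L ≤ n := (Nat.le_self_pow (by norm_num) L).trans hn4
  have hpos : 0 < streamLength L φ n := lt_add_five (Or.inl (Nat.succ_pos _))
  have hstr := fun j hj t (ht : t < streamLength L φ n) h e (he : Ev w s e t) =>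
    Ev.stream he hj (by omega) (by omega) (hlook j hj t ht h)
  have hpar := fun j (hj : j < 16) (h : EliasFano.stream L φ q x j 0 < 2 ^ L) =>
    (Ev.look (Ev.lit (w := w) (s := s) (x := j) (by omega))).congr
      (show s.table.getD j 0 = _ by simpa using hlook j hj 0 hpos h)
  have p1 : Ev w s (paramE 1) q := hpar 1 (by omega) hq
  have p2 : Ev w s (paramE 2) φ := hpar 2 (by omega) (by show φ < _; omega)
  have p3 : Ev w s (paramE 3) (L / φ) := hpar 3 (by omega) (by show L / φ < _; omega)
  have p4 : Ev w s (paramE 4) (φ ^ 2) := hpar 4 (by omega) (by show φ ^ 2 < _; omega)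
  have p5 : Ev w s (paramE 5) (φ ^ 4) := hpar 5 (by omega) (by show φ ^ 4 < _; omega)
  have p6 : Ev w s (paramE 6) (L * φ ^ 2) := hpar 6 (by omega) hML
  have p7 : Ev w s (paramE 7) (L ^ 3) := hpar 7 (by omega) hL3
  have v3 : Ev w s (.var 3) i := Ev.var' h3
  -- the lengths of the sequences
  have t1 : i / (L * φ ^ 2) < streamLength L φ n := by
    exact lt_add_five (Or.inl (Nat.lt_succ_of_le (Nat.div_le_div_right hi.le)))
  have t2 : ∀ z ≤ 3 * n / L ^ 3, z * (L * φ ^ 2) + i % (L * φ ^ 2) < streamLength L φ n := by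
    intro z hz
    have h1 := Nat.mul_le_mul_right (L * φ ^ 2) (Nat.succ_le_succ hz)
    have h2 := Nat.mod_lt i (show 0 < L * φ ^ 2 by positivity)
    rw [Nat.succ_mul, Nat.succ_eq_add_one] at h1
    exact lt_add_five (Or.inr (Or.inl (by omega)))
  have t3 : ∀ r ≤ 2 * (i / φ ^ 2) + 1, r / (L / φ) < streamLength L φ n := by
    intro r hr
    have h1 := Nat.div_le_div_right (c := φ ^ 2) hi.le
    exact lt_add_five (Or.inr (Or.inr (Or.inl (Nat.lt_succ_of_le
      (Nat.div_le_div_right (show r ≤ 2 * (n / φ ^ 2 + 1) by omega))))))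
  have t4' : ∀ z ≤ 3 * n / φ ^ 4, z * φ ^ 2 + i % φ ^ 2 ≤ (3 * n / φ ^ 4 + 1) * φ ^ 2 := by
    intro z hz
    have h1 := Nat.mul_le_mul_right (φ ^ 2) (Nat.succ_le_succ hz)
    have h2 := Nat.mod_lt i (show 0 < φ ^ 2 by positivity)
    rw [Nat.succ_mul, Nat.succ_eq_add_one] at h1
    omega
  have t4 : ∀ z ≤ 3 * n / φ ^ 4, (z * φ ^ 2 + i % φ ^ 2) / (L / φ) < streamLength L φ n := by
    intro z hz
    exact lt_add_five (Or.inr (Or.inr (Or.inr (Or.inl (Nat.lt_succ_of_le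
      (Nat.div_le_div_right (t4' z hz)))))))
  have t5 : ∀ p < 2 ^ φ ^ 4, p * φ ^ 2 + i % φ ^ 2 < streamLength L φ n := by
    intro p hp
    have h1 := Nat.mul_le_mul_right (φ ^ 2) (Nat.succ_le_of_lt hp)
    have h2 := Nat.mod_lt i (show 0 < φ ^ 2 by positivity)
    rw [Nat.succ_mul] at h1
    exact lt_add_five (Or.inr (Or.inr (Or.inr (Or.inr (by omega)))))
  -- Field `r` of a packed sequence stands in cell `r / (L / φ)` at place `r % (L / φ)`.
  have hpacked : ∀ j < 16, ∀ f : ℕ → ℕ, ∀ r e, Ev w s e r → r / (L / φ) < streamLength L φ n →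
      EliasFano.stream L φ q x j (r / (L / φ)) =
        packSum φ (fun k => f (r / (L / φ) * (L / φ) + k)) (L / φ) →
      Ev w s (packedE j e) (f r % 2 ^ φ) := by
    intro j hj f r e he hr h
    have h1 := packSum_lt φ (fun k => f (r / (L / φ) * (L / φ) + k)) (L / φ)
    have h2 := h1.trans_le (Nat.pow_le_pow_right (by norm_num) hφK)
    have hm := Nat.mod_lt r hK1
    have h3 := Nat.mul_le_mul_left φ hm.le
    have e1 := Ev.low hwf (Ev.shr hwf (hstr j hj _ hr (by rw [h]; exact h2) _ (Ev.div hwf he p3))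
      (Ev.mul p2 (Ev.mod hwf he p3) (by omega))) p2
    rw [h, packSum_field hm] at e1
    refine e1.congr ?_
    rw [Nat.div_add_mod']
  -- the large group
  set M := L * φ ^ 2 with hM
  have hM0 : 0 < M := by positivity
  have hPi : x (i / M * M) ≤ x i := hx.monotone (Nat.div_mul_le_self _ _)
  set P := x (i / M * M) with hP
  have hg := Ev.div hwf v3 p6
  have eP : Ev w s startE P :=
    Ev.pair (hstr 8 (by omega) _ t1 (by show P / 4 < _; omega) _ hg)
      (hstr 9 (by omega) _ t1 (by show P % 4 < _; omega) _ hg) (by omega) (by omega)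
  have hc1 : EliasFano.stream L φ q x 10 (i / M) = if IsSparse x M (L ^ 3) (i / M) then 1 else 0 := by
    rw [EliasFano.stream]
  have e10 := hstr 10 (by omega) _ t1 (by rw [hc1]; split_ifs <;> omega) _ hg
  rw [hc1] at e10
  refine Ev.cond e10 (fun h => ?_) fun h => ?_
  -- Sparse large group: the answer is stored explicitly, in the slot of the block where the group
  -- starts.
  · have hsp : IsSparse x M (L ^ 3) (i / M) := by by_contra h'; simp [h'] at h
    have hz := sparseGroup_eq hx (by positivity) hsp
    have hzle : P / L ^ 3 ≤ 3 * n / L ^ 3 := Nat.div_le_div_right (by omega)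
    have ht := t2 _ hzle
    have hidx : x (sparseGroup x M (L ^ 3) ((P / L ^ 3 * M + i % M) / M) * M +
        (P / L ^ 3 * M + i % M) % M) = x i := by
      rw [cell_add_div (Nat.mod_lt _ hM0), cell_add_mod (Nat.mod_lt _ hM0), hP, hz,
        Nat.div_add_mod']
    have et : Ev w s (slotE startE (paramE 7) (paramE 6)) (P / L ^ 3 * M + i % M) :=
      Ev.add (Ev.mul (Ev.div hwf eP p7) p6 (by omega)) (Ev.mod hwf v3 p6) (by omega)
    have e11 := hstr 11 (by omega) _ ht
    have e12 := hstr 12 (by omega) _ ht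
    simp only [EliasFano.stream, ← hM, hidx] at e11 e12
    exact Ev.pair (e11 (by omega) _ et) (e12 (by omega) _ et) (by omega) (by omega)
  have hsp : ¬ IsSparse x M (L ^ 3) (i / M) := by intro h'; simp [h'] at h
  have hiP := lt_of_not_isSparse hx hM0 hsp
  rw [← hP] at hiP
  -- the small group
  have hG0 : 0 < φ ^ 2 := by positivity
  have hgi : i / φ ^ 2 * φ ^ 2 ≤ i := Nat.div_mul_le_self _ _
  -- Small groups are nested in large ones, because `M` is a multiple of `φ ^ 2`.
  have hgM : i / φ ^ 2 * φ ^ 2 / M = i / M := by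
    rw [hM, mul_comm L, ← Nat.div_div_eq_div_mul, ← Nat.div_div_eq_div_mul,
      Nat.mul_div_cancel _ hG0]
  have hPo : P ≤ x (i / φ ^ 2 * φ ^ 2) := by
    rw [hP, ← hgM]
    exact hx.monotone (Nat.div_mul_le_self _ _)
  have hoi : x (i / φ ^ 2 * φ ^ 2) ≤ x i := hx.monotone hgi
  have hdl : i / φ ^ 2 ≤ i := Nat.div_le_self _ _
  set o := x (i / φ ^ 2 * φ ^ 2) with ho
  have hdl2 : 2 * (i / φ ^ 2) + 1 ≤ 2 * i + 1 := by omega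
  have er : Ev w s (.bin .mul (.lit 2) (.bin .div (.var 3) (paramE 4))) (2 * (i / φ ^ 2)) :=
    Ev.mul (Ev.lit (by omega)) (Ev.div hwf v3 p4) (by omega)
  have er1 := Ev.add er (Ev.lit (x := 1) (by omega)) (by omega)
  have f0 : groupField x M (φ ^ 2) (φ ^ 4) (2 * (i / φ ^ 2)) = o - P := by
    rw [groupField, if_pos (by omega), show 2 * (i / φ ^ 2) / 2 = i / φ ^ 2 by omega, hgM]
  have f1 : groupField x M (φ ^ 2) (φ ^ 4) (2 * (i / φ ^ 2) + 1) =
      if IsSparse x (φ ^ 2) (φ ^ 4) (i / φ ^ 2) then 1 else 0 := by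
    rw [groupField, if_neg (by omega), show (2 * (i / φ ^ 2) + 1) / 2 = i / φ ^ 2 by omega]
  have eo : Ev w s offsetE o := by
    have e1 := hpacked 13 (by omega) (groupField x M (φ ^ 2) (φ ^ 4)) _ _ er (t3 _ (by omega))
      (by rw [EliasFano.stream])
    rw [f0, Nat.mod_eq_of_lt (by omega)] at e1
    exact (Ev.add eP e1 (by omega)).congr (by omega)
  have ef := hpacked 13 (by omega) (groupField x M (φ ^ 2) (φ ^ 4)) _ _ er1 (t3 _ (by omega))
    (by rw [EliasFano.stream])
  have h2φ : 1 < 2 ^ φ := Nat.one_lt_two_pow (by omega)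
  rw [f1, Nat.mod_eq_of_lt (by split_ifs <;> omega)] at ef
  refine Ev.cond ef (fun h => ?_) fun h => ?_
  -- Sparse small group: the stored answer is relative to the start `P` of the large group.
  · have hsp : IsSparse x (φ ^ 2) (φ ^ 4) (i / φ ^ 2) := by by_contra h'; simp [h'] at h
    have hz := sparseGroup_eq hx (by positivity) hsp
    rw [← ho] at hz
    have hzle : o / φ ^ 4 ≤ 3 * n / φ ^ 4 := Nat.div_le_div_right (by omega)
    have ht := t4 _ hzle
    have f2 : sparseField x M (φ ^ 2) (φ ^ 4) (o / φ ^ 4 * φ ^ 2 + i % φ ^ 2) = x i - P := by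
      rw [sparseField, cell_add_div (Nat.mod_lt _ hG0), cell_add_mod (Nat.mod_lt _ hG0), hz, hgM,
        Nat.div_add_mod']
    have hb1 : o / φ ^ 4 * φ ^ 2 ≤ o := by
      calc o / φ ^ 4 * φ ^ 2 ≤ o / φ ^ 4 * φ ^ 4 :=
            Nat.mul_le_mul_left _ (Nat.pow_le_pow_right (by omega) (by norm_num))
        _ ≤ o := Nat.div_mul_le_self _ _
    have hb2 := Nat.mod_lt i hG0
    have et : Ev w s (slotE offsetE (paramE 5) (paramE 4)) (o / φ ^ 4 * φ ^ 2 + i % φ ^ 2) :=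
      Ev.add (Ev.mul (Ev.div hwf eo p5) p4 (by omega)) (Ev.mod hwf v3 p4) (by omega)
    have e1 := hpacked 14 (by omega) (sparseField x M (φ ^ 2) (φ ^ 4)) _ _ et ht
      (by rw [EliasFano.stream])
    rw [f2, Nat.mod_eq_of_lt (by omega)] at e1
    exact (Ev.add eP e1 (by omega)).congr (by omega)
  -- Dense small group: the answer lies within the next `φ ^ 4` bits, and the pattern table finds
  -- it.
  · have hsp : ¬ IsSparse x (φ ^ 2) (φ ^ 4) (i / φ ^ 2) := by intro h'; simp [h'] at h
    have hio := lt_of_not_isSparse hx hG0 hsp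
    rw [← ho] at hio
    obtain ⟨p, hp, ep, hbits⟩ := hpat o hoi hio eo p5 p1
    have hsel := patternSelect_eq hx hgi hio hbits
    rw [← ho] at hsel
    have ht := t5 p hp
    have hpG := (Nat.le_add_right (p * φ ^ 2) (i % φ ^ 2)).trans_lt ht
    have e1 := hstr 15 (by omega) _ ht
    simp only [EliasFano.stream] at e1
    rw [cell_add_div (Nat.mod_lt _ hG0), cell_add_mod (Nat.mod_lt _ hG0),
      show i % φ ^ 2 = i - i / φ ^ 2 * φ ^ 2 by
        have := Nat.div_add_mod' i (φ ^ 2); omega, hsel] at e1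
    refine (Ev.add eo (e1 (by omega) _ ((Ev.add (Ev.mul ep p4 (by omega)) (Ev.mod hwf v3 p4)
      (by omega)).congr ?_)) (by omega)).congr (by omega)
    have := Nat.div_add_mod' i (φ ^ 2); omega

end

end WordRAM

/-! ### Correctness of access -/

namespace WordRAM

open EliasFano

section

variable {n m w : ℕ} {A : List ℕ} {s : State}

/-- The low-order bits of an element, read from the compact format. -/
theorem getView_compact (hA : IsSortedList n m A) (hn : 4 ≤ n) (hm : n ≤ m) {i : ℕ} (hi : i < n) :
    getView (cellWidth m) (cellWidth m) 0 (compact m A) (i * lowWidth n m) (lowWidth n m) =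
      A.getD i 0 % 2 ^ lowWidth n m := by
  have hl := lowWidth_add_two_le hn hm
  have hil : (i + 1) * lowWidth n m ≤ n * lowWidth n m := Nat.mul_le_mul_right _ hi
  have hnl : n * lowWidth n m ≤ n * cellWidth m := Nat.mul_le_mul_left _ (by omega)
  rw [add_mul, one_mul] at hil
  refine Nat.eq_of_testBit_eq fun k => ?_
  rw [Nat.testBit_mod_two_pow]
  by_cases hk : k < lowWidth n m
  · have h := testBit_getView (compact m A) (b := cellWidth m) (W := cellWidth m) (off := 0)
      (by omega) (v := i * lowWidth n m) (len := lowWidth n m) (by omega)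
      (j := lowWidth n m - 1 - k) (by omega)
    rw [show lowWidth n m - 1 - (lowWidth n m - 1 - k) = k by omega, viewPos_real,
      arrayBit_compact hA (by omega), bit_low hA (by omega), cell_add_div (by omega),
      cell_add_mod (by omega),
      show lowWidth n m - 1 - (lowWidth n m - 1 - k) = k by omega] at h
    rw [h, decide_eq_true hk, Bool.true_and]
  · rw [decide_eq_false hk, Bool.false_and]
    exact Nat.testBit_lt_two_pow ((getView_lt _).trans_le
      (Nat.pow_le_pow_right (by norm_num) (by omega)))

theorem runs_access_of_ev (hA : IsSortedList n m A) (hn : 4 ≤ n) (hm : n ≤ m) (hw : WordFits n m w)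
    (h2 : s.reg 2 = cellWidth m) (harr : s.arr = compact m A) {i : ℕ} (hi : i < n)
    (h3 : s.reg 3 = i) (hl : Ev w s lowE (lowWidth n m))
    (hx : Ev w s positionE (onePosition n m A i)) :
    Runs w (cellWidth m) access s (accessE.cost + 1) fun s' => s'.arr = compact m A ∧
      s'.reg 0 = A.getD i 0 := by
  have hb := lowWidth_add_two_le hn hm
  have hw2 : n * cellWidth m < 2 ^ w := hw.2
  have hil : (i + 1) * lowWidth n m ≤ n * lowWidth n m := Nat.mul_le_mul_right _ hi
  have hnl : n * lowWidth n m ≤ n * cellWidth m := Nat.mul_le_mul_left _ (by omega)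
  rw [add_mul, one_mul] at hil
  refine Runs.of_wf fun hwf => ?_
  have e1 := Ev.sub hwf hx (Ev.var' h3)
  have h4 : onePosition n m A i - i = A.getD i 0 / 2 ^ lowWidth n m := by
    rw [onePosition, if_pos hi, Nat.add_sub_cancel, high, hA.1]
  rw [h4] at e1
  have h5 := Nat.div_add_mod' (A.getD i 0) (2 ^ lowWidth n m)
  have h6 := (hA.getD_lt hi).trans hw.1
  have e2 := Ev.shl e1 hl (by rw [Nat.shiftLeft_eq]; omega)
  have e3 := Ev.getView hwf (Ev.var' h2) (Ev.var' h2) (Ev.lit (w := w) (x := 0) (by omega))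
    (Ev.mul (Ev.var' h3) hl (by omega)) hl (by omega) (by omega) (by rw [viewPos_real]; omega)
    (fun j hj => by rw [viewPos_real]; omega) (by omega)
  rw [harr, getView_compact hA hn hm hi] at e3
  rw [Nat.shiftLeft_eq] at e2
  exact Runs.assign ((Ev.add e2 e3 (by omega)).congr h5) ⟨harr, by simp⟩ le_rfl

/-- Entry 0 serves both as the flag for explicit tables and as the width `b - l`, which is at least
2 and thus nonzero. The width is stored because its computation would not take constant time. -/
theorem Ev.low_and_position_plain (hA : IsSortedList n m A) (hn : 4 ≤ n) (hm : n ≤ m)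
    (hw : WordFits n m w) (hwf : WF w (cellWidth m) s) (h2 : s.reg 2 = cellWidth m) {i : ℕ}
    (hi : i < n) (h3 : s.reg 3 = i)
    (htab : s.table = plainTable n (cellWidth m - lowWidth n m) (onePosition n m A)) :
    Ev w s lowE (lowWidth n m) ∧ Ev w s positionE (onePosition n m A i) := by
  have h8 := hw.eight_le hn hm
  have hb := lowWidth_add_two_le hn hm
  have hw2 : n * cellWidth m < 2 ^ w := hw.2
  have h2n : n * 2 ≤ n * cellWidth m := Nat.mul_le_mul_left _ (by omega)
  have hget : ∀ a, a < 2 * n + 1 → s.table.getD a 0 = if a = 0 then cellWidth m - lowWidth n m else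
      if a % 2 = 1 then onePosition n m A (a / 2) / 4 else onePosition n m A (a / 2 - 1) % 4 := by
    intro a ha
    rw [htab, plainTable, getD_map_range _ ha]
  have e0 : Ev w s (paramE 0) (cellWidth m - lowWidth n m) :=
    (Ev.look (Ev.lit (by omega))).congr ((hget 0 (by omega)).trans (if_pos rfl))
  have hx : onePosition n m A i < 2 ^ w := by
    have h1 := onePosition_strictMono hA
    have h4 : n * lowWidth n m + (high m A i + i) < n * cellWidth m := high_add_lt hA hn hm hi
    rw [onePosition, if_pos hi]
    omega
  refine ⟨(Ev.sub hwf (Ev.var' h2) (Ev.cond e0 (fun _ => e0) fun h => by omega)).congr (by omega),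
    Ev.cond e0 (fun _ => ?_) fun h => by omega⟩
  have e1 : Ev w s (.bin .mul (.lit 2) (.var 3)) (2 * i) :=
    Ev.mul (Ev.lit (by omega)) (Ev.var' h3) (by omega)
  refine Ev.pair ((Ev.look (Ev.add e1 (Ev.lit (x := 1) (by omega)) (by omega))).congr ?_)
    ((Ev.look (Ev.add e1 (Ev.lit (x := 2) (by omega)) (by omega))).congr ?_) hx (by omega)
  · rw [hget _ (by omega), if_neg (by omega), if_pos (by omega)]
    congr 2; omega
  · rw [hget _ (by omega), if_neg (by omega), if_neg (by omega)]
    congr 2; omega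

/-- Needed for storing this width in one table cell: it is at most `1 + ⌈lg n⌉`, and `⌈lg n⌉ ≥ 2`.
-/
theorem highWidth_lt_two_pow (hn : 4 ≤ n) :
    cellWidth m - lowWidth n m < 2 ^ Nat.clog 2 n := by
  have h1 := cellWidth_le (m := m) (show 0 < n by omega)
  have h2 : 2 ≤ Nat.clog 2 n := by
    by_contra h
    have h3 := Nat.le_pow_clog (b := 2) (by norm_num) n
    have : 2 ^ Nat.clog 2 n ≤ 2 ^ 1 := Nat.pow_le_pow_right (by norm_num) (by omega)
    omega
  obtain ⟨k, hk⟩ := Nat.exists_eq_add_of_le h2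
  have h3 := Nat.lt_two_pow_self (n := k)
  rw [hk, pow_add]
  omega

theorem Ev.low_and_position_select (hA : IsSortedList n m A) (hn : 4 ≤ n) (hm : n ≤ m)
    (hw : WordFits n m w) (hwf : WF w (cellWidth m) s) (hlarge : IsLarge n) (h0 : s.reg 0 = n)
    (h2 : s.reg 2 = cellWidth m) (harr : s.arr = compact m A) {i : ℕ} (hi : i < n)
    (h3 : s.reg 3 = i)
    (htab : s.table = selectTable n (cellWidth m - lowWidth n m) (onePosition n m A)) :
    Ev w s lowE (lowWidth n m) ∧ Ev w s positionE (onePosition n m A i) := by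
  have h8 := hw.eight_le hn hm
  have hS := sizes (by omega) hlarge
  have hbig : ¬ n < 64 := by
    have := hS.lower
    have := hS.pow_le
    have := Nat.le_self_pow (show 4 ≠ 0 by norm_num) (Nat.clog 2 n)
    omega
  have hb := lowWidth_add_six_le hbig hm
  have hw2 : n * cellWidth m < 2 ^ w := hw.2
  have hx := onePosition_strictMono hA
  have hq := highWidth_lt_two_pow (m := m) hn
  have h6 : n * lowWidth n m + n * 6 ≤ n * cellWidth m := by
    rw [← mul_add]; exact Nat.mul_le_mul_left _ hb
  have hxi := onePosition_lt hA hi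
  have hlook : ∀ j < 16, ∀ t < streamLength (Nat.clog 2 n) (fieldWidth n) n,
      EliasFano.stream (Nat.clog 2 n) (fieldWidth n) (cellWidth m - lowWidth n m)
        (onePosition n m A) j t < 2 ^ Nat.clog 2 n → s.table.getD (16 * t + j) 0 =
      EliasFano.stream (Nat.clog 2 n) (fieldWidth n) (cellWidth m - lowWidth n m)
        (onePosition n m A) j t := by
    intro j hj t ht h
    rw [htab, selectTable_getD hj ht h]
  have e0 : Ev w s (paramE 0) 0 :=
    (Ev.look (Ev.lit (by omega))).congr (hlook 0 (by omega) 0 (lt_add_five (Or.inl (Nat.succ_pos _)))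
      (by rw [EliasFano.stream]; positivity; all_goals omega))
  have e1 : Ev w s (paramE 1) (cellWidth m - lowWidth n m) :=
    (Ev.look (Ev.lit (by omega))).congr (hlook 1 (by omega) 0 (lt_add_five (Or.inl (Nat.succ_pos _)))
      hq)
  have el : Ev w s lowE (lowWidth n m) :=
    (Ev.sub hwf (Ev.var' h2) (Ev.cond e0 (fun h => absurd rfl h) fun _ => e1)).congr (by omega)
  refine ⟨el, Ev.cond e0 (fun h => absurd rfl h) fun _ => ?_⟩
  refine Ev.largePosition hS hx hwf (by omega) hq hlook hi h3 hxi fun v hv hvS ev e5 _ => ?_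
  -- The pattern is no longer than a cell, so it meets at most two cells and is read in constant
  -- time.
  have hSL : fieldWidth n ^ 4 ≤ Nat.clog 2 n := by have := hS.large; omega
  have hLb : Nat.clog 2 n ≤ cellWidth m := Nat.clog_mono_right 2 hm
  have hLn := clog_le_self n
  refine ⟨WordRAM.getView (cellWidth m) (cellWidth m) 0 s.arr (n * lowWidth n m + v) (fieldWidth n ^ 4),
    getView_lt _, Ev.getView hwf (Ev.var' h2) (Ev.var' h2) (Ev.lit (x := 0) (by omega))
      (Ev.add (Ev.mul (Ev.var' h0) el (by omega)) ev (by omega)) e5 (by omega) (by omega)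
      (by rw [viewPos_real]; omega) (fun j hj => by rw [viewPos_real]; omega) (by omega), ?_⟩
  intro j hj
  rw [testBit_getView _ (by omega) (by omega) (by omega), viewPos_real, harr, add_assoc,
    arrayBit_compact_high hA hn hm, decide_eq_true_iff]
  constructor
  · rintro ⟨k, hk, h⟩
    exact ⟨k, by rw [onePosition, if_pos hk, h]⟩
  · rintro ⟨k, h⟩
    -- The continuation of the positions cannot interfere: a value of at most `x i` belongs to an
    -- index of at most `i`.
    have hk : k < n := (hx.le_iff_le.mp
      (show onePosition n m A k ≤ onePosition n m A i by omega)).trans_lt hi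
    rw [onePosition, if_pos hk] at h
    exact ⟨k, hk, h⟩

end

/-- The initial states are admissible. -/
theorem wf_start {n m w : ℕ} {Z table xs : List ℕ} (hw : WordFits n m w)
    (hxs : ∀ x ∈ xs, x < 2 ^ w) (hZ : ∀ x ∈ Z, x < 2 ^ cellWidth m) (ht : ∀ x ∈ table, x < 2 ^ w) :
    WF w (cellWidth m) (start xs Z table) where
  le := cellWidth_le_of_fits hw.1
  reg := fun r => getD_lt hxs (by positivity) r
  arr := hZ
  table := ht

theorem start_abs_reg {xs Z table : List ℕ} {r : ℕ} (hr : r < 4) :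
    (start xs Z table).abs.reg r = xs.getD r 0 := by
  simp [start, State.abs, vreg, hr]

theorem start_abs_reg_eq_zero {xs Z table : List ℕ} {r : ℕ} (hr : 4 ≤ r) (hxs : xs.length ≤ 4) :
    (start xs Z table).abs.reg r = 0 := by
  simp only [start, State.abs, vreg, if_neg (not_lt.mpr hr)]
  exact List.getD_eq_default _ _ (by omega)

end WordRAM

/-! ### Choice of the table and of the word size -/

namespace EliasFano

theorem exists_aux_table {n m w : ℕ} {A : List ℕ} (hA : IsSortedList n m A) (hn : 4 ≤ n)
    (hm : n ≤ m) (hw : WordFits n m w) :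
    ∃ aux : List ℕ, aux.length * Nat.clog 2 n ≤ auxBits n ∧ (∀ x ∈ aux, x < 2 ^ Nat.clog 2 n) ∧
      ∀ i < n, ∀ s : WordRAM.State, WordRAM.WF w (cellWidth m) s → s.reg 0 = n →
        s.reg 2 = cellWidth m → s.reg 3 = i → s.arr = compact m A → s.table = aux →
        WordRAM.Ev w s WordRAM.lowE (lowWidth n m) ∧
        WordRAM.Ev w s WordRAM.positionE (onePosition n m A i) := by
  have h4 : 4 ≤ 2 ^ Nat.clog 2 n := hn.trans (Nat.le_pow_clog (by norm_num) n)
  have hn2 := Nat.le_pow_clog (b := 2) (by norm_num) n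
  by_cases hl : IsLarge n
  · refine ⟨selectTable n (cellWidth m - lowWidth n m) (onePosition n m A), ?_, ?_, ?_⟩
    · rw [auxBits, if_pos hl, selectTable, List.length_map, List.length_range]
    · intro x hx
      rw [selectTable, List.mem_map] at hx
      obtain ⟨a, -, rfl⟩ := hx
      exact Nat.mod_lt _ (by positivity)
    · intro i hi s hwf h0 h2 h3 harr htab
      exact WordRAM.Ev.low_and_position_select hA hn hm hw hwf hl h0 h2 harr hi h3 htab
  · refine ⟨plainTable n (cellWidth m - lowWidth n m) (onePosition n m A), ?_, ?_, ?_⟩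
    · rw [auxBits, if_neg hl, plainTable, List.length_map, List.length_range]
    · intro x hx
      rw [plainTable, List.mem_map] at hx
      obtain ⟨a, ha, rfl⟩ := hx
      rw [List.mem_range] at ha
      split_ifs with h1 h2
      · exact WordRAM.highWidth_lt_two_pow hn
      · have := onePosition_lt hA (show a / 2 < n by omega)
        omega
      · omega
    · intro i hi s hwf _ h2 h3 _ htab
      exact WordRAM.Ev.low_and_position_plain hA hn hm hw hwf h2 hi h3 htab

/-- Words of logarithmic length are admissible for universes of polynomial size. -/
theorem exists_wordFits (d : ℕ) {n m : ℕ} (hn : 4 ≤ n) (hd : m ≤ n ^ d) :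
    ∃ w, WordFits n m w ∧ (w : ℝ) ≤ 2 * (d + 2) * Real.logb 2 n := by
  have hn0 : (0 : ℝ) < n := by exact_mod_cast (by omega : 0 < n)
  have hn2 := Nat.le_pow_clog (b := 2) (by norm_num) n
  have hb : cellWidth m ≤ d * Nat.clog 2 n := by
    refine Nat.clog_le_of_le_pow (hd.trans ?_)
    rw [mul_comm, pow_mul]
    exact Nat.pow_le_pow_left hn2 d
  have hL1 : 1 ≤ Nat.clog 2 n := Nat.clog_pos (by norm_num) (by omega)
  have h1 : ((Nat.clog 2 n - 1 : ℕ) : ℝ) ≤ Real.logb 2 n := by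
    rw [Real.le_logb_iff_rpow_le (by norm_num) hn0, Real.rpow_natCast]
    exact_mod_cast (Nat.pow_pred_clog_lt_self (b := 2) (by norm_num) (by omega)).le
  have h2 : 1 ≤ Real.logb 2 n := by
    rw [Real.le_logb_iff_rpow_le (by norm_num) hn0, Real.rpow_one]
    exact_mod_cast (by omega : 2 ≤ n)
  have h3 : (Nat.clog 2 n : ℝ) ≤ 2 * Real.logb 2 n := by
    rw [Nat.cast_sub hL1, Nat.cast_one] at h1
    linarith
  -- Addresses of bits satisfy `n * b ≤ 2^L * 2^b`; the additional bit makes the inequality strict.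
  refine ⟨cellWidth m + Nat.clog 2 n + 1, ⟨?_, ?_⟩, ?_⟩
  · refine (le_two_pow_cellWidth m).trans_lt (Nat.pow_lt_pow_right (by norm_num) (by omega))
  · rw [pow_succ, pow_add]
    have h5 := Nat.mul_le_mul hn2 (Nat.lt_two_pow_self (n := cellWidth m)).le
    have : 0 < 2 ^ Nat.clog 2 n * 2 ^ cellWidth m := by positivity
    rw [mul_comm (2 ^ cellWidth m)]
    omega
  · have h4 : cellWidth m + Nat.clog 2 n + 1 ≤ (d + 2) * Nat.clog 2 n := by
      rw [add_mul]; omega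
    calc ((cellWidth m + Nat.clog 2 n + 1 : ℕ) : ℝ) ≤ ((d + 2) * Nat.clog 2 n : ℕ) := by
          exact_mod_cast h4
      _ = (d + 2) * (Nat.clog 2 n : ℝ) := by push_cast; ring
      _ ≤ (d + 2) * (2 * Real.logb 2 n) := by gcongr
      _ = _ := by ring

end EliasFano

/-! ### Assembly of the theorem -/

theorem mainTheorem2 :
    ∃ (encode decode access : WordRAM.Cmd) (C : ℕ) (f : ℕ → ℕ),
      -- the auxiliary structure for `access` takes `o(n)` bits
      (fun n => (f n : ℝ)) =o[Filter.atTop] (fun n : ℕ => (n : ℝ)) ∧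
      (∀ n m w : ℕ, 4 ≤ n → n ≤ m → EliasFano.WordFits n m w →
        ∀ A : List ℕ, EliasFano.IsSortedList n m A →
          -- the last `n lg n - 2 n` bits of the compact format are zero
          (∀ j : ℕ, j < n * EliasFano.cellWidth m →
            (n * EliasFano.cellWidth m : ℝ) - (n * Real.logb 2 n - 2 * n) ≤ j →
            EliasFano.arrayBit (EliasFano.cellWidth m) (EliasFano.compact m A) j = false) ∧
          -- switching from the plain to the compact format and back takes `O(n)` time
          (∃ (τ : WordRAM.State) (t : ℕ),
            WordRAM.Exec w (EliasFano.cellWidth m) encode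
              (WordRAM.start [n, m, EliasFano.cellWidth m] A []) τ t ∧
            τ.arr = EliasFano.compact m A ∧ t ≤ C * n) ∧
          (∃ (τ : WordRAM.State) (t : ℕ),
            WordRAM.Exec w (EliasFano.cellWidth m) decode
              (WordRAM.start [n, m, EliasFano.cellWidth m] (EliasFano.compact m A) []) τ t ∧
            τ.arr = A ∧ t ≤ C * n) ∧
          -- each element is accessible from the compact format in `O(1)` time
          (∃ aux : List ℕ, aux.length * Nat.clog 2 n ≤ f n ∧
            (∀ x ∈ aux, x < 2 ^ Nat.clog 2 n) ∧
            ∀ i < n, ∃ (τ : WordRAM.State) (t : ℕ),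
              WordRAM.Exec w (EliasFano.cellWidth m) access
                (WordRAM.start [n, m, EliasFano.cellWidth m, i] (EliasFano.compact m A) aux) τ t ∧
              τ.arr = EliasFano.compact m A ∧ τ.reg 0 = A.getD i 0 ∧ t ≤ C)) ∧
      -- the registers are the only extra space: `O(lg n)` bits if `m` is polynomial in `n`
      (∀ d : ℕ, ∃ D : ℕ, ∀ n m : ℕ, 4 ≤ n → n ≤ m → m ≤ n ^ d →
        ∃ w : ℕ, EliasFano.WordFits n m w ∧
          ((encode.regs ∪ decode.regs ∪ access.regs).card * w : ℝ) ≤ D * Real.logb 2 n) := by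
  obtain ⟨C₁, henc⟩ := WordRAM.runs_encode
  obtain ⟨C₂, hdec⟩ := WordRAM.runs_decode
  refine ⟨WordRAM.encode, WordRAM.decode, WordRAM.access, C₁ + C₂ + (WordRAM.accessE.cost + 1),
    EliasFano.auxBits, EliasFano.auxBits_isLittleO, ?_, ?_⟩
  · intro n m w hn hm hw A hA
    have hb : EliasFano.cellWidth m < 2 ^ w := by
      have h1 : 1 * EliasFano.cellWidth m ≤ n * EliasFano.cellWidth m :=
        Nat.mul_le_mul_right _ (by omega)
      have := hw.2
      omega
    have hnw : n < 2 ^ w := hm.trans_lt hw.1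
    have hAb : ∀ x ∈ A, x < 2 ^ EliasFano.cellWidth m := fun x hx =>
      (hA.2.2 x hx).trans_le (EliasFano.le_two_pow_cellWidth m)
    have hCb : ∀ x ∈ EliasFano.compact m A, x < 2 ^ EliasFano.cellWidth m :=
      EliasFano.packBits_lt
    have hargs : ∀ x ∈ [n, m, EliasFano.cellWidth m], x < 2 ^ w := by
      simp only [List.mem_cons, List.not_mem_nil, or_false, forall_eq_or_imp, forall_eq]
      exact ⟨hnw, hw.1, hb⟩
    refine ⟨fun j hj h => EliasFano.compact_last_bits hA hn hm hj h, ?_, ?_, ?_⟩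
    · obtain ⟨τ, t, h, ht, -, harr⟩ := henc n m w A
        (WordRAM.start [n, m, EliasFano.cellWidth m] A []).abs hn hm hw hA
        (WordRAM.start_abs_reg (by omega)) (WordRAM.start_abs_reg (by omega))
        (WordRAM.start_abs_reg (by omega)) (fun r hr => WordRAM.start_abs_reg_eq_zero hr (by simp))
        rfl _ (WordRAM.wf_start (table := []) hw hargs hAb (by simp)) rfl
      refine ⟨τ, t, h, harr, ht.trans (Nat.mul_le_mul_right _ (by omega))⟩
    · obtain ⟨τ, t, h, ht, -, harr⟩ := hdec n m w A
        (WordRAM.start [n, m, EliasFano.cellWidth m] (EliasFano.compact m A) []).abs hn hm hw hA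
        (WordRAM.start_abs_reg (by omega)) (WordRAM.start_abs_reg (by omega))
        (WordRAM.start_abs_reg (by omega)) (fun r hr => WordRAM.start_abs_reg_eq_zero hr (by simp))
        rfl _ (WordRAM.wf_start (table := []) hw hargs hCb (by simp)) rfl
      refine ⟨τ, t, h, harr, ht.trans (Nat.mul_le_mul_right _ (by omega))⟩
    · obtain ⟨aux, haux, hcell, hev⟩ := EliasFano.exists_aux_table hA hn hm hw
      refine ⟨aux, haux, hcell, fun i hi => ?_⟩
      -- Table cells are no wider than words, so lookups lose nothing.
      have hLw : Nat.clog 2 n ≤ w := Nat.clog_le_of_le_pow hnw.le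
      have hwf : WordRAM.WF w (EliasFano.cellWidth m)
          (WordRAM.start [n, m, EliasFano.cellWidth m, i] (EliasFano.compact m A) aux) :=
        WordRAM.wf_start hw
          (by
            simp only [List.mem_cons, List.not_mem_nil, or_false, forall_eq_or_imp, forall_eq]
            exact ⟨hnw, hw.1, hb, hi.trans hnw⟩)
          hCb fun x hx => (hcell x hx).trans_le (Nat.pow_le_pow_right (by norm_num) hLw)
      obtain ⟨hl, hx⟩ := hev i hi _ hwf.abs (WordRAM.start_abs_reg (by omega))
        (WordRAM.start_abs_reg (by omega)) (WordRAM.start_abs_reg (by omega)) rfl rfl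
      obtain ⟨τ, t, h, ht, -, harr, hreg⟩ := WordRAM.runs_access_of_ev hA hn hm hw
        (WordRAM.start_abs_reg (by omega)) rfl hi (WordRAM.start_abs_reg (by omega)) hl hx _ hwf rfl
      exact ⟨τ, t, h, harr, hreg, ht.trans (by omega)⟩
  · intro d
    -- The number of registers is a constant of the three programs, and `2 * (d + 2)` is the factor
    -- from `EliasFano.exists_wordFits`.
    refine ⟨(WordRAM.encode.regs ∪ WordRAM.decode.regs ∪ WordRAM.access.regs).card * (2 * (d + 2)),
      fun n m hn _ hd => ?_⟩
    obtain ⟨w, hw, h⟩ := EliasFano.exists_wordFits d hn hd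
    refine ⟨w, hw, ?_⟩
    generalize (WordRAM.encode.regs ∪ WordRAM.decode.regs ∪ WordRAM.access.regs).card = k
    calc (k * w : ℝ) ≤ k * (2 * (d + 2) * Real.logb 2 n) :=
          mul_le_mul_of_nonneg_left h (Nat.cast_nonneg k)
      _ = _ := by push_cast; ring
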